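/- A rooted triplet $ab|c$ on three distinct leaves $a,b,c$ is the rooted binary tree in which $a$ and $b$ are the children of one child of the root and $c$ is the other child of the root. A rooted binary tree $T$ over a finite nonempty set $V$ (its leaves are in one-to-one correspondence with $V$) is consistent with $ab|c$ if the restriction $T_{|\{a,b,c\}}$ (delete the other leaves and suppress nodes with one child) equals $ab|c$, and inconsistent with it otherwise. A set $\mathcal R$ of rooted triplets on $V$ is dense if it contains exactly one rooted triplet on every three-element subset of $V$. An instance of $k$-Dense Rooted Triplet Inconsistency is a triple $(V,\mathcal R,k)$ with $V$ finite and nonempty, $\mathcal R$ a dense set of rooted triplets on $V$ and $k\ge 0$ an integer; it is positive if some rooted binary tree over $V$ is inconsistent with at most $k$ triplets of $\mathcal R$. **Theorem.** $k$-Dense Rooted Triplet Inconsistency admits a kernel with at most $5k$ vertices. That is, there is an algorithm that transforms every instance $(V,\mathcal R,k)$, in time polynomial in the size of the instance ($V$ and $\mathcal R$ listed explicitly, $k$ written in binary), into an instance $(V',\mathcal R',k')$ of the same problem such that $(V',\mathcal R',k')$ is positive if and only if $(V,\mathcal R,k)$ is positive, $k'\le k$, and $|V'|\le 5k$ if $k\ge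 1$, while $|V'|\le 4$ if $k=0$. -/

import Mathlib

/-! ### Polynomial time: WHILE programs over binary trees

The machine model is the classical WHILE language over binary trees (LISP-style data).  Time is
charged conservatively: evaluating an expression costs the total size of all the trees that are
read or produced on the way, so that no large tree is ever handled for free. -/

namespace While

/-- The data of the language: binary trees without labels. -/
inductive Data : Type
  | nil : Data
  | cons : Data → Data → Data

namespace Data

/-- The number of nodes of a tree, leaves included. -/
def size : Data → ℕ
  | nil => 1
  | cons d e => size d + size e + 1

/-- The first component of a pair; the value `nil` is returned on `nil`. -/
def hd : Data → Data
  | nil => nil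
  | cons d _ => d

/-- The second component of a pair; the value `nil` is returned on `nil`. -/
def tl : Data → Data
  | nil => nil
  | cons _ e => e

/-- Lists of data. -/
def ofList : List Data → Data
  | [] => nil
  | d :: l => cons d (ofList l)

/-- Natural numbers in unary. -/
def ofUnary : ℕ → Data
  | 0 => nil
  | n + 1 => cons nil (ofUnary n)

/-- Bits. -/
def ofBool : Bool → Data
  | false => nil
  | true => cons nil nil

/-- Natural numbers in binary, the least significant bit first. -/
def ofBinary (n : ℕ) : Data :=
  ofList (n.bits.map ofBool)

end Data

/-- A store assigns a value to each variable; the variables are the natural numbers. -/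
abbrev Store : Type := ℕ → Data

/-- Expressions. -/
inductive Expr : Type
  | var : ℕ → Expr
  | nil : Expr
  | cons : Expr → Expr → Expr
  | hd : Expr → Expr
  | tl : Expr → Expr

namespace Expr

/-- The value of an expression in a store. -/
def eval : Expr → Store → Data
  | var x, s => s x
  | nil, _ => Data.nil
  | cons e f, s => Data.cons (eval e s) (eval f s)
  | hd e, s => (eval e s).hd
  | tl e, s => (eval e s).tl

/-- The cost of evaluating an expression: every subexpression is charged the size of its value. -/
def cost : Expr → Store → ℕ
  | var x, s => (s x).size
  | nil, _ => 1
  | cons e f, s => cost e s + cost f s + ((cons e f).eval s).size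
  | hd e, s => cost e s + ((hd e).eval s).size
  | tl e, s => cost e s + ((tl e).eval s).size

end Expr

/-- Commands: assignment, sequential composition, branching and while loop.  In a test, `nil`
counts as false and any other value as true. -/
inductive Cmd : Type
  | assign : ℕ → Expr → Cmd
  | seq : Cmd → Cmd → Cmd
  | ite : Expr → Cmd → Cmd → Cmd
  | loop : Expr → Cmd → Cmd

/-- `Exec c s t s'`: the command `c`, started in the store `s`, halts in the store `s'`, after
time `t`. -/
inductive Exec : Cmd → Store → ℕ → Store → Prop
  | assign (x : ℕ) (e : Expr) (s : Store) :
      Exec (Cmd.assign x e) s (1 + e.cost s) (Function.update s x (e.eval s))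
  | seq {c d : Cmd} {s s' s'' : Store} {m n : ℕ} (hc : Exec c s m s') (hd : Exec d s' n s'') :
      Exec (Cmd.seq c d) s (m + n) s''
  | iteTrue {e : Expr} {c d : Cmd} {s s' : Store} {m : ℕ} (he : e.eval s ≠ Data.nil)
      (hc : Exec c s m s') : Exec (Cmd.ite e c d) s (1 + e.cost s + m) s'
  | iteFalse {e : Expr} {c d : Cmd} {s s' : Store} {m : ℕ} (he : e.eval s = Data.nil)
      (hd : Exec d s m s') : Exec (Cmd.ite e c d) s (1 + e.cost s + m) s'
  | loopTrue {e : Expr} {c : Cmd} {s s' s'' : Store} {m n : ℕ} (he : e.eval s ≠ Data.nil)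
      (hc : Exec c s m s') (hl : Exec (Cmd.loop e c) s' n s'') :
      Exec (Cmd.loop e c) s (1 + e.cost s + m + n) s''
  | loopFalse {e : Expr} {c : Cmd} {s : Store} (he : e.eval s = Data.nil) :
      Exec (Cmd.loop e c) s (1 + e.cost s) s

/-- The initial store on input `x`: variable `0` holds `x`, every other variable holds `nil`. -/
def initStore (x : Data) : Store :=
  Function.update (fun _ => Data.nil) 0 x

/-- The program `P`, on input `x`, halts after time `t` with output `y` (found in variable `0`). -/
def Outputs (P : Cmd) (x y : Data) (t : ℕ) : Prop :=
  ∃ s : Store, Exec P (initStore x) t s ∧ s 0 = y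

end While

/-! ### Rooted binary trees and rooted triplets -/

namespace RTI

/-- Rooted binary trees with leaves labelled by `V` (drawn in the plane; see `BinTree.Iso`). -/
inductive BinTree (V : Type*) : Type _
  | leaf : V → BinTree V
  | node : BinTree V → BinTree V → BinTree V

namespace BinTree

variable {V : Type*}

/-- The labels of the leaves, from left to right. -/
def leaves : BinTree V → List V
  | leaf v => [v]
  | node l r => leaves l ++ leaves r

/-- `T` is a tree over `V`: its leaves are in one-to-one correspondence with `V`. -/
def IsOver (T : BinTree V) : Prop :=
  T.leaves.Nodup ∧ ∀ v : V, v ∈ T.leaves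

/-- Equality of rooted trees with labelled leaves, where the order of the two children of a node
is irrelevant. -/
inductive Iso : BinTree V → BinTree V → Prop
  | leaf (v : V) : Iso (leaf v) (leaf v)
  | node {l l' r r' : BinTree V} (hl : Iso l l') (hr : Iso r r') : Iso (node l r) (node l' r')
  | swap {l l' r r' : BinTree V} (hl : Iso l l') (hr : Iso r r') : Iso (node l r) (node r' l')

open Classical in
/-- The restriction of a tree to a set `S` of leaves: the leaves outside `S` are deleted and the
nodes that are left with a single child are suppressed.  The value is `none` if no leaf of the
tree lies in `S`. -/
noncomputable def restrict (S : Set V) : BinTree V → Option (BinTree V)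
  | leaf v => if v ∈ S then some (leaf v) else none
  | node l r =>
    match restrict S l, restrict S r with
    | none, r' => r'
    | some l', none => some l'
    | some l', some r' => some (node l' r')

end BinTree

/-- The rooted triplet `ab|c` on three distinct leaves: `pair` is `{a, b}` and `apex` is the chosen
leaf `c`. -/
@[ext]
structure Triplet (V : Type*) where
  pair : Sym2 V
  apex : V
  not_isDiag : ¬ pair.IsDiag
  apex_notMem : apex ∉ pair

namespace Triplet

variable {V : Type*}

/-- The set of the three leaves of a rooted triplet. -/
def leaves (t : Triplet V) : Set V :=
  {v | v ∈ t.pair ∨ v = t.apex}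

/-- `t = ab|c` is consistent with `T`: the restriction of `T` to the leaves of `t` is the tree in
which `a` and `b` are the children of one child of the root and `c` is the other child. -/
def ConsistentWith (t : Triplet V) (T : BinTree V) : Prop :=
  ∃ a b : V, t.pair = s(a, b) ∧ ∃ T' : BinTree V, T.restrict t.leaves = some T' ∧
    T'.Iso (.node (.node (.leaf a) (.leaf b)) (.leaf t.apex))

end Triplet

/-- A set of rooted triplets is dense if it has exactly one triplet on every three leaves. -/
def Dense {V : Type*} (R : Finset (Triplet V)) : Prop :=
  ∀ S : Finset V, S.card = 3 → ∃! t : Triplet V, t ∈ R ∧ t.leaves = (S : Set V)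

open Classical in
/-- The rooted triplets of `R` that are inconsistent with `T`. -/
noncomputable def inconsistent {V : Type*} (R : Finset (Triplet V)) (T : BinTree V) :
    Finset (Triplet V) :=
  R.filter fun t => ¬ t.ConsistentWith T

/-- An instance of Dense Rooted Triplet Inconsistency: a nonempty set `{0, …, n - 1}` of leaves, a
dense set of rooted triplets on it, and a budget `k` (the parameter). -/
structure Instance where
  n : ℕ
  n_pos : 0 < n
  triplets : Finset (Triplet (Fin n))
  dense : Dense triplets
  k : ℕ

namespace Instance

open While

/-- Positive instances: some rooted binary tree over the leaf set is inconsistent with at most `k`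
of the given triplets. -/
def Positive (I : Instance) : Prop :=
  ∃ T : BinTree (Fin I.n), T.IsOver ∧ (inconsistent I.triplets T).card ≤ I.k

/-- `d` is a code of the rooted triplet `ab|c`, namely `(a, b, c)` or `(b, a, c)`. -/
def TripletCode {n : ℕ} (t : Triplet (Fin n)) (d : Data) : Prop :=
  ∃ a b : Fin n, t.pair = s(a, b) ∧
    d = .cons (.ofUnary a) (.cons (.ofUnary b) (.ofUnary t.apex))

/-- `x` is a code of the instance `I`: the number of leaves, a list of the triplets in an arbitrary
order and without repetitions, and the budget in binary. -/
def Code (I : Instance) (x : Data) : Prop :=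
  ∃ (ts : List (Triplet (Fin I.n))) (ds : List Data),
    ts.Nodup ∧ (∀ t, t ∈ ts ↔ t ∈ I.triplets) ∧ List.Forall₂ TripletCode ts ds ∧
    x = .cons (.ofUnary I.n) (.cons (.ofList ds) (.ofBinary I.k))

end Instance

end RTI

/-! Call `ab|c` in the input together with a leaf `d` a violation if neither `db|c` nor `ab|d` is in
the input. Every tree misses a triplet on `abc`, `dbc` or `abd`. A greedy packing accepts a
violation only if none of these three triples lies inside the set `W` of leaves covered so far. Each
acceptance therefore charges a new inconsistent triplet: `p` acceptances mean that every tree misses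
at least `p` triplets (`pack_le_cost`), while `W` has at most `4p` leaves.

The triplets at a leaf `x` outside `W` form a caterpillar with `x` at the bottom (`exists_rank`),
and they force a triplet on any three other leaves that they distinguish (`Touches.forces`). The
input can contradict a forced triplet only inside `W` (`Forces.of_packed`). Any tree can be rebuilt
around `x` by hanging the clusters of equal rank along a spine and keeping the old tree inside each
cluster; this preserves agreement at the other uncovered leaves (`exists_agreesAt`).

Join an uncovered leaf `x` to each triplet `t` that contradicts what `x` forces. For an edge `(t,
x)`, every tree misses `t` or a triplet on `x` and two leaves of `t`. Since `t` lies in `W` and `x`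
does not, the edges of a matching yield distinct missed triplets (`length_le_countP`), so a matching
with more than `k` edges certifies a negative instance. Otherwise, if `n > 5k`, at least `n - 4p >
k` leaves are uncovered and one of them is unmatched. Let `X` be the leaves reached by alternating
paths from unmatched leaves. If no augmenting path exists, then, as in the theorems of Hall and
Kőnig, the set `F` of triplets in conflict with `X` is matched into `X` (`exists_mem_matching`). So
every tree misses at least `|F|` triplets touched by `X`, and correcting exactly `F` is an optimal
way to satisfy all of them. After that correction, at price `|F|`, a leaf of `X` is redundant and is
deleted (`pos_edit`). Each such round removes a leaf, so `n` rounds suffice.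

Trees enter only through ternary relations on `ℕ` that satisfy `TreeRel`; `BinTree.treeRel_extend`
and `TreeRel.exists_tree` translate in both directions. Polynomial time is handled by the class
`PT`, which is closed under composition, pairing, branching and folds of bounded growth, so that
`fun_prop` derives it from the shape of the algorithm. The budget, given in binary, is capped at `n`
before it is written in unary. -/

namespace While

/-! ### Polynomially bounded functions -/

/-- Monotone functions with a polynomial upper bound. -/
def PolyBdd (T : ℕ → ℕ) : Prop :=
  Monotone T ∧ ∃ p : Polynomial ℕ, ∀ n, T n ≤ p.eval n

theorem monotone_eval_polynomial (p : Polynomial ℕ) : Monotone fun n => p.eval n := by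
  induction p using Polynomial.induction_on' with
  | add p q hp hq =>
    intro a b h
    simpa using add_le_add (hp h) (hq h)
  | monomial n c =>
    intro a b h
    simpa using Nat.mul_le_mul_left c (Nat.pow_le_pow_left h n)

namespace PolyBdd

theorem const (c : ℕ) : PolyBdd fun _ => c :=
  ⟨monotone_const, .C c, fun n => by simp⟩

theorem id : PolyBdd fun n => n :=
  ⟨monotone_id, .X, fun n => by simp⟩

theorem add {S T : ℕ → ℕ} (hS : PolyBdd S) (hT : PolyBdd T) : PolyBdd fun n => S n + T n := by
  obtain ⟨mS, p, hp⟩ := hS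
  obtain ⟨mT, q, hq⟩ := hT
  exact ⟨mS.add mT, p + q, fun n => by simpa using add_le_add (hp n) (hq n)⟩

theorem mul {S T : ℕ → ℕ} (hS : PolyBdd S) (hT : PolyBdd T) : PolyBdd fun n => S n * T n := by
  obtain ⟨mS, p, hp⟩ := hS
  obtain ⟨mT, q, hq⟩ := hT
  exact ⟨fun a b h => Nat.mul_le_mul (mS h) (mT h), p * q,
    fun n => by simpa using Nat.mul_le_mul (hp n) (hq n)⟩

theorem comp {S T : ℕ → ℕ} (hS : PolyBdd S) (hT : PolyBdd T) : PolyBdd fun n => S (T n) := by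
  obtain ⟨mS, p, hp⟩ := hS
  obtain ⟨mT, q, hq⟩ := hT
  refine ⟨mS.comp mT, p.comp q, fun n => ?_⟩
  simpa using (hp (T n)).trans (monotone_eval_polynomial p (hq n))

end PolyBdd

/-! ### Encodings -/

/-- Types whose elements are coded as data. -/
class Enc (α : Type) where
  enc : α → Data

open Enc (enc)

instance : Enc Unit := ⟨fun _ => .nil⟩
instance : Enc Bool := ⟨Data.ofBool⟩
instance : Enc ℕ := ⟨Data.ofUnary⟩
instance {α β : Type} [Enc α] [Enc β] : Enc (α × β) := ⟨fun p => .cons (enc p.1) (enc p.2)⟩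
instance {α : Type} [Enc α] : Enc (List α) := ⟨fun l => Data.ofList (l.map enc)⟩

/-- The size of the code of an element. -/
def len {α : Type} [Enc α] (a : α) : ℕ := (enc a).size

section Len

variable {α β : Type} [Enc α] [Enc β]

theorem enc_pair (a : α) (b : β) : enc (a, b) = .cons (enc a) (enc b) := rfl
theorem enc_nil : enc ([] : List α) = .nil := rfl
theorem enc_cons (a : α) (l : List α) : enc (a :: l) = .cons (enc a) (enc l) := rfl
theorem enc_false : enc false = .nil := rfl
theorem enc_true : enc true = .cons .nil .nil := rfl

/-- This identity lets list operations act on unary numbers: the predecessor is a tail, and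
iteration is a fold. -/
theorem enc_replicate (n : ℕ) : enc (List.replicate n ()) = enc n := by
  induction n with
  | zero => rfl
  | succ n ih => rw [List.replicate_succ, enc_cons, ih]; rfl

theorem size_enc (a : α) : (enc a).size = len a := rfl
theorem Data.one_le_size (d : Data) : 1 ≤ d.size := by cases d <;> simp [Data.size]
theorem one_le_len (a : α) : 1 ≤ len a := Data.one_le_size _
theorem len_pair (a : α) (b : β) : len (a, b) = len a + len b + 1 := rfl
theorem len_pair' (p : α × β) : len p = len p.1 + len p.2 + 1 := rfl
theorem len_nil : len ([] : List α) = 1 := rfl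
theorem len_cons (a : α) (l : List α) : len (a :: l) = len a + len l + 1 := rfl

theorem len_nat (n : ℕ) : len n = 2 * n + 1 := by
  induction n with
  | zero => rfl
  | succ n ih =>
    have : len (n + 1) = 1 + len n + 1 := rfl
    omega

theorem len_bool_le (b : Bool) : len b ≤ 3 := by cases b <;> decide

theorem len_append (l m : List α) : len (l ++ m) + 1 = len l + len m := by
  induction l with
  | nil => simp [len_nil, add_comm]
  | cons a l ih => simp only [List.cons_append, len_cons]; omega

theorem len_le_of_mem {a : α} {l : List α} (h : a ∈ l) : len a < len l := by
  induction l with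
  | nil => simp at h
  | cons b l ih =>
    rw [len_cons]
    rcases List.mem_cons.1 h with rfl | h
    · omega
    · have := ih h; omega

theorem length_lt_len (l : List α) : l.length < len l := by
  induction l with
  | nil => simp [len_nil]
  | cons b l ih => rw [len_cons, List.length_cons]; omega

theorem len_list_le {l : List α} {B : ℕ} (h : ∀ a ∈ l, len a ≤ B) :
    len l ≤ l.length * (B + 1) + 1 := by
  induction l with
  | nil => simp [len_nil]
  | cons b l ih =>
    have h1 := h b (by simp)
    have h2 := ih fun a ha => h a (by simp [ha])
    rw [len_cons, List.length_cons, Nat.succ_mul]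
    omega

end Len

/-! ### Running programs -/

/-- The program takes the first store to the second within the given time. -/
def Runs (P : Cmd) (s s' : Store) (b : ℕ) : Prop :=
  ∃ t ≤ b, Exec P s t s'

namespace Runs

theorem mono {P : Cmd} {s s' : Store} {b c : ℕ} (h : Runs P s s' b) (hbc : b ≤ c) :
    Runs P s s' c := by
  obtain ⟨t, ht, h⟩ := h
  exact ⟨t, ht.trans hbc, h⟩

theorem seq {P Q : Cmd} {s s' s'' : Store} {b c : ℕ} (hP : Runs P s s' b) (hQ : Runs Q s' s'' c) :
    Runs (.seq P Q) s s'' (b + c) := by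
  obtain ⟨t, ht, hP⟩ := hP
  obtain ⟨u, hu, hQ⟩ := hQ
  exact ⟨t + u, add_le_add ht hu, .seq hP hQ⟩

theorem assign (x : ℕ) (e : Expr) (s : Store) :
    Runs (.assign x e) s (Function.update s x (e.eval s)) (1 + e.cost s) :=
  ⟨_, le_rfl, .assign x e s⟩

end Runs

/-- The program computes `f` within time `T`: the argument and the value are in variable `0`, and
variable `1`, which holds a stack, is left as it was found. -/
def ComputesIn {α β : Type} [Enc α] [Enc β] (P : Cmd) (f : α → β) (T : ℕ → ℕ) : Prop :=
  ∀ (a : α) (s : Store), s 0 = enc a →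
    ∃ s', Runs P s s' (T (len a + (s 1).size)) ∧ s' 0 = enc (f a) ∧ s' 1 = s 1

/-- Polynomial-time functions between coded types. -/
def PT {α β : Type} [Enc α] [Enc β] (f : α → β) : Prop :=
  (∃ q, PolyBdd q ∧ ∀ a, len (f a) ≤ q (len a)) ∧ ∃ P T, PolyBdd T ∧ ComputesIn P f T

/-- The expression whose value is a given constant. -/
def Expr.ofData : Data → Expr
  | .nil => .nil
  | .cons d e => .cons (ofData d) (ofData e)

theorem Expr.eval_ofData (d : Data) (s : Store) : (Expr.ofData d).eval s = d := by
  induction d with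
  | nil => rfl
  | cons d e hd he => simp [Expr.ofData, Expr.eval, hd, he]

theorem Expr.cost_ofData (d : Data) (s s' : Store) :
    (Expr.ofData d).cost s = (Expr.ofData d).cost s' := by
  induction d with
  | nil => rfl
  | cons d e hd he =>
    simp only [Expr.ofData, Expr.cost, hd, he, Expr.eval, Expr.eval_ofData]

/-! ### Composition, pairing and branching of polynomial-time functions -/

namespace PT

variable {α β γ δ : Type} [Enc α] [Enc β] [Enc γ] [Enc δ]

/-- A function computed by a single assignment. -/
theorem of_expr {f : α → β} (e : Expr) (c : ℕ)
    (h : ∀ (a : α) (s : Store), s 0 = enc a → e.eval s = enc (f a) ∧ e.cost s ≤ c * len a + c) :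
    PT f := by
  -- Evaluation is charged the size of its value, so the linear cost bound also bounds the output.
  have hs : ∀ d (s : Store), e.eval s = d → d.size ≤ e.cost s := by
    rintro _ s rfl
    cases e <;> simp [Expr.cost, Expr.eval, Data.size]
  refine ⟨⟨fun n => c * n + c, .add (.mul (.const c) .id) (.const c), fun a => ?_⟩,
    .assign 0 e, fun n => c * n + c + 1, .add (.add (.mul (.const c) .id) (.const c)) (.const 1),
    fun a s hsa => ?_⟩
  · have := h a (fun _ => enc a) rfl
    exact (hs _ _ this.1).trans this.2
  · obtain ⟨h1, h2⟩ := h a s hsa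
    refine ⟨_, (Runs.assign 0 e s).mono ?_, ?_, ?_⟩
    · have : c * len a ≤ c * (len a + (s 1).size) := Nat.mul_le_mul_left _ (by omega)
      dsimp only
      omega
    · simp [h1]
    · simp

theorem id : PT fun a : α => a :=
  of_expr (.var 0) 1 fun a s hs => by simp [Expr.eval, Expr.cost, hs, size_enc]

theorem const (b : β) : PT fun _ : α => b :=
  of_expr (.ofData (enc b)) ((Expr.ofData (enc b)).cost fun _ => .nil) fun a s hs => by
    refine ⟨Expr.eval_ofData _ _, ?_⟩
    rw [Expr.cost_ofData _ s fun _ => .nil]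
    omega

/-- The second program is charged in terms of `len (f a)`. This is why `PT` carries a bound on the
output in terms of the argument alone, independent of the stack. -/
theorem comp {g : β → γ} {f : α → β} (hg : PT g) (hf : PT f) : PT fun a => g (f a) := by
  obtain ⟨⟨q, hq, hqf⟩, P, T, hT, hP⟩ := hf
  obtain ⟨⟨q', hq', hqg⟩, P', T', hT', hP'⟩ := hg
  refine ⟨⟨_, hq'.comp hq, fun a => (hqg _).trans (hq'.1 (hqf a))⟩, .seq P P',
    fun n => T n + T' (q n + n), .add hT (hT'.comp (.add hq .id)), fun a s hs => ?_⟩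
  obtain ⟨s1, r1, h1, h1'⟩ := hP a s hs
  obtain ⟨s2, r2, h2, h2'⟩ := hP' (f a) s1 h1
  refine ⟨s2, (r1.seq r2).mono (Nat.add_le_add_left (hT'.1 ?_) _), h2, h2'.trans h1'⟩
  rw [h1']
  exact add_le_add ((hqf a).trans (hq.1 (by omega))) (by omega)

/-- The subprograms may destroy every variable except the stack. So the argument is pushed before
`f` is computed, then exchanged with `f a` on the stack while `g` is computed, and finally `f a` is
popped. Variable `2` is needed only for the exchange. -/
theorem pair {f : α → β} {g : α → γ} (hf : PT f) (hg : PT g) : PT fun a => (f a, g a) := by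
  obtain ⟨⟨q, hq, hqf⟩, P, T, hT, hP⟩ := hf
  obtain ⟨⟨q', hq', hqg⟩, P', T', hT', hP'⟩ := hg
  refine ⟨⟨fun n => q n + q' n + 1, .add (.add hq hq') (.const 1), fun a => ?_⟩,
    .seq (.assign 1 (.cons (.var 0) (.var 1))) <| .seq P <|
    .seq (.assign 2 (.hd (.var 1))) <|
    .seq (.assign 1 (.cons (.var 0) (.tl (.var 1)))) <|
    .seq (.assign 0 (.var 2)) <| .seq P' <|
    .seq (.assign 0 (.cons (.hd (.var 1)) (.var 0))) (.assign 1 (.tl (.var 1))),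
    -- The arguments of `T` and `T'` account for the stack, which has grown by a copy of `a`,
    -- respectively of `f a`. The factor `40` is generous room for the six assignments.
    fun n => 40 * (q n + q' n + n) + 40 + T (2 * n + 1) + T' (2 * n + q n + 1), ?_, fun a s hs => ?_⟩
  · have := hqf a
    have := hqg a
    dsimp only
    rw [len_pair]
    omega
  · exact .add (.add (.add (.mul (.const 40) (.add (.add hq hq') .id)) (.const 40))
      (hT.comp (.add (.mul (.const 2) .id) (.const 1))))
      (hT'.comp (.add (.add (.mul (.const 2) .id) hq) (.const 1)))
  set σ := s 1 with hσ
  set n := len a + σ.size with hn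
  have e1 := Runs.assign 1 (.cons (.var 0) (.var 1)) s
  set s1 := Function.update s 1 ((Expr.cons (.var 0) (.var 1)).eval s) with hs1
  have s10 : s1 0 = enc a := by simp [hs1, hs]
  have s11 : s1 1 = .cons (enc a) σ := by simp [hs1, Expr.eval, hs, hσ]
  obtain ⟨s2, e2, s20, s21⟩ := hP a s1 s10
  rw [s11] at s21
  have e3 := Runs.assign 2 (.hd (.var 1)) s2
  set s3 := Function.update s2 2 ((Expr.hd (.var 1)).eval s2) with hs3
  have s30 : s3 0 = enc (f a) := by simp [hs3, s20]
  have s31 : s3 1 = .cons (enc a) σ := by simp [hs3, s21]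
  have s32 : s3 2 = enc a := by simp [hs3, Expr.eval, s21, Data.hd]
  have e4 := Runs.assign 1 (.cons (.var 0) (.tl (.var 1))) s3
  set s4 := Function.update s3 1 ((Expr.cons (.var 0) (.tl (.var 1))).eval s3) with hs4
  have s41 : s4 1 = .cons (enc (f a)) σ := by simp [hs4, Expr.eval, s30, s31, Data.tl]
  have s42 : s4 2 = enc a := by simp [hs4, s32]
  have e5 := Runs.assign 0 (.var 2) s4
  set s5 := Function.update s4 0 ((Expr.var 2).eval s4) with hs5
  have s50 : s5 0 = enc a := by simp [hs5, Expr.eval, s42]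
  have s51 : s5 1 = .cons (enc (f a)) σ := by simp [hs5, s41]
  obtain ⟨s6, e6, s60, s61⟩ := hP' a s5 s50
  rw [s51] at s61
  have e7 := Runs.assign 0 (.cons (.hd (.var 1)) (.var 0)) s6
  set s7 := Function.update s6 0 ((Expr.cons (.hd (.var 1)) (.var 0)).eval s6) with hs7
  have s70 : s7 0 = .cons (enc (f a)) (enc (g a)) := by
    simp [hs7, Expr.eval, s60, s61, Data.hd]
  have s71 : s7 1 = .cons (enc (f a)) σ := by simp [hs7, s61]
  have e8 := Runs.assign 1 (.tl (.var 1)) s7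
  refine ⟨_, (e1.seq <| e2.seq <| e3.seq <| e4.seq <| e5.seq <| e6.seq <| e7.seq e8).mono ?_,
    by simpa [enc_pair] using s70, by simp [Expr.eval, s71, Data.tl]⟩
  have hq1 : len (f a) ≤ q n := (hqf a).trans (hq.1 (by omega))
  have hq2 : len (g a) ≤ q' n := (hqg a).trans (hq'.1 (by omega))
  have hT1 : T (len a + (s1 1).size) ≤ T (2 * n + 1) := hT.1 (by
    simp only [s11, Data.size, size_enc]; omega)
  have hT2 : T' (len a + (s5 1).size) ≤ T' (2 * n + q n + 1) := hT'.1 (by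
    simp only [s51, Data.size, size_enc]; omega)
  simp only [Expr.cost, Expr.eval, hs, ← hσ, s21, s30, s31, s42, s60, s61, s71, Data.size,
    Data.hd, Data.tl, size_enc]
  omega

theorem fst : PT fun p : α × β => p.1 :=
  of_expr (.hd (.var 0)) 2 fun a s hs => by
    obtain ⟨a, b⟩ := a
    simp only [Expr.eval, Expr.cost, hs, enc_pair, Data.size, Data.hd, size_enc, len_pair]
    exact ⟨trivial, by omega⟩

theorem snd : PT fun p : α × β => p.2 :=
  of_expr (.tl (.var 0)) 2 fun a s hs => by
    obtain ⟨a, b⟩ := a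
    simp only [Expr.eval, Expr.cost, hs, enc_pair, Data.size, Data.tl, size_enc, len_pair]
    exact ⟨trivial, by omega⟩

/-- Computing the test destroys the argument, so the test is paired with a copy of it. -/
theorem ite {p : α → Bool} {f g : α → β} (hp : PT p) (hf : PT f) (hg : PT g) :
    PT fun a => bif p a then f a else g a := by
  obtain ⟨⟨q, hq, hqf⟩, P, T, hT, hP⟩ := hf
  obtain ⟨⟨q', hq', hqg⟩, P', T', hT', hP'⟩ := hg
  obtain ⟨-, C, U, hU, hC⟩ := PT.pair hp PT.id
  refine ⟨⟨fun n => q n + q' n, .add hq hq', fun a => ?_⟩,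
    .seq C <| .seq (.assign 2 (.hd (.var 0))) <| .seq (.assign 0 (.tl (.var 0))) <|
      .ite (.var 2) P P', fun n => U n + 10 * n + 40 + T n + T' n,
    .add (.add (.add (.add hU (.mul (.const 10) .id)) (.const 40)) hT) hT', fun a s hs => ?_⟩
  · have := hqf a
    have := hqg a
    dsimp only
    cases p a <;> simp only [cond_true, cond_false] <;> omega
  obtain ⟨s1, e1, s10, s11⟩ := hC a s hs
  rw [enc_pair] at s10
  have e2 := Runs.assign 2 (.hd (.var 0)) s1
  set s2 := Function.update s1 2 ((Expr.hd (.var 0)).eval s1) with hs2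
  have s20 : s2 0 = .cons (enc (p a)) (enc a) := by simp [hs2, s10]
  have s21 : s2 1 = s 1 := by simp [hs2, s11]
  have s22 : s2 2 = enc (p a) := by simp [hs2, Expr.eval, s10, Data.hd]
  have e3 := Runs.assign 0 (.tl (.var 0)) s2
  set s3 := Function.update s2 0 ((Expr.tl (.var 0)).eval s2) with hs3
  have s30 : s3 0 = enc a := by simp [hs3, Expr.eval, s20, Data.tl]
  have s31 : s3 1 = s 1 := by simp [hs3, s21]
  have s32 : s3 2 = enc (p a) := by simp [hs3, s22]
  have hb := len_bool_le (p a)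
  cases hpa : p a with
  | true =>
    obtain ⟨s4, ⟨t, ht, e4⟩, s40, s41⟩ := hP a s3 s30
    have e5 : Runs (.ite (.var 2) P P') s3 s4 (1 + (Expr.var 2).cost s3 + t) :=
      ⟨_, le_rfl, .iteTrue (by simp [Expr.eval, s32, hpa, enc_true]) e4⟩
    refine ⟨s4, (e1.seq <| e2.seq <| e3.seq e5).mono ?_, by simpa [hpa] using s40, s41.trans s31⟩
    rw [s31] at ht
    simp only [Expr.cost, Expr.eval, s10, s20, s32, Data.size, Data.hd, Data.tl, size_enc]
    omega
  | false =>
    obtain ⟨s4, ⟨t, ht, e4⟩, s40, s41⟩ := hP' a s3 s30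
    have e5 : Runs (.ite (.var 2) P P') s3 s4 (1 + (Expr.var 2).cost s3 + t) :=
      ⟨_, le_rfl, .iteFalse (by simp [Expr.eval, s32, hpa, enc_false]) e4⟩
    refine ⟨s4, (e1.seq <| e2.seq <| e3.seq e5).mono ?_, by simpa [hpa] using s40, s41.trans s31⟩
    rw [s31] at ht
    simp only [Expr.cost, Expr.eval, s10, s20, s32, Data.size, Data.hd, Data.tl, size_enc]
    omega

end PT

end While

/-! ### Folds over lists -/

namespace While

open Enc (enc)

namespace PT

variable {α β γ δ : Type} [Enc α] [Enc β] [Enc γ] [Enc δ]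

/-- The body of the loop that computes a fold: variable `0` holds the list that is left, the
accumulator and the parameter. -/
def foldBody (S : Cmd) : Cmd :=
  .seq (.assign 1 (.cons (.cons (.tl (.hd (.var 0))) (.tl (.tl (.var 0)))) (.var 1))) <|
  .seq (.assign 0 (.cons (.tl (.tl (.var 0))) (.cons (.hd (.tl (.var 0))) (.hd (.hd (.var 0)))))) <|
  .seq S <|
  .seq (.assign 0 (.cons (.hd (.hd (.var 1))) (.cons (.var 0) (.tl (.hd (.var 1))))))
    (.assign 1 (.tl (.var 1)))

/-- The rest of the list and the parameter wait on the stack while `S` computes the new accumulator.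
The number `N` bounds the sizes involved before and after, so the cost can be stated in terms of `N`
alone. -/
theorem runs_foldBody {step : γ → β → α → β} {S : Cmd} {T : ℕ → ℕ} (hT : PolyBdd T)
    (hS : ComputesIn S (fun p : γ × β × α => step p.1 p.2.1 p.2.2) T) (c : γ) (b : β) (a : α)
    (l : List α) (s : Store) (hs : s 0 = enc (a :: l, b, c)) (N : ℕ)
    (hN : len (a :: l, b, c) + len (step c b a) + (s 1).size ≤ N) :
    ∃ s', Runs (foldBody S) s s' (40 * N + 40 + T (4 * N)) ∧ s' 0 = enc (l, step c b a, c) ∧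
      s' 1 = s 1 := by
  set σ := s 1 with hσ
  simp only [enc_pair, enc_cons] at hs
  have e1 := Runs.assign 1
    (.cons (.cons (.tl (.hd (.var 0))) (.tl (.tl (.var 0)))) (.var 1)) s
  set s1 := Function.update s 1
    ((Expr.cons (.cons (.tl (.hd (.var 0))) (.tl (.tl (.var 0)))) (.var 1)).eval s) with hs1
  have s10 : s1 0 = .cons (.cons (enc a) (enc l)) (.cons (enc b) (enc c)) := by simp [hs1, hs]
  have s11 : s1 1 = .cons (.cons (enc l) (enc c)) σ := by
    simp [hs1, Expr.eval, hs, ← hσ, Data.tl, Data.hd]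
  have e2 := Runs.assign 0
    (.cons (.tl (.tl (.var 0))) (.cons (.hd (.tl (.var 0))) (.hd (.hd (.var 0))))) s1
  set s2 := Function.update s1 0
    ((Expr.cons (.tl (.tl (.var 0))) (.cons (.hd (.tl (.var 0))) (.hd (.hd (.var 0))))).eval s1)
    with hs2
  have s20 : s2 0 = enc (c, b, a) := by
    simp [hs2, Expr.eval, s10, Data.tl, Data.hd, enc_pair]
  have s21 : s2 1 = .cons (.cons (enc l) (enc c)) σ := by simp [hs2, s11]
  obtain ⟨s3, e3, s30, s31⟩ := hS _ s2 s20
  rw [s21] at s31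
  have e4 := Runs.assign 0
    (.cons (.hd (.hd (.var 1))) (.cons (.var 0) (.tl (.hd (.var 1))))) s3
  set s4 := Function.update s3 0
    ((Expr.cons (.hd (.hd (.var 1))) (.cons (.var 0) (.tl (.hd (.var 1))))).eval s3) with hs4
  have s40 : s4 0 = enc (l, step c b a, c) := by
    simp [hs4, Expr.eval, s30, s31, Data.tl, Data.hd, enc_pair]
  have s41 : s4 1 = .cons (.cons (enc l) (enc c)) σ := by simp [hs4, s31]
  have e5 := Runs.assign 1 (.tl (.var 1)) s4
  refine ⟨_, (e1.seq <| e2.seq <| e3.seq <| e4.seq e5).mono ?_, by simpa using s40,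
    by simp [Expr.eval, s41, Data.tl]⟩
  simp only [len_pair, len_cons] at hN
  have hT1 : T (len (c, b, a) + (s2 1).size) ≤ T (4 * N) := hT.1 (by
    simp only [s21, Data.size, size_enc, len_pair]; omega)
  simp only [Expr.cost, Expr.eval, hs, ← hσ, s10, s30, s31, s41, Data.size, Data.hd, Data.tl,
    size_enc]
  omega

theorem runs_foldLoop {step : γ → β → α → β} {S : Cmd} {T : ℕ → ℕ} (hT : PolyBdd T)
    (hS : ComputesIn S (fun p : γ × β × α => step p.1 p.2.1 p.2.2) T) (c : γ) (N : ℕ)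
    (l : List α) : ∀ (b : β) (s : Store), s 0 = enc (l, b, c) →
    (∀ l1 l2, l = l1 ++ l2 → len (l1.foldl (step c) b) ≤ N) →
    len l + len c + (s 1).size ≤ N →
    ∃ s', Runs (.loop (.hd (.var 0)) (foldBody S)) s s'
        ((l.length + 1) * (400 * N + 100 + T (20 * N))) ∧
      s' 0 = enc (([] : List α), l.foldl (step c) b, c) ∧ s' 1 = s 1 := by
  induction l with
  | nil =>
    intro b s hs hb hN
    have := hb [] [] rfl
    simp only [List.foldl_nil, len_nil] at this hN
    refine ⟨s, ⟨_, ?_, .loopFalse ?_⟩, hs, rfl⟩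
    · simp only [Expr.cost, Expr.eval, hs, enc_pair, enc_nil, Data.size, Data.hd, size_enc,
        List.length_nil]
      omega
    · simp [Expr.eval, hs, enc_pair, enc_nil, Data.hd]
  | cons a l ih =>
    intro b s hs hb hN
    have hb0 := hb [] _ rfl
    have hb1 := hb [a] _ rfl
    simp only [List.foldl_nil, List.foldl_cons] at hb0 hb1
    rw [len_cons] at hN
    obtain ⟨s1, ⟨t1, ht1, e1⟩, s10, s11⟩ := runs_foldBody hT hS c b a l s hs (4 * N) (by
      simp only [len_pair, len_cons]
      have := one_le_len c
      omega)
    obtain ⟨s2, ⟨t2, ht2, e2⟩, s20, s21⟩ := ih (step c b a) s1 s10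
      (fun l1 l2 h => hb (a :: l1) l2 (by rw [h, List.cons_append]))
      (by rw [s11]; omega)
    refine ⟨s2, ⟨_, ?_, .loopTrue ?_ e1 e2⟩, s20, s21.trans s11⟩
    · have : T (4 * (4 * N)) ≤ T (20 * N) := hT.1 (by omega)
      simp only [Expr.cost, Expr.eval, hs, enc_pair, enc_cons, Data.size, Data.hd, size_enc,
        List.length_cons]
      rw [Nat.succ_mul (l.length + 1)]
      omega
    · simp [Expr.eval, hs, enc_pair, enc_cons, Data.hd]

/-- The bound on the accumulator after every prefix is a genuine hypothesis: a step that doubles the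
accumulator is polynomial, but its iterates grow exponentially. -/
theorem foldl {l : γ → List α} {init : γ → β} {step : γ → β → α → β} (hl : PT l) (hi : PT init)
    (hs : PT fun p : γ × β × α => step p.1 p.2.1 p.2.2)
    (hsize : ∃ q, PolyBdd q ∧
      ∀ c l1 l2, l c = l1 ++ l2 → len (l1.foldl (step c) (init c)) ≤ q (len c)) :
    PT fun c => (l c).foldl (step c) (init c) := by
  have hl' := hl
  obtain ⟨⟨r, hr, hrl⟩, -⟩ := hl'
  obtain ⟨-, P, U, hU, hP⟩ := pair hl (pair hi PT.id)
  obtain ⟨-, S, T, hT, hS⟩ := hs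
  obtain ⟨q, hq, hqs⟩ := hsize
  refine ⟨⟨q, hq, fun c => hqs c _ [] (by simp)⟩,
    .seq P <| .seq (.loop (.hd (.var 0)) (foldBody S)) (.assign 0 (.hd (.tl (.var 0)))),
    fun n => U n + r n * (400 * (q n + r n + n) + 100 + T (20 * (q n + r n + n))) +
      (10 * (q n + n) + 20), ?_, fun c s hsc => ?_⟩
  · exact .add (.add hU (.mul hr (.add (.add (.mul (.const _) (.add (.add hq hr) .id)) (.const _))
      (hT.comp (.mul (.const _) (.add (.add hq hr) .id))))))
      (.add (.mul (.const _) (.add hq .id)) (.const _))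
  set n := len c + (s 1).size with hn
  have hqn : q (len c) ≤ q n := hq.1 (by omega)
  have hrn : len (l c) ≤ r n := (hrl c).trans (hr.1 (by omega))
  obtain ⟨s1, e1, s10, s11⟩ := hP c s hsc
  obtain ⟨s2, e2, s20, s21⟩ := runs_foldLoop hT hS c (q n + r n + n) (l c) (init c) s1 s10
    (fun l1 l2 h => (hqs c l1 l2 h).trans (by omega)) (by rw [s11]; omega)
  have e3 := Runs.assign 0 (.hd (.tl (.var 0))) s2
  have hv := (hqs c (l c) [] (by simp)).trans hqn
  refine ⟨_, (e1.seq <| e2.seq e3).mono ?_, ?_, ?_⟩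
  · have : ((l c).length + 1) * (400 * (q n + r n + n) + 100 + T (20 * (q n + r n + n))) ≤
        r n * (400 * (q n + r n + n) + 100 + T (20 * (q n + r n + n))) :=
      Nat.mul_le_mul_right _ ((length_lt_len (l c)).trans_le hrn)
    simp only [Expr.cost, Expr.eval, s20, enc_pair, enc_nil, Data.size, Data.hd, Data.tl, size_enc,
      ← hn]
    omega
  · simp [Expr.eval, s20, enc_pair, Data.hd, Data.tl]
  · simp [s21, s11]

/-- Folds whose steps let the accumulator grow by an amount that does not depend on it. -/
theorem foldl_of_growth {l : γ → List α} {init : γ → β} {step : γ → β → α → β} (hl : PT l)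
    (hi : PT init) (hs : PT fun p : γ × β × α => step p.1 p.2.1 p.2.2)
    (hsize : ∃ q, PolyBdd q ∧ ∀ c b a, len (step c b a) ≤ len b + q (len c + len a)) :
    PT fun c => (l c).foldl (step c) (init c) := by
  refine foldl hl hi hs ?_
  obtain ⟨⟨r, hr, hrl⟩, -⟩ := hl
  obtain ⟨⟨r', hr', hri⟩, -⟩ := hi
  obtain ⟨q, hq, hqs⟩ := hsize
  refine ⟨fun n => r' n + r n * q (n + r n), .add hr' (.mul hr (hq.comp (.add .id hr))),
    fun c l1 l2 h => ?_⟩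
  have key : ∀ (l1 : List α) (b : β), (∀ a ∈ l1, a ∈ l c) →
      len (l1.foldl (step c) b) ≤ len b + l1.length * q (len c + r (len c)) := by
    intro l1
    induction l1 with
    | nil => intro b _; simp
    | cons a l1 ih =>
      intro b hb
      have h1 := ih (step c b a) fun x hx => hb x (by simp [hx])
      have h2 := hqs c b a
      have h3 : q (len c + len a) ≤ q (len c + r (len c)) := hq.1 (by
        have := len_le_of_mem (hb a (by simp))
        have := hrl c
        omega)
      rw [List.foldl_cons, List.length_cons, Nat.succ_mul]
      omega
  refine (key l1 (init c) fun a ha => by rw [h]; simp [ha]).trans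
    (add_le_add (hri c) (Nat.mul_le_mul_right _ ?_))
  have h1 := length_lt_len (l c)
  have h2 := hrl c
  rw [h, List.length_append] at h1
  rw [h] at h2
  omega

end PT

end While

/-! ### Arithmetic, Boolean and list operations in polynomial time -/

namespace While

open Enc (enc)

attribute [fun_prop] PT
attribute [fun_prop] PT.id PT.const PT.comp PT.fst PT.snd PT.pair

namespace PT

variable {α β γ δ : Type} [Enc α] [Enc β] [Enc γ] [Enc δ]

/-- Polynomial time depends only on the codes of the values. -/
theorem of_enc_eq {f : α → β} {g : α → γ} (hf : PT f) (h : ∀ a, enc (g a) = enc (f a)) : PT g := by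
  obtain ⟨⟨q, hq, hqf⟩, P, T, hT, hP⟩ := hf
  refine ⟨⟨q, hq, fun a => ?_⟩, P, T, hT, fun a s hs => ?_⟩
  · simpa [len, h] using hqf a
  · simpa [h] using hP a s hs

/-- Polynomial time depends only on the codes of the arguments. -/
theorem of_enc_arg_eq {f : α → β} (hf : PT f) (g : γ → α) (h : ∀ c, enc (g c) = enc c) :
    PT fun c => f (g c) := by
  have : PT g := of_enc_eq PT.id h
  exact hf.comp this

@[fun_prop]
theorem fst' {f : γ → α × β} (hf : PT f) : PT fun c => (f c).1 := fst.comp hf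

@[fun_prop]
theorem snd' {f : γ → α × β} (hf : PT f) : PT fun c => (f c).2 := snd.comp hf

@[fun_prop]
theorem cond {p : γ → Bool} {f g : γ → α} (hp : PT p) (hf : PT f) (hg : PT g) :
    PT fun c => _root_.cond (p c) (f c) (g c) := ite hp hf hg

@[fun_prop]
theorem and {p q : γ → Bool} (hp : PT p) (hq : PT q) : PT fun c => p c && q c :=
  of_enc_eq (cond hp hq (const false)) fun c => by cases p c <;> rfl

@[fun_prop]
theorem or {p q : γ → Bool} (hp : PT p) (hq : PT q) : PT fun c => p c || q c :=
  of_enc_eq (cond hp (const true) hq) fun c => by cases p c <;> rfl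

@[fun_prop]
theorem not {p : γ → Bool} (hp : PT p) : PT fun c => !p c :=
  of_enc_eq (cond hp (const false) (const true)) fun c => by cases p c <;> rfl

@[fun_prop]
theorem cons {f : γ → α} {l : γ → List α} (hf : PT f) (hl : PT l) : PT fun c => f c :: l c :=
  of_enc_eq (pair hf hl) fun _ => rfl

theorem tail_fun : PT fun l : List α => l.tail :=
  of_expr (.tl (.var 0)) 2 fun l s hs => by
    cases l with
    | nil =>
      simp only [Expr.eval, Expr.cost, hs, enc_nil, Data.tl, Data.size, List.tail_nil, len_nil]
      exact ⟨trivial, by omega⟩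
    | cons a l =>
      simp only [Expr.eval, Expr.cost, hs, enc_cons, Data.tl, Data.size, List.tail_cons, len_cons,
        size_enc]
      exact ⟨trivial, by omega⟩

@[fun_prop]
theorem tail {l : γ → List α} (hl : PT l) : PT fun c => (l c).tail := tail_fun.comp hl

theorem pred_fun : PT fun n : ℕ => n - 1 :=
  of_enc_eq (of_enc_arg_eq (tail_fun (α := Unit)) (fun n => List.replicate n ()) enc_replicate)
    fun n => by rw [List.tail_replicate, enc_replicate]

@[fun_prop]
theorem pred {f : γ → ℕ} (hf : PT f) : PT fun c => f c - 1 := pred_fun.comp hf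

@[fun_prop]
theorem succ {f : γ → ℕ} (hf : PT f) : PT fun c => f c + 1 :=
  of_enc_eq (pair (const ()) hf) fun _ => rfl

/-- Iteration a number of times that is given in unary. -/
theorem iterate {m : γ → ℕ} {init : γ → β} {step : γ → β → β} (hm : PT m) (hi : PT init)
    (hs : PT fun p : γ × β => step p.1 p.2)
    (hsize : ∃ q, PolyBdd q ∧ ∀ c i, i ≤ m c → len ((step c)^[i] (init c)) ≤ q (len c)) :
    PT fun c => (step c)^[m c] (init c) := by
  have e : ∀ c i b, (step c)^[i] b = (List.replicate i ()).foldl (fun b _ => step c b) b := by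
    intro c i
    induction i with
    | zero => intro b; rfl
    | succ i ih => intro b; rw [Function.iterate_succ_apply, ih, List.replicate_succ]; rfl
  have hl : PT fun c => List.replicate (m c) () := of_enc_eq hm fun c => enc_replicate _
  refine of_enc_eq (foldl (step := fun c b _ => step c b) hl hi ?_ ?_) fun c => by rw [e]
  · exact hs.comp (f := fun p : γ × β × Unit => (p.1, p.2.1)) (by fun_prop)
  · obtain ⟨q, hq, hqs⟩ := hsize
    refine ⟨q, hq, fun c l1 l2 h => ?_⟩
    obtain ⟨h1, h2, -⟩ := List.append_eq_replicate_iff.1 h.symm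
    have := hqs c l1.length (by omega)
    rwa [e, ← h2] at this

theorem iterate_of_growth {m : γ → ℕ} {init : γ → β} {step : γ → β → β} (hm : PT m) (hi : PT init)
    (hs : PT fun p : γ × β => step p.1 p.2)
    (hsize : ∃ q, PolyBdd q ∧ ∀ c b, len (step c b) ≤ len b + q (len c)) :
    PT fun c => (step c)^[m c] (init c) := by
  refine iterate hm hi hs ?_
  obtain ⟨⟨r, hr, hrm⟩, -⟩ := hm
  obtain ⟨⟨r', hr', hri⟩, -⟩ := hi
  obtain ⟨q, hq, hqs⟩ := hsize
  refine ⟨fun n => r' n + r n * q n, .add hr' (.mul hr hq), fun c i hi => ?_⟩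
  have key : len ((step c)^[i] (init c)) ≤ len (init c) + i * q (len c) := by
    clear hi
    induction i with
    | zero => simp
    | succ i ih =>
      rw [Function.iterate_succ_apply', Nat.succ_mul]
      have := hqs c ((step c)^[i] (init c))
      omega
  refine key.trans (add_le_add (hri c) (Nat.mul_le_mul_right _ ?_))
  have := hrm c
  rw [len_nat] at this
  omega

@[fun_prop]
theorem sub {f g : γ → ℕ} (hf : PT f) (hg : PT g) : PT fun c => f c - g c := by
  refine of_enc_eq (iterate_of_growth (step := fun _ b => b - 1) hg hf (by fun_prop)
    ⟨fun _ => 0, .const 0, fun c b => ?_⟩) fun c => ?_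
  · simp only [len_nat]; omega
  · congr 1
    induction g c with
    | zero => rfl
    | succ n ih => rw [Function.iterate_succ_apply', ← ih]; omega

@[fun_prop]
theorem add {f g : γ → ℕ} (hf : PT f) (hg : PT g) : PT fun c => f c + g c := by
  refine of_enc_eq (iterate_of_growth (step := fun _ b => b + 1) hg hf (by fun_prop)
    ⟨fun _ => 2, .const 2, fun c b => ?_⟩) fun c => ?_
  · simp only [len_nat]; omega
  · congr 1
    induction g c with
    | zero => rfl
    | succ n ih => rw [Function.iterate_succ_apply', ← ih]; omega

theorem isZero_fun : PT fun n : ℕ => n == 0 := by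
  -- The constant function `false`, iterated `n` times from `true`, returns `true` only for `n = 0`.
  refine of_enc_eq (iterate_of_growth (step := fun _ _ => false) PT.id (const true) (by fun_prop)
    ⟨fun _ => 3, .const 3, fun c b => ?_⟩) fun n => ?_
  · exact (len_bool_le _).trans (by dsimp only; omega)
  · cases n with
    | zero => rfl
    | succ n => simp [Function.iterate_succ_apply']

@[fun_prop]
theorem ble {f g : γ → ℕ} (hf : PT f) (hg : PT g) : PT fun c => Nat.ble (f c) (g c) :=
  of_enc_eq (isZero_fun.comp (sub hf hg)) fun c => by
    congr 1
    rw [Bool.eq_iff_iff]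
    simp [Nat.sub_eq_zero_iff_le]

@[fun_prop]
theorem beq {f g : γ → ℕ} (hf : PT f) (hg : PT g) : PT fun c => Nat.beq (f c) (g c) :=
  of_enc_eq (and (ble hf hg) (ble hg hf)) fun c => by
    congr 1
    rw [Bool.eq_iff_iff]
    simp only [Nat.beq_eq, Bool.and_eq_true, Nat.ble_eq]
    omega

@[fun_prop]
theorem reverse {l : γ → List α} (hl : PT l) : PT fun c => (l c).reverse := by
  refine of_enc_eq (foldl_of_growth (init := fun _ => []) (step := fun _ b a => a :: b) hl
    (const []) (by fun_prop) ⟨fun n => n + 1, .add .id (.const 1), fun c b a => ?_⟩) fun c => ?_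
  · dsimp only; rw [len_cons]; omega
  · rw [List.foldl_flip_cons_eq_append']; simp

theorem foldr_of_growth {l : γ → List α} {init : γ → β} {step : γ → α → β → β} (hl : PT l)
    (hi : PT init) (hs : PT fun p : γ × β × α => step p.1 p.2.2 p.2.1)
    (hsize : ∃ q, PolyBdd q ∧ ∀ c b a, len (step c a b) ≤ len b + q (len c + len a)) :
    PT fun c => (l c).foldr (step c) (init c) :=
  of_enc_eq (foldl_of_growth (step := fun c b a => step c a b) (reverse hl) hi hs hsize)
    fun c => by rw [List.foldl_reverse]

@[fun_prop]
theorem map {l : γ → List α} {g : γ → α → β} (hl : PT l) (hg : PT fun p : γ × α => g p.1 p.2) :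
    PT fun c => (l c).map (g c) := by
  have hg' := hg
  obtain ⟨⟨q, hq, hqg⟩, -⟩ := hg'
  refine of_enc_eq (foldr_of_growth (init := fun _ => []) (step := fun c a b => g c a :: b) hl
    (const []) (by fun_prop) ⟨fun n => q (n + 1) + 1,
      .add (hq.comp (.add .id (.const 1))) (.const 1), fun c b a => ?_⟩)
    fun c => by rw [List.map_eq_foldr]
  have := hqg (c, a)
  rw [len_cons]
  rw [len_pair] at this
  dsimp only at this ⊢
  omega

@[fun_prop]
theorem filter {l : γ → List α} {p : γ → α → Bool} (hl : PT l)
    (hp : PT fun x : γ × α => p x.1 x.2) : PT fun c => (l c).filter (p c) := by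
  refine of_enc_eq (foldr_of_growth (init := fun _ => [])
    (step := fun c a b => _root_.cond (p c a) (a :: b) b) hl (const []) (by fun_prop)
    ⟨fun n => n + 1, .add .id (.const 1), fun c b a => ?_⟩)
    fun c => by rw [List.filter_eq_foldr]
  cases p c a <;> simp only [cond_true, cond_false, len_cons] <;> omega

@[fun_prop]
theorem append {l m : γ → List α} (hl : PT l) (hm : PT m) : PT fun c => l c ++ m c := by
  refine of_enc_eq (foldr_of_growth (step := fun _ a b => a :: b) hl hm (by fun_prop)
    ⟨fun n => n + 1, .add .id (.const 1), fun c b a => ?_⟩) fun c => by simp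
  dsimp only; rw [len_cons]; omega

@[fun_prop]
theorem flatMap {l : γ → List α} {g : γ → α → List β} (hl : PT l)
    (hg : PT fun p : γ × α => g p.1 p.2) : PT fun c => (l c).flatMap (g c) := by
  have hg' := hg
  obtain ⟨⟨q, hq, hqg⟩, -⟩ := hg'
  refine of_enc_eq (foldr_of_growth (init := fun _ => []) (step := fun c a b => g c a ++ b) hl
    (const []) (by fun_prop) ⟨fun n => q (n + 1), hq.comp (.add .id (.const 1)), fun c b a => ?_⟩)
    fun c => ?_
  · have h1 := hqg (c, a)
    have h2 := len_append (g c a) b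
    rw [len_pair] at h1
    dsimp only at h1 ⊢
    omega
  · congr 1
    induction l c with
    | nil => rfl
    | cons a l ih => rw [List.flatMap_cons, ih]; rfl

@[fun_prop]
theorem any {l : γ → List α} {p : γ → α → Bool} (hl : PT l)
    (hp : PT fun x : γ × α => p x.1 x.2) : PT fun c => (l c).any (p c) := by
  refine of_enc_eq (foldr_of_growth (init := fun _ => false) (step := fun c a b => p c a || b) hl
    (const false) (by fun_prop) ⟨fun _ => 3, .const 3, fun c b a => ?_⟩) fun c => ?_
  · exact (len_bool_le _).trans (by dsimp only; omega)
  · congr 1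
    induction l c with
    | nil => rfl
    | cons a l ih => rw [List.any_cons, ih]; rfl

@[fun_prop]
theorem isEmpty {l : γ → List α} (hl : PT l) : PT fun c => (l c).isEmpty :=
  of_enc_eq (not (any (p := fun _ _ => true) hl (const true))) fun c => by
    cases l c <;> rfl

@[fun_prop]
theorem length {l : γ → List α} (hl : PT l) : PT fun c => (l c).length := by
  refine of_enc_eq (foldr_of_growth (init := fun _ => 0) (step := fun c a b => b + 1) hl
    (const 0) (by fun_prop) ⟨fun _ => 2, .const 2, fun c b a => ?_⟩) fun c => ?_
  · simp only [len_nat]; omega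
  · congr 1
    induction l c with
    | nil => rfl
    | cons a l ih => rw [List.length_cons, ih]; rfl

@[fun_prop]
theorem headD {l : γ → List α} {d : γ → α} (hl : PT l) (hd : PT d) :
    PT fun c => (l c).headD (d c) := by
  refine of_enc_eq (foldr_of_growth (step := fun c a b => a) hl hd (by fun_prop)
    ⟨fun n => n, .id, fun c b a => ?_⟩) fun c => ?_
  · dsimp only; omega
  · cases l c <;> rfl

-- The step appends the current length, so its growth depends on the accumulator and
-- `iterate_of_growth` does not apply. The bound comes from the closed form `e` of the iterates.
@[fun_prop]
theorem range {f : γ → ℕ} (hf : PT f) : PT fun c => List.range (f c) := by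
  have e : ∀ n : ℕ, (fun l : List ℕ => l ++ [l.length])^[n] [] = List.range n := by
    intro n
    induction n with
    | zero => rfl
    | succ n ih => rw [Function.iterate_succ_apply', ih, List.range_succ, List.length_range]
  refine of_enc_eq (iterate (init := fun _ => []) (step := fun _ l => l ++ [l.length]) hf (const [])
    (by fun_prop) ?_) fun c => by rw [e]
  obtain ⟨⟨r, hr, hrf⟩, -⟩ := hf
  refine ⟨fun n => r n * (r n + 1) + 1, .add (.mul hr (.add hr (.const 1))) (.const 1),
    fun c i hi => ?_⟩
  have h := hrf c
  rw [len_nat] at h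
  rw [e]
  refine (len_list_le (B := r (len c)) fun a ha => ?_).trans ?_
  · rw [List.mem_range] at ha
    rw [len_nat]
    omega
  · rw [List.length_range]
    have : i * (r (len c) + 1) ≤ r (len c) * (r (len c) + 1) := Nat.mul_le_mul_right _ (by omega)
    dsimp only
    omega

end PT

end While

namespace RTI

open While

/-! ### The algorithm -/

/-- A triple `(a, b, c)` stands for the rooted triplet `ab|c`. -/
abbrev Triple : Type := ℕ × ℕ × ℕ

namespace Triple

/-- Equality of triples, as a Boolean. -/
def beq (s t : Triple) : Bool :=
  Nat.beq s.1 t.1 && Nat.beq s.2.1 t.2.1 && Nat.beq s.2.2 t.2.2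

/-- Whether a leaf occurs in a triple. -/
def has (x : ℕ) (t : Triple) : Bool :=
  Nat.beq t.1 x || Nat.beq t.2.1 x || Nat.beq t.2.2 x

end Triple

/-- Membership in a list of natural numbers, as a Boolean. -/
def inList (l : List ℕ) (a : ℕ) : Bool := l.any fun b => Nat.beq b a

/-- Whether `ab|c` belongs to the list. -/
def rel (ts : List Triple) (a b c : ℕ) : Bool :=
  ts.any fun t => Nat.beq t.2.2 c &&
    (Nat.beq t.1 a && Nat.beq t.2.1 b || Nat.beq t.1 b && Nat.beq t.2.1 a)

/-- Whether `ab|c` belongs to the list, but neither `db|c` nor `ab|d` does. -/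
def viol (ts : List Triple) (q : ℕ × ℕ × ℕ × ℕ) : Bool :=
  rel ts q.1 q.2.1 q.2.2.1 && !(Nat.beq q.2.1 q.2.2.2) && !(rel ts q.2.2.2 q.2.1 q.2.2.1) &&
    !(rel ts q.1 q.2.1 q.2.2.2)

/-- Whether three leaves lie in a list. -/
def inside (W : List ℕ) (a b c : ℕ) : Bool := inList W a && inList W b && inList W c

/-- One step of the greedy packing of violations: the leaves that are covered so far, and the
number of violations. -/
def packStep (ts : List Triple) (s : List ℕ × ℕ) (q : ℕ × ℕ × ℕ × ℕ) : List ℕ × ℕ :=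
  bif viol ts q && !(inside s.1 q.1 q.2.1 q.2.2.1) && !(inside s.1 q.2.2.2 q.2.1 q.2.2.1) &&
      !(inside s.1 q.1 q.2.1 q.2.2.2) then
    (q.1 :: q.2.1 :: q.2.2.1 :: q.2.2.2 :: s.1, s.2 + 1)
  else s

/-- All quadruples of numbers below `n`. -/
def quads (n : ℕ) : List (ℕ × ℕ × ℕ × ℕ) :=
  (List.range n).flatMap fun a => (List.range n).flatMap fun b => (List.range n).flatMap fun c =>
    (List.range n).map fun d => (a, b, c, d)

/-- The greedy packing of violations. -/
def pack (n : ℕ) (ts : List Triple) : List ℕ × ℕ :=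
  (quads n).foldl (packStep ts) ([], 0)

/-- The leaves that the packing leaves uncovered. -/
def uncovered (n : ℕ) (W : List ℕ) : List ℕ :=
  (List.range n).filter fun x => !(inList W x)

/-- The triplets that contain `x` force `ab|c`. -/
def dict (ts : List Triple) (x a b c : ℕ) : Bool :=
  rel ts x a c && rel ts x b c || rel ts a b x && rel ts c x a

/-- The triplet `t` disagrees with what the triplets that contain `x` force. -/
def conf (ts : List Triple) (x : ℕ) (t : Triple) : Bool :=
  dict ts x t.1 t.2.2 t.2.1 || dict ts x t.2.1 t.2.2 t.1

/-- Matchings of triplets to leaves. -/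
abbrev Matching : Type := List (Triple × ℕ)

namespace Matching

/-- Whether the triplet is matched. -/
def covers (M : Matching) (t : Triple) : Bool := M.any fun p => p.1.beq t

/-- Match `t` to `y` instead of its former partner. -/
def rematch (M : Matching) (t : Triple) (y : ℕ) : Matching :=
  (t, y) :: M.filter fun p => !(p.1.beq t)

end Matching

/-- The ways to reach a new leaf from the leaves reached so far; every leaf comes with a matching
that avoids it. -/
def reachable (ts : List Triple) (Q : List (ℕ × Matching)) : List (ℕ × Matching) :=
  Q.flatMap fun q => (ts.filter fun t => conf ts q.1 t).flatMap fun t =>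
    ((q.2.filter fun p => p.1.beq t && !(inList (Q.map fun r => r.1) p.2)).map fun p =>
      (p.2, q.2.rematch t q.1))

/-- Reach one more leaf, if possible. -/
def grow (ts : List Triple) (Q : List (ℕ × Matching)) : List (ℕ × Matching) :=
  bif (reachable ts Q).isEmpty then Q else (reachable ts Q).headD (0, []) :: Q

/-- The leaves of `U` that are unmatched. -/
def unmatched (U : List ℕ) (M : Matching) : List ℕ :=
  U.filter fun x => !(inList (M.map fun p => p.2) x)

/-- The leaves that are reached by alternating paths from the unmatched leaves of `U`. -/
def alternating (n : ℕ) (ts : List Triple) (U : List ℕ) (M : Matching) : List (ℕ × Matching) :=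
  (grow ts)^[n] ((unmatched U M).map fun x => (x, M))

/-- The larger matchings that are found from the leaves reached. -/
def larger (ts : List Triple) (Q : List (ℕ × Matching)) : List Matching :=
  Q.flatMap fun q => (ts.filter fun t => conf ts q.1 t && !(q.2.covers t)).map fun t =>
    (t, q.1) :: q.2

/-- Enlarge the matching by an augmenting path, if possible. -/
def augment (n : ℕ) (ts : List Triple) (U : List ℕ) (M : Matching) : Matching :=
  (larger ts (alternating n ts U M)).headD M

/-- A matching that is maximum or has more than `k` edges. -/
def matching (n : ℕ) (ts : List Triple) (U : List ℕ) (k : ℕ) : Matching :=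
  (augment n ts U)^[k + 1] []

/-- Change the triplet to the one that some leaf of `X` forces. -/
def edit (ts : List Triple) (X : List ℕ) (t : Triple) : Triple :=
  bif X.any fun x => dict ts x t.1 t.2.2 t.2.1 then (t.1, t.2.2, t.2.1)
  else bif X.any fun x => dict ts x t.2.1 t.2.2 t.1 then (t.2.1, t.2.2, t.1)
  else t

/-- Give the label `x` to the last leaf. -/
def relabel (n x i : ℕ) : ℕ := bif Nat.beq i (n - 1) then x else i

/-- Delete the leaf `x`. -/
def deleteLeaf (n x : ℕ) (ts : List Triple) : List Triple :=
  (ts.filter fun t => !(t.has x)).map fun t =>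
    (relabel n x t.1, relabel n x t.2.1, relabel n x t.2.2)

/-- Instances with the parameter in unary. -/
abbrev State : Type := ℕ × List Triple × ℕ

/-- Edit the triplets according to `X`, pay for it, and delete the leaf `x`. -/
def reduce (s : State) (X : List ℕ) (x : ℕ) : State :=
  (s.1 - 1, deleteLeaf s.1 x (s.2.1.map fun t => edit s.2.1 X t),
    s.2.2 - (s.2.1.filter fun t => X.any fun x => conf s.2.1 x t).length)

/-- A negative instance. -/
def negative : State := (4, [(0, 1, 2), (1, 2, 3), (0, 3, 1), (0, 2, 3)], 0)

/-- Reduction by means of a matching. -/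
def stepMatching (s : State) (U : List ℕ) (M : Matching) : State :=
  bif Nat.ble M.length s.2.2 then
    reduce s ((alternating s.1 s.2.1 U M).map fun q => q.1) ((unmatched U M).headD 0)
  else negative

/-- Reduction by means of the covered leaves and the size of a packing. -/
def stepPack (s : State) (p : List ℕ × ℕ) : State :=
  bif Nat.ble p.2 s.2.2 then
    stepMatching s (uncovered s.1 p.1) (matching s.1 s.2.1 (uncovered s.1 p.1) s.2.2)
  else negative

/-- Whether the instance is small enough. -/
def small (n k : ℕ) : Bool := Nat.ble n 4 || Nat.ble n (k + k + k + k + k)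

/-- One round of the kernelization. -/
def step (s : State) : State :=
  bif small s.1 s.2.2 then s else stepPack s (pack s.1 s.2.1)

/-- The kernelization, with the parameter in unary. -/
def kernel (s : State) : State := step^[s.1] s

/-! ### Binary numbers -/

/-- Add a Boolean to a number in binary, least significant bit first: carry and reversed sum. -/
def addCarry (c : Bool) (l : List Bool) : Bool × List Bool :=
  l.foldl (fun p b => (b && p.1, (b && !p.1 || !b && p.1) :: p.2)) (c, [])

/-- The successor in binary. -/
def incBits (l : List Bool) : List Bool :=
  bif (addCarry true l).1 then (true :: (addCarry true l).2).reverse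
  else (addCarry true l).2.reverse

/-- Conversion from unary to binary. -/
def toBits (n : ℕ) : List Bool := incBits^[n] []

/-- The minimum of two numbers. -/
def minNat (a b : ℕ) : ℕ := bif Nat.ble a b then a else b

/-- The value of a number in binary, capped at `n`. -/
def capBits (n : ℕ) (l : List Bool) : ℕ :=
  l.foldr (fun b v => minNat n (bif b then v + v + 1 else v + v)) 0

/-- Instances with the parameter in binary. -/
abbrev Input : Type := ℕ × List Triple × List Bool

/-- Convert the parameter to binary. -/
def toInput (s : State) : Input := (s.1, s.2.1, toBits s.2.2)

/-- The kernelization. -/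
def kernelize (x : Input) : Input :=
  bif small x.1 (capBits x.1 x.2.2) then x else toInput (kernel (x.1, x.2.1, capBits x.1 x.2.2))

end RTI

namespace RTI

open While

/-! ### The algorithm takes polynomial time -/

section PolynomialTime

variable {γ : Type} [Enc γ] {ts : γ → List Triple} {a b c d n k : γ → ℕ} {l U X : γ → List ℕ}
  {t u : γ → Triple} {M : γ → Matching} {Q : γ → List (ℕ × Matching)} {q : γ → ℕ × ℕ × ℕ × ℕ}
  {s : γ → State} {bs : γ → List Bool}

@[fun_prop]
theorem pt_beq (ht : PT t) (hu : PT u) : PT fun x => (t x).beq (u x) := by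
  unfold Triple.beq; fun_prop

@[fun_prop]
theorem pt_has (ha : PT a) (hu : PT u) : PT fun x => (u x).has (a x) := by
  unfold Triple.has; fun_prop

@[fun_prop]
theorem pt_inList (hl : PT l) (ha : PT a) : PT fun x => inList (l x) (a x) := by
  unfold inList; fun_prop

@[fun_prop]
theorem pt_rel (hts : PT ts) (ha : PT a) (hb : PT b) (hc : PT c) :
    PT fun x => rel (ts x) (a x) (b x) (c x) := by
  unfold rel; fun_prop

@[fun_prop]
theorem pt_viol (hts : PT ts) (hq : PT q) : PT fun x => viol (ts x) (q x) := by
  unfold viol; fun_prop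

@[fun_prop]
theorem pt_inside (hl : PT l) (ha : PT a) (hb : PT b) (hc : PT c) :
    PT fun x => inside (l x) (a x) (b x) (c x) := by
  unfold inside; fun_prop

@[fun_prop]
theorem pt_packStep {p : γ → List ℕ × ℕ} (hts : PT ts) (hp : PT p) (hq : PT q) :
    PT fun x => packStep (ts x) (p x) (q x) := by
  unfold packStep; fun_prop

@[fun_prop]
theorem pt_quads (hn : PT n) : PT fun x => quads (n x) := by
  unfold quads; fun_prop

@[fun_prop]
theorem pt_pack (hn : PT n) (hts : PT ts) : PT fun x => pack (n x) (ts x) := by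
  unfold pack
  have h : PT fun p : γ × (List ℕ × ℕ) × ℕ × ℕ × ℕ × ℕ => packStep (ts p.1) p.2.1 p.2.2 := by
    fun_prop
  obtain ⟨r, hr, hrt⟩ := hts.1
  refine PT.foldl_of_growth (pt_quads hn) (.const _) h
    -- An accepted quadruple adds its four leaves to the cover and one to the counter.
    ⟨fun n => n + 10, .add .id (.const 10), fun x p q => ?_⟩
  dsimp only [packStep]
  rw [Bool.cond_eq_ite]
  split
  all_goals simp only [len_cons, len_pair', len_nat]
  all_goals omega

@[fun_prop]
theorem pt_uncovered (hn : PT n) (hl : PT l) : PT fun x => uncovered (n x) (l x) := by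
  unfold uncovered; fun_prop

@[fun_prop]
theorem pt_dict (hts : PT ts) (hd : PT d) (ha : PT a) (hb : PT b) (hc : PT c) :
    PT fun x => dict (ts x) (d x) (a x) (b x) (c x) := by
  unfold dict; fun_prop

@[fun_prop]
theorem pt_conf (hts : PT ts) (ha : PT a) (ht : PT t) : PT fun x => conf (ts x) (a x) (t x) := by
  unfold conf; fun_prop

@[fun_prop]
theorem pt_covers (hM : PT M) (ht : PT t) : PT fun x => (M x).covers (t x) := by
  unfold Matching.covers; fun_prop

@[fun_prop]
theorem pt_rematch (hM : PT M) (ht : PT t) (ha : PT a) :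
    PT fun x => (M x).rematch (t x) (a x) := by
  unfold Matching.rematch; fun_prop

@[fun_prop]
theorem pt_reachable (hts : PT ts) (hQ : PT Q) : PT fun x => reachable (ts x) (Q x) := by
  unfold reachable; fun_prop

@[fun_prop]
theorem pt_grow (hts : PT ts) (hQ : PT Q) : PT fun x => grow (ts x) (Q x) := by
  unfold grow; fun_prop

@[fun_prop]
theorem pt_unmatched (hl : PT l) (hM : PT M) : PT fun x => unmatched (l x) (M x) := by
  unfold unmatched; fun_prop

theorem len_filter_le {α : Type} [Enc α] (p : α → Bool) (l : List α) : len (l.filter p) ≤ len l := by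
  induction l with
  | nil => rfl
  | cons a l ih =>
    rw [List.filter_cons]
    split <;> simp only [len_cons] <;> omega

theorem len_filter_add_len_filter_not {α : Type} [Enc α] (p : α → Bool) (l : List α) :
    len (l.filter p) + len (l.filter fun a => !p a) = len l + 1 := by
  induction l with
  | nil => rfl
  | cons a l ih =>
    cases h : p a <;> simp [h, len_cons] <;> omega

/-- The pair dropped by the rematching pays for writing down the newly reached leaf. Only the new
copy of the triple counts, so the growth is additive and stays polynomial over `n` rounds. -/
theorem len_of_mem_reachable {ts : List Triple} {Q : List (ℕ × Matching)} {B : ℕ}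
    (hQ : ∀ q ∈ Q, len q ≤ B) {q : ℕ × Matching} (hq : q ∈ reachable ts Q) :
    len q ≤ B + len ts + 5 := by
  simp only [reachable, List.mem_flatMap, List.mem_map, List.mem_filter, Bool.and_eq_true] at hq
  obtain ⟨r, hr, t, ⟨ht, -⟩, p, ⟨hp, hpt, -⟩, rfl⟩ := hq
  have h1 := hQ r hr
  have h2 := len_filter_add_len_filter_not (fun p => Triple.beq p.1 t) r.2
  have h3 := len_le_of_mem (List.mem_filter (p := fun p => Triple.beq p.1 t).2 ⟨hp, hpt⟩)
  have h4 := len_le_of_mem ht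
  simp only [Matching.rematch, len_pair', len_cons] at *
  omega

theorem len_of_mem_grow {ts : List Triple} {Q : List (ℕ × Matching)} {B : ℕ}
    (hQ : ∀ q ∈ Q, len q ≤ B) (i : ℕ) :
    (∀ q ∈ (grow ts)^[i] Q, len q ≤ B + i * (len ts + 5)) ∧
      ((grow ts)^[i] Q).length ≤ Q.length + i := by
  induction i with
  | zero => simpa using hQ
  | succ i ih =>
    obtain ⟨h1, h2⟩ := ih
    rw [Function.iterate_succ_apply']
    generalize (grow ts)^[i] Q = R at *
    rw [grow, Nat.succ_mul]
    cases hR : reachable ts R with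
    | nil => exact ⟨fun q hq => (h1 q hq).trans (by omega), by simpa using by omega⟩
    | cons r l =>
      simp only [List.isEmpty_cons, cond_false, List.headD_cons, List.mem_cons, List.length_cons]
      refine ⟨?_, by omega⟩
      rintro q (rfl | hq)
      · have := len_of_mem_reachable (ts := ts) h1 (q := q) (by simp [hR])
        omega
      · exact (h1 q hq).trans (by omega)

theorem len_le_of_mem_start {U : List ℕ} {M : Matching} :
    ∀ q ∈ (unmatched U M).map fun x => (x, M), len q ≤ len U + len M + 1 := by
  simp only [List.mem_map, unmatched, List.mem_filter]
  rintro q ⟨x, ⟨hx, -⟩, rfl⟩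
  have := len_le_of_mem hx
  rw [len_pair]
  omega

@[fun_prop]
theorem pt_alternating (hn : PT n) (hts : PT ts) (hU : PT U) (hM : PT M) :
    PT fun x => alternating (n x) (ts x) (U x) (M x) := by
  unfold alternating
  obtain ⟨q1, hq1, h1⟩ := hn.1
  obtain ⟨q2, hq2, h2⟩ := hts.1
  obtain ⟨q3, hq3, h3⟩ := hU.1
  obtain ⟨q4, hq4, h4⟩ := hM.1
  have h : PT fun p : γ × List (ℕ × Matching) => grow (ts p.1) p.2 := by fun_prop
  refine PT.iterate (step := fun x => grow (ts x)) hn (by fun_prop) h ⟨fun n =>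
    (q3 n + q1 n) * (q3 n + q4 n + 1 + q1 n * (q2 n + 5) + 1) + 1,
    .add (.mul (.add hq3 hq1) (.add (.add (.add (.add hq3 hq4) (.const 1)) (.mul hq1
      (.add hq2 (.const 5)))) (.const 1))) (.const 1), fun x i hi => ?_⟩
  obtain ⟨h5, h6⟩ := len_of_mem_grow (ts := ts x) (len_le_of_mem_start (U := U x) (M := M x)) i
  refine (len_list_le h5).trans (Nat.add_le_add_right (Nat.mul_le_mul ?_ ?_) 1)
  · have h7 : (unmatched (U x) (M x)).length ≤ (U x).length := List.length_filter_le _ _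
    have := length_lt_len (U x)
    have := h3 x
    have := h1 x
    rw [len_nat] at this
    rw [List.length_map] at h6
    omega
  · have h7 : i * (len (ts x) + 5) ≤ q1 (len x) * (q2 (len x) + 5) := by
      refine Nat.mul_le_mul ?_ (Nat.add_le_add_right (h2 x) 5)
      have := h1 x
      rw [len_nat] at this
      omega
    have := h3 x
    have := h4 x
    omega

@[fun_prop]
theorem pt_larger (hts : PT ts) (hQ : PT Q) : PT fun x => larger (ts x) (Q x) := by
  unfold larger; fun_prop

@[fun_prop]
theorem pt_augment (hn : PT n) (hts : PT ts) (hU : PT U) (hM : PT M) :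
    PT fun x => augment (n x) (ts x) (U x) (M x) := by
  unfold augment; fun_prop

theorem len_augment_le (n : ℕ) (ts : List Triple) (U : List ℕ) (M : Matching) :
    len (augment n ts U M) ≤ len M + (len U + n * (len ts + 5) + len ts + 5) := by
  unfold augment
  cases h : larger ts (alternating n ts U M) with
  | nil => simp only [List.headD_nil]; omega
  | cons N l =>
    have hN : N ∈ larger ts (alternating n ts U M) := by simp [h]
    simp only [larger, List.mem_flatMap, List.mem_map, List.mem_filter] at hN
    obtain ⟨q, hq, t, ⟨ht, -⟩, rfl⟩ := hN
    have h1 := (len_of_mem_grow (ts := ts) (len_le_of_mem_start (U := U) (M := M)) n).1 q hq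
    have h2 := len_le_of_mem ht
    rw [List.headD_cons]
    simp only [len_pair', len_cons] at *
    omega

@[fun_prop]
theorem pt_matching (hn : PT n) (hts : PT ts) (hU : PT U) (hk : PT k) :
    PT fun x => matching (n x) (ts x) (U x) (k x) := by
  unfold matching
  obtain ⟨q1, hq1, h1⟩ := hn.1
  obtain ⟨q2, hq2, h2⟩ := hts.1
  obtain ⟨q3, hq3, h3⟩ := hU.1
  have h : PT fun p : γ × Matching => augment (n p.1) (ts p.1) (U p.1) p.2 := by fun_prop
  refine PT.iterate_of_growth (step := fun x => augment (n x) (ts x) (U x)) (by fun_prop)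
    (.const _) h ⟨fun n => q3 n + q1 n * (q2 n + 5) + q2 n + 5,
      .add (.add (.add hq3 (.mul hq1 (.add hq2 (.const 5)))) hq2) (.const 5), fun x M => ?_⟩
  refine (len_augment_le _ _ _ _).trans ?_
  have h7 : n x * (len (ts x) + 5) ≤ q1 (len x) * (q2 (len x) + 5) := by
    refine Nat.mul_le_mul ?_ (Nat.add_le_add_right (h2 x) 5)
    have := h1 x
    rw [len_nat] at this
    omega
  have := h2 x
  have := h3 x
  dsimp only
  omega

@[fun_prop]
theorem pt_edit (hts : PT ts) (hX : PT X) (ht : PT t) :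
    PT fun x => edit (ts x) (X x) (t x) := by
  unfold edit; fun_prop

@[fun_prop]
theorem pt_relabel (hn : PT n) (ha : PT a) (hb : PT b) :
    PT fun x => relabel (n x) (a x) (b x) := by
  unfold relabel; fun_prop

@[fun_prop]
theorem pt_deleteLeaf (hn : PT n) (ha : PT a) (hts : PT ts) :
    PT fun x => deleteLeaf (n x) (a x) (ts x) := by
  unfold deleteLeaf; fun_prop

@[fun_prop]
theorem pt_reduce (hs : PT s) (hX : PT X) (ha : PT a) :
    PT fun x => reduce (s x) (X x) (a x) := by
  unfold reduce; fun_prop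

@[fun_prop]
theorem pt_stepMatching (hs : PT s) (hU : PT U) (hM : PT M) :
    PT fun x => stepMatching (s x) (U x) (M x) := by
  unfold stepMatching; fun_prop

@[fun_prop]
theorem pt_stepPack {p : γ → List ℕ × ℕ} (hs : PT s) (hp : PT p) :
    PT fun x => stepPack (s x) (p x) := by
  unfold stepPack; fun_prop

@[fun_prop]
theorem pt_small (hn : PT n) (hk : PT k) : PT fun x => small (n x) (k x) := by
  unfold small; fun_prop

@[fun_prop]
theorem pt_step (hs : PT s) : PT fun x => step (s x) := by
  unfold step; fun_prop

theorem len_map_le {α β : Type} [Enc α] [Enc β] {f : α → β} {l : List α}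
    (h : ∀ a ∈ l, len (f a) ≤ len a) : len (l.map f) ≤ len l := by
  induction l with
  | nil => rfl
  | cons a l ih =>
    have h1 := h a (by simp)
    have h2 := ih fun b hb => h b (by simp [hb])
    rw [List.map_cons, len_cons, len_cons]
    omega

/-- Only the last label `n - 1` changes, and it becomes the label `x`, which is no larger. In unary,
no code gets longer. -/
theorem len_deleteLeaf_le {n x : ℕ} (hx : x ≤ n - 1) (ts : List Triple) :
    len (deleteLeaf n x ts) ≤ len ts := by
  have h : ∀ i, relabel n x i ≤ i := by
    intro i
    rw [relabel, Bool.cond_eq_ite]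
    split
    · simp_all
    · rfl
  refine (len_map_le fun t ht => ?_).trans (len_filter_le _ _)
  have := h t.1
  have := h t.2.1
  have := h t.2.2
  simp only [len_pair', len_nat]
  omega

theorem len_edit (ts : List Triple) (X : List ℕ) (t : Triple) : len (edit ts X t) = len t := by
  simp only [edit, Bool.cond_eq_ite]
  split_ifs <;> simp only [len_pair'] <;> omega

theorem headD_unmatched_le (n : ℕ) (W : List ℕ) (M : Matching) :
    (unmatched (uncovered n W) M).headD 0 ≤ n - 1 := by
  cases h : unmatched (uncovered n W) M with
  | nil => simp
  | cons x l =>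
    have hx : x ∈ unmatched (uncovered n W) M := by simp [h]
    simp only [unmatched, uncovered, List.mem_filter, List.mem_range] at hx
    rw [List.headD_cons]
    omega

/-- A round keeps the state, shrinks it, or replaces it by a fixed one. Growth by a constant per
round is what `iterate_of_growth` needs. -/
theorem len_step_le (s : State) : len (step s) ≤ len s + len negative := by
  simp only [step, stepPack, stepMatching, Bool.cond_eq_ite]
  split_ifs
  · omega
  · have h1 := headD_unmatched_le s.1 (pack s.1 s.2.1).1
      (matching s.1 s.2.1 (uncovered s.1 (pack s.1 s.2.1).1) s.2.2)
    generalize (unmatched _ _).headD 0 = x at *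
    generalize List.map _ (alternating _ _ _ _) = X
    have h2 := len_deleteLeaf_le h1 (s.2.1.map fun t => edit s.2.1 X t)
    have h3 : len (s.2.1.map fun t => edit s.2.1 X t) ≤ len s.2.1 :=
      len_map_le fun t _ => (len_edit _ _ t).le
    simp only [reduce, len_pair', len_nat] at *
    omega
  · omega
  · omega

@[fun_prop]
theorem pt_kernel (hs : PT s) : PT fun x => kernel (s x) := by
  unfold kernel
  refine PT.iterate_of_growth (step := fun _ => step) (by fun_prop) hs (by fun_prop)
    ⟨fun _ => len negative, .const _, fun x b => len_step_le b⟩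

@[fun_prop]
theorem pt_addCarry {e : γ → Bool} (he : PT e) (hb : PT bs) :
    PT fun x => addCarry (e x) (bs x) := by
  unfold addCarry
  refine PT.foldl_of_growth hb (by fun_prop) (by fun_prop)
    ⟨fun n => 10, .const _, fun x p b => ?_⟩
  have := len_bool_le (b && p.1)
  have := len_bool_le (b && !p.1 || !b && p.1)
  simp only [len_pair', len_cons]
  omega

@[fun_prop]
theorem pt_incBits (hb : PT bs) : PT fun x => incBits (bs x) := by
  unfold incBits; fun_prop

/-- The successor in binary, by recursion. -/
def succBits : List Bool → List Bool
  | [] => [true]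
  | false :: l => true :: l
  | true :: l => false :: succBits l

theorem incBits_eq (l : List Bool) : incBits l = succBits l := by
  -- The induction needs an arbitrary carry and an arbitrary list of digits already produced, stored
  -- in reverse.
  have key : ∀ (l : List Bool) (c : Bool) (acc : List Bool),
      (fun p : Bool × List Bool => (bif p.1 then (true :: p.2).reverse else p.2.reverse))
        (l.foldl (fun p b => (b && p.1, (b && !p.1 || !b && p.1) :: p.2)) (c, acc)) =
      acc.reverse ++ (bif c then succBits l else l) := by
    intro l
    induction l with
    | nil => intro c acc; cases c <;> simp [succBits]
    | cons b l ih =>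
      intro c acc
      rw [List.foldl_cons, ih]
      cases c <;> cases b <;> simp [succBits]
  exact key l true []

theorem len_incBits_le (l : List Bool) : len (incBits l) ≤ len l + 5 := by
  rw [incBits_eq]
  induction l with
  | nil => decide
  | cons b l ih =>
    have ht : len true = 3 := rfl
    have hf : len false = 1 := rfl
    cases b <;> simp only [succBits, len_cons] <;> omega

@[fun_prop]
theorem pt_toBits (hn : PT n) : PT fun x => toBits (n x) := by
  unfold toBits
  exact PT.iterate_of_growth (step := fun _ => incBits) hn (.const _) (by fun_prop)
    ⟨fun _ => 5, .const _, fun x b => len_incBits_le b⟩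

@[fun_prop]
theorem pt_minNat (ha : PT a) (hb : PT b) : PT fun x => minNat (a x) (b x) := by
  unfold minNat; fun_prop

-- The number coded by the bits may be exponential in their number. Capping at `n` after each bit
-- keeps the unary accumulator small throughout the fold.
@[fun_prop]
theorem pt_capBits (hn : PT n) (hb : PT bs) : PT fun x => capBits (n x) (bs x) := by
  unfold capBits
  obtain ⟨q, hq, h⟩ := hn.1
  refine PT.foldr_of_growth (step := fun x b v => minNat (n x) (bif b then v + v + 1 else v + v))
    hb (.const _) (by fun_prop) ⟨q, hq, fun x v b => ?_⟩
  have h1 := h x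
  have h2 : q (len x) ≤ q (len x + len b) := hq.1 (by omega)
  have h3 : ∀ a b, minNat a b ≤ a := by
    intro a b
    rw [minNat, Bool.cond_eq_ite]
    split <;> simp_all
    omega
  have h4 := h3 (n x) (bif b then v + v + 1 else v + v)
  rw [len_nat] at *
  omega

theorem pt_kernelize : PT kernelize := by
  unfold kernelize toInput; fun_prop

end PolynomialTime

end RTI

namespace RTI

/-! ### Tree-like ternary relations -/

/-- Ternary relations that pick exactly one rooted triplet `ab|c` on every three leaves below
`n`. -/
structure DenseRel (n : ℕ) (R : ℕ → ℕ → ℕ → Prop) : Prop where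
  lt : ∀ {a b c}, R a b c → a < n ∧ b < n ∧ c < n
  ne : ∀ {a b c}, R a b c → a ≠ b ∧ a ≠ c ∧ b ≠ c
  symm : ∀ {a b c}, R a b c → R b a c
  asymm : ∀ {a b c}, R a b c → ¬ R a c b
  total : ∀ {a b c}, a < n → b < n → c < n → a ≠ b → a ≠ c → b ≠ c → R a b c ∨ R a c b ∨ R b c a

/-- The relations `ab|c` that come from rooted binary trees (with leaf set `ℕ`). -/
structure TreeRel (C : ℕ → ℕ → ℕ → Prop) : Prop where
  ne : ∀ {a b c}, C a b c → a ≠ b ∧ a ≠ c ∧ b ≠ c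
  symm : ∀ {a b c}, C a b c → C b a c
  asymm : ∀ {a b c}, C a b c → ¬ C a c b
  total : ∀ {a b c}, a ≠ b → a ≠ c → b ≠ c → C a b c ∨ C a c b ∨ C b c a
  trans : ∀ {a b c} d, C a b c → b ≠ d → C d b c ∨ C a b d

/-- The triplets that contain `x` are those of a caterpillar of clusters with `x` at the bottom. -/
def StarConsistent (n : ℕ) (R : ℕ → ℕ → ℕ → Prop) (x : ℕ) : Prop :=
  ∀ a c d, R a x c → x ≠ d → d < n → R d x c ∨ R a x d

/-- Every violation uses a triplet inside `W`. -/
def Packed (n : ℕ) (R : ℕ → ℕ → ℕ → Prop) (W : ℕ → Prop) : Prop :=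
  ∀ a b c d, R a b c → b ≠ d → d < n → R d b c ∨ R a b d ∨
    W b ∧ (W a ∧ W c ∨ W d ∧ W c ∨ W a ∧ W d)

/-- The triplets that contain `x` force `ab|c`. -/
def Forces (R : ℕ → ℕ → ℕ → Prop) (x a b c : ℕ) : Prop :=
  R x a c ∧ R x b c ∨ R a b x ∧ R c x a

/-- The triplets of `R` that contain `x` belong to `C`. -/
def AgreesAt (R C : ℕ → ℕ → ℕ → Prop) (x : ℕ) : Prop :=
  ∀ a b c, x = a ∨ x = b ∨ x = c → R a b c → C a b c

/-- The leaf `x` is one of `a, b, c` or its triplets distinguish between them. -/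
def Touches (R : ℕ → ℕ → ℕ → Prop) (x a b c : ℕ) : Prop :=
  x = a ∨ x = b ∨ x = c ∨ R x a b ∨ R x b a ∨ R x a c ∨ R x c a ∨ R x b c ∨ R x c b

/-- The tree relation of the caterpillar of the clusters of equal rank. -/
def lift (r : ℕ → ℕ) (C : ℕ → ℕ → ℕ → Prop) (a b c : ℕ) : Prop :=
  a ≠ b ∧ a ≠ c ∧ b ≠ c ∧ (r a = r b ∧ r b = r c ∧ C a b c ∨ r a < r c ∧ r b < r c ∨
    r a = r b ∧ r c < r a)

/-- The tree behind `lift r C` is a spine from which the rank classes hang, the lowest rank at the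
bottom, each class carrying the tree induced by `C`. A unique leaf of highest rank is the apex; if
two leaves tie for the highest rank, the third leaf is. -/
theorem TreeRel.lift {C : ℕ → ℕ → ℕ → Prop} (hC : TreeRel C) (r : ℕ → ℕ) :
    TreeRel (lift r C) where
  ne h := ⟨h.1, h.2.1, h.2.2.1⟩
  symm := by
    rintro a b c ⟨h1, h2, h3, h⟩
    refine ⟨h1.symm, h3, h2, ?_⟩
    have := hC.symm (a := a) (b := b) (c := c)
    grind
  asymm := by
    rintro a b c ⟨h1, h2, h3, h⟩ ⟨-, -, -, h'⟩
    have := hC.asymm (a := a) (b := b) (c := c)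
    grind
  total := by
    intro a b c h1 h2 h3
    have := hC.total h1 h2 h3
    unfold RTI.lift
    grind
  trans := by
    rintro a b c d ⟨h1, h2, h3, h⟩ hd
    unfold RTI.lift
    by_cases hda : d = a
    · subst hda; exact .inl ⟨h1, h2, h3, h⟩
    by_cases hdc : d = c
    · subst hdc; exact .inr ⟨h1, h2, h3, h⟩
    have h4 := hC.trans (a := a) (b := b) (c := c) d
    grind

/-! ### Caterpillars around uncovered leaves, and rebuilding trees -/

section Rank

variable {n : ℕ} {R : ℕ → ℕ → ℕ → Prop}

/-- The rank of `a ≠ x` is one more than the number of leaves `d` with `xd|a`. Star consistency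
makes these sets of leaves a chain under inclusion, so comparing cardinalities amounts to comparing
sets. -/
theorem exists_rank (hR : DenseRel n R) {x : ℕ} (hx : StarConsistent n R x) :
    ∃ r : ℕ → ℕ, r x = 0 ∧ (∀ a, a ≠ x → 0 < r a) ∧
      ∀ a b, a < n → b < n → a ≠ x → b ≠ x → (R x a b ↔ r a < r b) := by
  classical
  let f : ℕ → Finset ℕ := fun a => (Finset.range n).filter fun d => R x d a
  refine ⟨fun a => if a = x then 0 else 1 + (f a).card, by simp, fun a ha => by simp [ha], ?_⟩
  have key : ∀ a b, a < n → b < n → a ≠ x → b ≠ x → ¬ R x b a → f a ⊆ f b := by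
    intro a b ha hb hax hbx hba d hd
    simp only [f, Finset.mem_filter] at hd ⊢
    refine ⟨hd.1, ?_⟩
    rcases hx d a b (hR.symm hd.2) hbx.symm hb with h | h
    · exact absurd (hR.symm h) hba
    · exact hR.symm h
  intro a b ha hb hax hbx
  simp only [if_neg hax, if_neg hbx]
  constructor
  · intro h
    have h1 : f a ⊆ f b := key a b ha hb hax hbx fun h' => hR.asymm h h'
    have h2 : f a ⊂ f b := by
      refine Finset.ssubset_iff_subset_ne.2 ⟨h1, fun he => ?_⟩
      have : a ∈ f a := by rw [he]; simp [f, ha, h]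
      simp only [f, Finset.mem_filter] at this
      exact (hR.ne this.2).2.2 rfl
    have := Finset.card_lt_card h2
    omega
  · intro h
    by_contra hn
    have := Finset.card_le_card (key b a hb ha hbx hax hn)
    omega

/-- All three triples of a violation contain its second leaf. This is why `Packed` puts that leaf in
`W`, and why no violation has an uncovered leaf in this position. -/
theorem Packed.starConsistent {W : ℕ → Prop} (hW : Packed n R W) {x : ℕ} (hx : ¬ W x) :
    StarConsistent n R x := by
  intro a c d h hxd hd
  have := hW a x c d h hxd hd
  tauto

/-- Inserting the missing leaf into the forcing triplets gives `ab|c` as in a tree, unless `Packed`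
excuses a violation. As `x` is not in `W`, that would require `a`, `b` and `c` all to be in `W`.
Consequently, conflicts with an uncovered leaf lie inside `W`. -/
theorem Forces.of_packed (hR : DenseRel n R) {W : ℕ → Prop} (hW : Packed n R W) {x a b c : ℕ}
    (hx : ¬ W x) (h : Forces R x a b c) (hab : a ≠ b) (hac : a ≠ c)
    (hy : ¬ W a ∨ ¬ W b ∨ ¬ W c) : R a b c := by
  rcases h with ⟨h1, h2⟩ | ⟨h1, h2⟩
  · have hb := (hR.lt h2).2.1
    have ha := (hR.lt h1).2.1
    have e1 := hW x a c b h1 hab hb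
    have e2 := hW x b c a h2 hab.symm ha
    have e3 := hR.asymm (a := x) (b := a) (c := b)
    have e4 := hR.symm (a := b) (b := a) (c := c)
    tauto
  · have hb := (hR.lt h1).2.1
    have hc := (hR.lt h2).1
    have e1 := hW b a x c (hR.symm h1) hac hc
    have e2 := hR.asymm (a := c) (b := x) (c := a)
    have e3 := hR.symm (a := b) (b := a) (c := c)
    tauto

theorem TreeRel.of_forces {C : ℕ → ℕ → ℕ → Prop} (hC : TreeRel C) {x a b c : ℕ}
    (h : Forces C x a b c) (hab : a ≠ b) (hac : a ≠ c) : C a b c := by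
  rcases h with ⟨h1, h2⟩ | ⟨h1, h2⟩
  · have e1 := hC.trans b h1 hab
    have e2 := hC.trans a h2 hab.symm
    have e3 := hC.asymm (a := x) (b := a) (c := b)
    have e4 := hC.symm (a := b) (b := a) (c := c)
    tauto
  · have e1 := hC.trans c (hC.symm h1) hac
    have e2 := hC.asymm (a := c) (b := x) (c := a)
    have e3 := hC.symm (a := b) (b := a) (c := c)
    tauto

theorem Forces.of_agreesAt {C : ℕ → ℕ → ℕ → Prop} (hC : TreeRel C) {x a b c : ℕ}
    (hx : AgreesAt R C x) (h : Forces R x a b c) (hab : a ≠ b) (hac : a ≠ c) : C a b c :=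
  hC.of_forces (h.imp (.imp (hx _ _ _ (by simp)) (hx _ _ _ (by simp)))
    (.imp (hx _ _ _ (by simp)) (hx _ _ _ (by simp)))) hab hac

/-- Away from `x`, being touched means that the three ranks are not all equal. Then either one leaf
has the strictly highest rank, or two leaves tie above the third; these are the two alternatives of
`Forces`, up to the choice of the apex. -/
theorem Touches.forces (hR : DenseRel n R) {x a b c : ℕ} (hx : StarConsistent n R x)
    (h : Touches R x a b c) (ha : a < n) (hb : b < n) (hc : c < n) (hab : a ≠ b) (hac : a ≠ c)
    (hbc : b ≠ c) (hxn : x < n) (hxa : x ≠ a) (hxb : x ≠ b) (hxc : x ≠ c) :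
    Forces R x a b c ∨ Forces R x a c b ∨ Forces R x b c a := by
  obtain ⟨r, -, -, hr⟩ := exists_rank hR hx
  have e1 := hr a b ha hb hxa.symm hxb.symm
  have e2 := hr b a hb ha hxb.symm hxa.symm
  have e3 := hr a c ha hc hxa.symm hxc.symm
  have e4 := hr c a hc ha hxc.symm hxa.symm
  have e5 := hr c b hc hb hxc.symm hxb.symm
  have e6 := hr b c hb hc hxb.symm hxc.symm
  have s : ∀ {p q : ℕ}, p < n → q < n → p ≠ q → x ≠ p → x ≠ q → (R p q x ↔ r p = r q) := by
    intro p q hp hq hpq hxp hxq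
    have f1 := hr p q hp hq hxp.symm hxq.symm
    have f2 := hr q p hq hp hxq.symm hxp.symm
    have f3 := hR.total hxn hp hq hxp hxq hpq
    have f4 : R p q x → ¬ R x p q := fun h h' => hR.asymm (hR.symm h') h
    have f5 : R p q x → ¬ R x q p := fun h h' => hR.asymm (hR.symm h) (hR.symm h')
    have : r p < r q ∨ r p = r q ∨ r q < r p := by omega
    constructor
    · intro h
      have := f4 h
      have := f5 h
      rw [f1] at *; rw [f2] at *
      omega
    · intro h
      rw [f1, f2] at f3
      rcases f3 with f3 | f3 | f3
      · omega
      · omega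
      · exact f3
  have s1 := s ha hb hab hxa hxb
  have s2 := s ha hc hac hxa hxc
  have s3 := s hb hc hbc hxb hxc
  have t : ∀ p q, R p x q ↔ R x p q := fun p q => ⟨hR.symm, hR.symm⟩
  simp only [Touches, hxa, hxb, hxc, false_or, Forces, t, s1, s2, s3, e1, e2, e3, e4, e5, e6]
    at h ⊢
  omega

/-- Restructure a tree around a leaf `y` whose triplets are consistent. -/
theorem exists_agreesAt (hR : DenseRel n R) {W : ℕ → Prop} (hW : Packed n R W) {y : ℕ}
    (hy : ¬ W y) (hyn : y < n) {C : ℕ → ℕ → ℕ → Prop} (hC : TreeRel C) :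
    ∃ C', TreeRel C' ∧ AgreesAt R C' y ∧ (∀ x, ¬ W x → AgreesAt R C x → AgreesAt R C' x) ∧
      ∀ a b c, a < n → b < n → c < n → a ≠ b → a ≠ c → b ≠ c → ¬ Touches R y a b c →
        (C' a b c ↔ C a b c) := by
  have hs := hW.starConsistent hy
  obtain ⟨r, r0, rpos, hr⟩ := exists_rank hR hs
  have hC' := hC.lift r
  have agree : AgreesAt R (lift r C) y := by
    rintro a b c hyabc h
    have hne := hR.ne h
    have hlt := hR.lt h
    refine ⟨hne.1, hne.2.1, hne.2.2, .inr ?_⟩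
    rcases hyabc with rfl | rfl | rfl
    · have e1 := (hr b c hlt.2.1 hlt.2.2 hne.1.symm hne.2.1.symm).1 h
      omega
    · have e1 := (hr a c hlt.1 hlt.2.2 hne.1 hne.2.2.symm).1 (hR.symm h)
      omega
    · have e1 := mt (hr a b hlt.1 hlt.2.1 hne.2.1 hne.2.2).2
        fun h' => hR.asymm (hR.symm h') h
      have e2 := mt (hr b a hlt.2.1 hlt.1 hne.2.2 hne.2.1).2
        fun h' => hR.asymm (hR.symm h') (hR.symm h)
      have := rpos a hne.2.1
      omega
  have keep : ∀ a b c, a < n → b < n → c < n → a ≠ b → a ≠ c → b ≠ c → ¬ Touches R y a b c →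
      (lift r C a b c ↔ C a b c) := by
    intro a b c ha hb hc hab hac hbc ht
    simp only [Touches, not_or] at ht
    obtain ⟨h1, h2, h3, h4, h5, h6, h7, -⟩ := ht
    have h1 := Ne.symm h1
    have h2 := Ne.symm h2
    have h3 := Ne.symm h3
    rw [hr _ _ ‹_› ‹_› ‹_› ‹_›] at h4 h5 h6 h7
    have e1 : r a = r b := by omega
    have e2 : r b = r c := by omega
    simp [lift, e1, e2, hab, hac, hbc]
  refine ⟨_, hC', agree, fun x hx hxC a b c hxabc h => ?_, keep⟩
  by_cases ht : Touches R y a b c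
  · have hne := hR.ne h
    have hlt := hR.lt h
    by_cases hya : y = a
    · exact agree a b c (.inl hya) h
    by_cases hyb : y = b
    · exact agree a b c (.inr (.inl hyb)) h
    by_cases hyc : y = c
    · exact agree a b c (.inr (.inr hyc)) h
    -- A triplet at the uncovered leaf `x` does not lie inside `W`, so it cannot contradict what `y`
    -- forces. Rebuilding around `y` thus preserves the agreement at `x`.
    have hw : ¬ W a ∨ ¬ W b ∨ ¬ W c := by
      rcases hxabc with rfl | rfl | rfl <;> simp [hx]
    rcases ht.forces hR hs hlt.1 hlt.2.1 hlt.2.2 hne.1 hne.2.1 hne.2.2 hyn hya hyb hyc with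
      hf | hf | hf
    · exact hf.of_agreesAt hC' agree hne.1 hne.2.1
    · exact absurd (hf.of_packed hR hW hy hne.2.1 hne.1 (by tauto)) (hR.asymm h)
    · exact absurd (hf.of_packed hR hW hy hne.2.2 hne.1.symm (by tauto))
        (hR.asymm (hR.symm h))
  · have hne := hR.ne h
    have hlt := hR.lt h
    exact (keep a b c hlt.1 hlt.2.1 hlt.2.2 hne.1 hne.2.1 hne.2.2 ht).2 (hxC a b c hxabc h)

theorem exists_agreesAt_list (hR : DenseRel n R) {W : ℕ → Prop} (hW : Packed n R W) (X : List ℕ)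
    (hX : ∀ x ∈ X, ¬ W x ∧ x < n) {C : ℕ → ℕ → ℕ → Prop} (hC : TreeRel C) :
    ∃ C', TreeRel C' ∧ (∀ x ∈ X, AgreesAt R C' x) ∧
      ∀ a b c, a < n → b < n → c < n → a ≠ b → a ≠ c → b ≠ c → (∀ x ∈ X, ¬ Touches R x a b c) →
        (C' a b c ↔ C a b c) := by
  induction X with
  | nil => exact ⟨C, hC, by simp, by simp⟩
  | cons y X ih =>
    obtain ⟨C1, h1, h2, h3⟩ := ih fun x hx => hX x (by simp [hx])
    obtain ⟨C2, h4, h5, h6, h7⟩ :=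
      exists_agreesAt hR hW (hX y (by simp)).1 (hX y (by simp)).2 h1
    refine ⟨C2, h4, ?_, fun a b c ha hb hc hab hac hbc ht => ?_⟩
    · simp only [List.mem_cons, forall_eq_or_imp]
      exact ⟨h5, fun x hx => h6 x (hX x (by simp [hx])).1 (h2 x hx)⟩
    · rw [h7 a b c ha hb hc hab hac hbc (ht y (by simp)),
        h3 a b c ha hb hc hab hac hbc fun x hx => ht x (by simp [hx])]

end Rank

end RTI

namespace RTI

open While

/-! ### Lists of triples -/

@[simp]
theorem Triple.beq_iff {s t : Triple} : s.beq t = true ↔ s = t := by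
  obtain ⟨a, b, c⟩ := s
  obtain ⟨a', b', c'⟩ := t
  simp [Triple.beq, and_assoc]

/-- The leaves of a triple. -/
def Triple.support (t : Triple) : Finset ℕ := {t.1, t.2.1, t.2.2}

theorem Triple.mem_support {t : Triple} {x : ℕ} :
    x ∈ t.support ↔ x = t.1 ∨ x = t.2.1 ∨ x = t.2.2 := by
  simp [Triple.support]

@[simp]
theorem Triple.has_iff {t : Triple} {x : ℕ} : t.has x = true ↔ x ∈ t.support := by
  simp only [Triple.has, Bool.or_eq_true, Nat.beq_eq, Triple.mem_support, or_assoc]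
  tauto

@[simp]
theorem inList_iff {l : List ℕ} {a : ℕ} : inList l a = true ↔ a ∈ l := by
  simp [inList]

theorem inside_iff {W : List ℕ} {a b c : ℕ} : inside W a b c = true ↔ a ∈ W ∧ b ∈ W ∧ c ∈ W := by
  simp [inside, and_assoc]

theorem rel_iff {ts : List Triple} {a b c : ℕ} :
    rel ts a b c = true ↔ (a, b, c) ∈ ts ∨ (b, a, c) ∈ ts := by
  simp only [rel, List.any_eq_true, Bool.and_eq_true, Bool.or_eq_true, Nat.beq_eq]
  constructor
  · rintro ⟨⟨x, y, z⟩, h, rfl, ⟨rfl, rfl⟩ | ⟨rfl, rfl⟩⟩ <;> simp [h]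
  · rintro (h | h)
    · exact ⟨_, h, rfl, .inl ⟨rfl, rfl⟩⟩
    · exact ⟨_, h, rfl, .inr ⟨rfl, rfl⟩⟩

/-- Membership of `ab|c` in the list. -/
def Rel (ts : List Triple) (a b c : ℕ) : Prop := rel ts a b c = true

theorem dict_iff {ts : List Triple} {x a b c : ℕ} :
    dict ts x a b c = true ↔ Forces (Rel ts) x a b c := by
  simp [dict, Forces, Rel]

theorem conf_iff {ts : List Triple} {x : ℕ} {t : Triple} :
    conf ts x t = true ↔
      Forces (Rel ts) x t.1 t.2.2 t.2.1 ∨ Forces (Rel ts) x t.2.1 t.2.2 t.1 := by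
  simp [conf, dict_iff]

/-- The list has exactly one triple on every three leaves below `n`. -/
structure Good (n : ℕ) (ts : List Triple) : Prop where
  lt : ∀ t ∈ ts, t.1 < n ∧ t.2.1 < n ∧ t.2.2 < n
  ne : ∀ t ∈ ts, t.1 ≠ t.2.1 ∧ t.1 ≠ t.2.2 ∧ t.2.1 ≠ t.2.2
  nodup : (ts.map Triple.support).Nodup
  exists_mem : ∀ a b c, a < n → b < n → c < n → a ≠ b → a ≠ c → b ≠ c →
    ∃ t ∈ ts, t.support = {a, b, c}

theorem Rel.exists_mem {ts : List Triple} {a b c : ℕ} (h : Rel ts a b c) :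
    ∃ t ∈ ts, t.support = {a, b, c} ∧ (t = (a, b, c) ∨ t = (b, a, c)) := by
  rcases rel_iff.1 h with h | h
  · exact ⟨_, h, rfl, .inl rfl⟩
  · exact ⟨_, h, Finset.insert_comm _ _ _, .inr rfl⟩

theorem Rel.of_mem {ts : List Triple} {t : Triple} (h : t ∈ ts) : Rel ts t.1 t.2.1 t.2.2 :=
  rel_iff.2 (.inl h)

theorem rel_or_of_support_eq {ts : List Triple} {a b c : ℕ} {t : Triple} (ht : t ∈ ts)
    (hab : a ≠ b) (hac : a ≠ c) (hbc : b ≠ c) (h : t.support = {a, b, c}) :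
    Rel ts a b c ∨ Rel ts a c b ∨ Rel ts b c a := by
  obtain ⟨x, y, z⟩ := t
  have ha : a ∈ Triple.support (x, y, z) := by rw [h]; simp
  have hb : b ∈ Triple.support (x, y, z) := by rw [h]; simp
  have hc : c ∈ Triple.support (x, y, z) := by rw [h]; simp
  simp only [Triple.mem_support] at ha hb hc
  simp only [Rel, rel_iff]
  rcases ha with rfl | rfl | rfl <;> rcases hb with rfl | rfl | rfl <;>
    rcases hc with rfl | rfl | rfl <;> first | contradiction | simp [ht]

theorem Good.eq_of_support_eq {n : ℕ} {ts : List Triple} (h : Good n ts) {s t : Triple}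
    (hs : s ∈ ts) (ht : t ∈ ts) (hst : s.support = t.support) : s = t :=
  List.inj_on_of_nodup_map h.nodup hs ht hst

theorem Good.denseRel {n : ℕ} {ts : List Triple} (h : Good n ts) : DenseRel n (Rel ts) where
  lt := by
    intro a b c hr
    rcases rel_iff.1 hr with hr | hr
    · exact h.lt _ hr
    · have := h.lt _ hr
      dsimp only at this
      omega
  ne := by
    intro a b c hr
    rcases rel_iff.1 hr with hr | hr
    · exact h.ne _ hr
    · have := h.ne _ hr
      dsimp only at this
      omega
  symm := by
    intro a b c hr
    rw [Rel, rel_iff] at hr ⊢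
    exact hr.symm
  asymm := by
    intro a b c h1 h2
    obtain ⟨s, hs, hs', hs''⟩ := h1.exists_mem
    obtain ⟨t, ht, ht', ht''⟩ := h2.exists_mem
    have : s = t := h.eq_of_support_eq hs ht (by rw [hs', ht', Finset.pair_comm])
    have hne := h.ne s hs
    subst this
    rcases hs'' with rfl | rfl <;> simp_all
  total := by
    intro a b c ha hb hc hab hac hbc
    obtain ⟨t, ht, hs⟩ := h.exists_mem a b c ha hb hc hab hac hbc
    exact rel_or_of_support_eq ht hab hac hbc hs

/-- The triple belongs to the relation. -/
def Triple.In (C : ℕ → ℕ → ℕ → Prop) (t : Triple) : Prop := C t.1 t.2.1 t.2.2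

open Classical in
/-- The number of triples outside a relation. -/
noncomputable def cost (C : ℕ → ℕ → ℕ → Prop) (ts : List Triple) : ℕ :=
  ts.countP fun t => ¬ t.In C

/-- Some tree is inconsistent with at most `k` of the triples. -/
def Pos (ts : List Triple) (k : ℕ) : Prop := ∃ C, TreeRel C ∧ cost C ts ≤ k

theorem TreeRel.of_rel {ts : List Triple} {C : ℕ → ℕ → ℕ → Prop} (hC : TreeRel C) {a b c : ℕ}
    (h : ∀ t ∈ ts, t.support = {a, b, c} → t.In C) (hr : Rel ts a b c) : C a b c := by
  obtain ⟨t, ht, hs, h'⟩ := hr.exists_mem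
  have := h t ht hs
  rcases h' with rfl | rfl
  · exact this
  · exact hC.symm this

/-- On three given leaves both relations select exactly one triplet, so one inclusion gives
equality. -/
theorem TreeRel.rel_iff {n : ℕ} {ts : List Triple} (hg : Good n ts) {C : ℕ → ℕ → ℕ → Prop}
    (hC : TreeRel C) {a b c : ℕ} (ha : a < n) (hb : b < n) (hc : c < n) (hab : a ≠ b)
    (hac : a ≠ c) (hbc : b ≠ c) (h : ∀ t ∈ ts, t.support = {a, b, c} → t.In C) :
    Rel ts a b c ↔ C a b c := by
  refine ⟨hC.of_rel h, fun hc' => ?_⟩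
  rcases hg.denseRel.total ha hb hc hab hac hbc with h' | h' | h'
  · exact h'
  · exact absurd (hC.of_rel (fun t ht hs => h t ht (by rw [hs, Finset.pair_comm])) h')
      (hC.asymm hc')
  · refine absurd (hC.of_rel (fun t ht hs => h t ht ?_) h') (hC.asymm (hC.symm hc'))
    rw [hs, Finset.pair_comm, Finset.insert_comm, Finset.pair_comm]

theorem countP_lt_countP {α : Type*} {p q : α → Bool} {l : List α}
    (h : ∀ x ∈ l, p x = true → q x = true) (h' : ∃ x ∈ l, q x = true ∧ ¬ p x = true) :
    l.countP p + 1 ≤ l.countP q := by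
  induction l with
  | nil => simp at h'
  | cons a l ih =>
    have hl : ∀ x ∈ l, p x = true → q x = true := fun x hx => h x (by simp [hx])
    rw [List.countP_cons, List.countP_cons]
    obtain ⟨x, hx, hqx, hpx⟩ := h'
    rcases List.mem_cons.1 hx with rfl | hx
    · have := List.countP_mono_left hl
      simp only [hqx, hpx, if_true]
      simp
      omega
    · have := ih hl ⟨x, hx, hqx, hpx⟩
      have h1 := h a (by simp)
      by_cases hpa : p a = true
      · simp only [hpa, h1 hpa, if_true]; omega
      · simp only [hpa]; simp; omega

theorem countP_or_le {α : Type*} (p q r : α → Bool) (l : List α)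
    (h : ∀ x ∈ l, r x = true → p x = true ∨ q x = true) :
    l.countP r ≤ l.countP p + l.countP q := by
  induction l with
  | nil => simp
  | cons a l ih =>
    have h1 := ih fun x hx => h x (by simp [hx])
    have h2 := h a (by simp)
    simp only [List.countP_cons]
    by_cases hr : r a = true
    · rcases h2 hr with h | h <;> simp only [hr, h, if_true] <;> omega
    · simp only [hr]; simp; omega

theorem add_countP_le {α : Type*} (p q r : α → Bool) (l : List α)
    (hp : ∀ x ∈ l, p x = true → r x = true) (hq : ∀ x ∈ l, q x = true → r x = true)
    (h : ∀ x ∈ l, p x = true → ¬ q x = true) :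
    l.countP p + l.countP q ≤ l.countP r := by
  induction l with
  | nil => simp
  | cons a l ih =>
    have h1 := ih (fun x hx => hp x (by simp [hx])) (fun x hx => hq x (by simp [hx]))
      fun x hx => h x (by simp [hx])
    have h2 := hp a (by simp)
    have h3 := hq a (by simp)
    have h4 := h a (by simp)
    simp only [List.countP_cons]
    cases hpa : p a <;> cases hqa : q a <;> cases hra : r a <;> simp_all <;> omega

/-! ### The packing -/

theorem mem_quads {n a b c d : ℕ} : (a, b, c, d) ∈ quads n ↔ a < n ∧ b < n ∧ c < n ∧ d < n := by
  simp [quads]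

theorem viol_iff {ts : List Triple} {a b c d : ℕ} : viol ts (a, b, c, d) = true ↔
    Rel ts a b c ∧ b ≠ d ∧ ¬ Rel ts d b c ∧ ¬ Rel ts a b d := by
  simp only [viol, Rel, Bool.and_eq_true, Bool.not_eq_true', and_assoc, ne_eq,
    Bool.not_eq_true, ← Nat.beq_eq]

/-- A tree is inconsistent with one of the three triplets of a violation. -/
theorem exists_not_in_of_viol {n : ℕ} {ts : List Triple} (hg : Good n ts)
    {C : ℕ → ℕ → ℕ → Prop} (hC : TreeRel C) {a b c d : ℕ} (hd : d < n)
    (h : viol ts (a, b, c, d) = true) : ∃ t ∈ ts, ¬ t.In C ∧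
      (t.support = {a, b, c} ∨ t.support = {d, b, c} ∨ t.support = {a, b, d}) := by
  obtain ⟨h1, h2, h3, h4⟩ := viol_iff.1 h
  have hne := hg.denseRel.ne h1
  have hlt := hg.denseRel.lt h1
  have had : a ≠ d := by rintro rfl; exact h3 h1
  have hcd : c ≠ d := by rintro rfl; exact h4 h1
  by_contra hn
  push Not at hn
  have e1 := hC.of_rel (fun t ht hs => by_contra fun h => (hn t ht h).1 hs) h1
  rcases hC.trans d e1 h2 with e | e
  · exact h3 ((hC.rel_iff hg hd hlt.2.1 hlt.2.2 h2.symm hcd.symm hne.2.2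
      (fun t ht hs => by_contra fun h => (hn t ht h).2.1 hs)).2 e)
  · exact h4 ((hC.rel_iff hg hlt.1 hlt.2.1 hd hne.1 had h2
      (fun t ht hs => by_contra fun h => (hn t ht h).2.2 hs)).2 e)

open Classical in
/-- What the greedy packing maintains. -/
structure PackInv (n : ℕ) (ts : List Triple) (l : List (ℕ × ℕ × ℕ × ℕ)) (s : List ℕ × ℕ) :
    Prop where
  le_cost : ∀ C, TreeRel C →
    s.2 ≤ ts.countP fun t => ¬ t.In C ∧ ∀ x ∈ t.support, x ∈ s.1
  length_le : s.1.length ≤ 4 * s.2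
  packed : ∀ a b c d, (a, b, c, d) ∈ l → viol ts (a, b, c, d) = true →
    b ∈ s.1 ∧ (a ∈ s.1 ∧ c ∈ s.1 ∨ d ∈ s.1 ∧ c ∈ s.1 ∨ a ∈ s.1 ∧ d ∈ s.1)

/-- For an accepted violation, the triplet missed by the tree lies inside the new cover but not
inside the old one, so the count of missed triplets inside the cover increases. A rejected violation
has one of its three triples inside the cover, which is the clause `packed`. -/
theorem PackInv.step {n : ℕ} {ts : List Triple} (hg : Good n ts) {l : List (ℕ × ℕ × ℕ × ℕ)}
    {s : List ℕ × ℕ} (h : PackInv n ts l s) {a b c d : ℕ} (hd : d < n) :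
    PackInv n ts ((a, b, c, d) :: l) (packStep ts s (a, b, c, d)) := by
  rw [packStep, Bool.cond_eq_ite]
  split_ifs with hv
  · simp only [Bool.and_eq_true, Bool.not_eq_true', ← Bool.not_eq_true, inside_iff] at hv
    obtain ⟨⟨⟨hv, n1⟩, n2⟩, n3⟩ := hv
    refine ⟨fun C hC => ?_, ?_, ?_⟩
    · refine (Nat.add_le_add_right (h.le_cost C hC) 1).trans (countP_lt_countP ?_ ?_)
      · simp only [decide_eq_true_eq]
        rintro t - ⟨h1, h2⟩
        exact ⟨h1, fun x hx => by simp [h2 x hx]⟩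
      · obtain ⟨t, ht, h1, h2⟩ := exists_not_in_of_viol hg hC hd hv
        refine ⟨t, ht, ?_⟩
        simp only [decide_eq_true_eq]
        refine ⟨⟨h1, ?_⟩, ?_⟩
        · rcases h2 with h2 | h2 | h2 <;> rw [h2] <;> simp
        · rintro ⟨-, h3⟩
          rcases h2 with h2 | h2 | h2 <;> rw [h2] at h3
          · exact n1 ⟨h3 a (by simp), h3 b (by simp), h3 c (by simp)⟩
          · exact n2 ⟨h3 d (by simp), h3 b (by simp), h3 c (by simp)⟩
          · exact n3 ⟨h3 a (by simp), h3 b (by simp), h3 d (by simp)⟩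
    · have := h.length_le
      simp only [List.length_cons]
      omega
    · intro a' b' c' d' hm hv'
      rcases List.mem_cons.1 hm with he | hm
      · simp only [Prod.mk.injEq] at he
        obtain ⟨rfl, rfl, rfl, rfl⟩ := he
        simp
      · have := h.packed a' b' c' d' hm hv'
        exact ⟨.tail _ <| .tail _ <| .tail _ <| .tail _ this.1, this.2.imp
          (.imp (.tail _ <| .tail _ <| .tail _ <| .tail _ ·)
            (.tail _ <| .tail _ <| .tail _ <| .tail _ ·))
          (.imp (.imp (.tail _ <| .tail _ <| .tail _ <| .tail _ ·)
            (.tail _ <| .tail _ <| .tail _ <| .tail _ ·))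
          (.imp (.tail _ <| .tail _ <| .tail _ <| .tail _ ·)
            (.tail _ <| .tail _ <| .tail _ <| .tail _ ·)))⟩
  · refine ⟨h.le_cost, h.length_le, fun a' b' c' d' hm hv' => ?_⟩
    rcases List.mem_cons.1 hm with he | hm
    · simp only [Prod.mk.injEq] at he
      obtain ⟨rfl, rfl, rfl, rfl⟩ := he
      simp only [Bool.and_eq_true, Bool.not_eq_true', ← Bool.not_eq_true, inside_iff] at hv
      tauto
    · exact h.packed a' b' c' d' hm hv'

theorem packInv_pack {n : ℕ} {ts : List Triple} (hg : Good n ts) :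
    ∃ l, (∀ q, q ∈ l ↔ q ∈ quads n) ∧ PackInv n ts l (pack n ts) := by
  have key : ∀ (l l' : List (ℕ × ℕ × ℕ × ℕ)) (s : List ℕ × ℕ), (∀ q ∈ l, q.2.2.2 < n) →
      PackInv n ts l' s → PackInv n ts (l.reverse ++ l') (l.foldl (packStep ts) s) := by
    intro l
    induction l with
    | nil => intro l' s _ h; simpa using h
    | cons q l ih =>
      intro l' s hl h
      obtain ⟨a, b, c, d⟩ := q
      have := ih _ _ (fun q hq => hl q (by simp [hq]))
        (h.step hg (a := a) (b := b) (c := c) (d := d) (hl (a, b, c, d) (by simp)))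
      simpa using this
  refine ⟨_, fun q => ?_, key (quads n) [] ([], 0) ?_ ⟨by simp, by simp, by simp⟩⟩
  · simp
  · rintro ⟨a, b, c, d⟩ hq
    exact (mem_quads.1 hq).2.2.2

theorem packed_pack {n : ℕ} {ts : List Triple} (hg : Good n ts) :
    Packed n (Rel ts) fun x => x ∈ (pack n ts).1 := by
  intro a b c d h hbd hd
  obtain ⟨l, hl, hp⟩ := packInv_pack hg
  have hlt := hg.denseRel.lt h
  have := hp.packed a b c d ((hl _).2 (mem_quads.2 ⟨hlt.1, hlt.2.1, hlt.2.2, hd⟩))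
  rw [viol_iff] at this
  tauto

theorem pack_le_cost {n : ℕ} {ts : List Triple} (hg : Good n ts) {C : ℕ → ℕ → ℕ → Prop}
    (hC : TreeRel C) : (pack n ts).2 ≤ cost C ts := by
  obtain ⟨l, hl, hp⟩ := packInv_pack hg
  refine (hp.le_cost C hC).trans (List.countP_mono_left fun t _ => ?_)
  simp only [decide_eq_true_eq]
  exact fun h => h.1

theorem mem_uncovered {n x : ℕ} {W : List ℕ} : x ∈ uncovered n W ↔ x < n ∧ x ∉ W := by
  simp only [uncovered, List.mem_filter, List.mem_range, Bool.not_eq_true', ← Bool.not_eq_true,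
    inList_iff]

theorem nodup_uncovered (n : ℕ) (W : List ℕ) : (uncovered n W).Nodup :=
  List.nodup_range.filter _

theorem le_length_uncovered {n : ℕ} {ts : List Triple} (hg : Good n ts) :
    n ≤ (uncovered n (pack n ts).1).length + 4 * (pack n ts).2 := by
  obtain ⟨l, hl, hp⟩ := packInv_pack hg
  have h1 := hp.length_le
  have h2 : List.range n ⊆ uncovered n (pack n ts).1 ++ (pack n ts).1 := by
    intro x hx
    rw [List.mem_append, mem_uncovered]
    have := List.mem_range.1 hx
    tauto
  have h3 := (List.nodup_range.subperm h2).length_le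
  rw [List.length_range, List.length_append] at h3
  omega

end RTI

namespace RTI

open While

/-! ### The matching -/

/-- `M` matches triplets to leaves in `U` that they are in conflict with. -/
structure IsMatching (ts : List Triple) (U : List ℕ) (M : Matching) : Prop where
  nodup_fst : (M.map Prod.fst).Nodup
  nodup_snd : (M.map Prod.snd).Nodup
  mem : ∀ p ∈ M, p.1 ∈ ts ∧ p.2 ∈ U ∧ conf ts p.2 p.1 = true

namespace IsMatching

variable {ts : List Triple} {U : List ℕ} {M : Matching}

theorem eq_of_snd_eq (h : IsMatching ts U M) {p q : Triple × ℕ} (hp : p ∈ M) (hq : q ∈ M)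
    (hpq : p.2 = q.2) : p = q := List.inj_on_of_nodup_map h.nodup_snd hp hq hpq

theorem nil (ts : List Triple) (U : List ℕ) : IsMatching ts U [] := ⟨by simp, by simp, by simp⟩

theorem sublist (h : IsMatching ts U M) {N : Matching} (hN : N.Sublist M) : IsMatching ts U N :=
  ⟨h.nodup_fst.sublist (hN.map _), h.nodup_snd.sublist (hN.map _),
    fun p hp => h.mem p (hN.subset hp)⟩

theorem cons (h : IsMatching ts U M) {t : Triple} {x : ℕ} (ht : t ∈ ts) (hx : x ∈ U)
    (hc : conf ts x t = true) (h1 : t ∉ M.map Prod.fst) (h2 : x ∉ M.map Prod.snd) :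
    IsMatching ts U ((t, x) :: M) := by
  refine ⟨List.nodup_cons.2 ⟨h1, h.nodup_fst⟩, List.nodup_cons.2 ⟨h2, h.nodup_snd⟩, ?_⟩
  simp only [List.mem_cons, forall_eq_or_imp]
  exact ⟨⟨ht, hx, hc⟩, h.mem⟩

end IsMatching

theorem mem_rematch {M : Matching} {t : Triple} {y : ℕ} {p : Triple × ℕ} :
    p ∈ M.rematch t y ↔ p = (t, y) ∨ p ∈ M ∧ p.1 ≠ t := by
  simp only [Matching.rematch, List.mem_cons, List.mem_filter, Bool.not_eq_true',
    ← Bool.not_eq_true, Triple.beq_iff, ne_eq]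

theorem IsMatching.rematch {ts : List Triple} {U : List ℕ} {M : Matching}
    (h : IsMatching ts U M) {t : Triple} {x : ℕ} (ht : t ∈ ts) (hx : x ∈ U)
    (hc : conf ts x t = true) (h2 : x ∉ M.map Prod.snd) : IsMatching ts U (M.rematch t x) := by
  refine (h.sublist List.filter_sublist).cons ht hx hc ?_ fun h' => ?_
  · simp only [List.mem_map, List.mem_filter, Bool.not_eq_true', ← Bool.not_eq_true,
      Triple.beq_iff]
    rintro ⟨p, ⟨-, hp⟩, rfl⟩
    exact hp rfl
  · exact h2 ((List.filter_sublist.map _).subset h')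

theorem length_filter_fst {M : Matching} (h : (M.map Prod.fst).Nodup) {p : Triple × ℕ}
    (hp : p ∈ M) : (M.filter fun q => !(q.1.beq p.1)).length + 1 = M.length := by
  induction M with
  | nil => simp at hp
  | cons q M ih =>
    rw [List.map_cons, List.nodup_cons] at h
    rcases List.mem_cons.1 hp with rfl | hp
    · have h1 : (p.1.beq p.1) = true := Triple.beq_iff.2 rfl
      rw [List.filter_cons, h1]
      simp only [Bool.not_true, Bool.false_eq_true, if_false, List.length_cons,
        Nat.add_right_cancel_iff]
      congr 1
      rw [List.filter_eq_self]
      intro q hq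
      rw [Bool.not_eq_true', ← Bool.not_eq_true, Triple.beq_iff]
      exact fun h' => h.1 (List.mem_map.2 ⟨q, hq, h'⟩)
    · have h1 : (q.1.beq p.1) = false := by
        rw [← Bool.not_eq_true, Triple.beq_iff]
        exact fun h' => h.1 (List.mem_map.2 ⟨p, hp, h'.symm⟩)
      rw [List.filter_cons, h1]
      simp [ih h.2 hp]

/-- What the search for alternating paths maintains. -/
structure SearchInv (ts : List Triple) (U : List ℕ) (M : Matching) (Q : List (ℕ × Matching)) :
    Prop where
  nodup : (Q.map Prod.fst).Nodup
  mem : ∀ q ∈ Q, q.1 ∈ U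
  isMatching : ∀ q ∈ Q, IsMatching ts U q.2
  notMem : ∀ q ∈ Q, q.1 ∉ q.2.map Prod.snd
  length_eq : ∀ q ∈ Q, q.2.length = M.length
  exists_mem : ∀ q ∈ Q, ∀ p ∈ q.2, ∃ z, (p.1, z) ∈ M ∧ (z = p.2 ∨ z ∈ Q.map Prod.fst)

theorem mem_reachable {ts : List Triple} {Q : List (ℕ × Matching)} {r : ℕ × Matching} :
    r ∈ reachable ts Q ↔ ∃ q ∈ Q, ∃ t ∈ ts, conf ts q.1 t = true ∧ ∃ p ∈ q.2, p.1 = t ∧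
      p.2 ∉ Q.map Prod.fst ∧ r = (p.2, q.2.rematch t q.1) := by
  simp only [reachable, List.mem_flatMap, List.mem_filter, List.mem_map (f := fun p : Triple × ℕ =>
    (p.2, _)), Bool.and_eq_true, Bool.not_eq_true', ← Bool.not_eq_true, Triple.beq_iff, inList_iff]
  constructor
  · rintro ⟨q, hq, t, ⟨ht, hc⟩, p, ⟨hp, hpt, hpQ⟩, rfl⟩
    exact ⟨q, hq, t, ht, hc, p, hp, hpt, hpQ, rfl⟩
  · rintro ⟨q, hq, t, ht, hc, p, hp, hpt, hpQ, rfl⟩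
    exact ⟨q, hq, t, ⟨ht, hc⟩, p, ⟨hp, hpt, hpQ⟩, rfl⟩

/-- Moving the triple `t` to the leaf already reached frees its partner, which becomes the new leaf,
and the size of the matching is unchanged. For `exists_mem`: a triple loses its original partner
only when that partner is reached. -/
theorem SearchInv.cons {ts : List Triple} {U : List ℕ} {M : Matching} {Q : List (ℕ × Matching)}
    (h : SearchInv ts U M Q) {r : ℕ × Matching} (hr : r ∈ reachable ts Q) :
    SearchInv ts U M (r :: Q) := by
  obtain ⟨q, hq, t, ht, hc, p, hp, rfl, hpQ, rfl⟩ := mem_reachable.1 hr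
  have hm := h.isMatching q hq
  constructor
  · exact List.nodup_cons.2 ⟨hpQ, h.nodup⟩
  · simp only [List.mem_cons, forall_eq_or_imp]
    exact ⟨(hm.mem p hp).2.1, h.mem⟩
  · simp only [List.mem_cons, forall_eq_or_imp]
    exact ⟨hm.rematch ht (h.mem q hq) hc (h.notMem q hq), h.isMatching⟩
  · simp only [List.mem_cons, forall_eq_or_imp]
    refine ⟨fun hm' => ?_, h.notMem⟩
    obtain ⟨p', hp', he⟩ := List.mem_map.1 hm'
    rcases mem_rematch.1 hp' with rfl | ⟨h1, h2⟩
    · exact hpQ (he ▸ List.mem_map_of_mem hq)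
    · exact h2 (by rw [hm.eq_of_snd_eq h1 hp he])
  · simp only [List.mem_cons, forall_eq_or_imp]
    refine ⟨?_, h.length_eq⟩
    rw [Matching.rematch, List.length_cons, length_filter_fst hm.nodup_fst hp, h.length_eq q hq]
  · simp only [List.mem_cons, forall_eq_or_imp]
    refine ⟨fun p' hp' => ?_, fun q' hq' p' hp' => ?_⟩
    · rcases mem_rematch.1 hp' with rfl | ⟨h1, h2⟩
      · obtain ⟨z, hz, hz'⟩ := h.exists_mem q hq p hp
        refine ⟨z, hz, .inr ?_⟩
        rcases hz' with rfl | hz'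
        · simp
        · exact List.mem_cons_of_mem _ hz'
      · obtain ⟨z, hz, hz'⟩ := h.exists_mem q hq p' h1
        exact ⟨z, hz, hz'.imp_right (List.mem_cons_of_mem _)⟩
    · obtain ⟨z, hz, hz'⟩ := h.exists_mem q' hq' p' hp'
      exact ⟨z, hz, hz'.imp_right (List.mem_cons_of_mem _)⟩

theorem mem_unmatched {U : List ℕ} {M : Matching} {x : ℕ} :
    x ∈ unmatched U M ↔ x ∈ U ∧ x ∉ M.map Prod.snd := by
  simp only [unmatched, List.mem_filter, Bool.not_eq_true', ← Bool.not_eq_true, inList_iff]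

theorem searchInv_start {ts : List Triple} {U : List ℕ} {M : Matching} (hU : U.Nodup)
    (hM : IsMatching ts U M) : SearchInv ts U M ((unmatched U M).map fun x => (x, M)) := by
  have hm : ∀ q ∈ (unmatched U M).map fun x => (x, M), q.1 ∈ unmatched U M ∧ q.2 = M := by
    simp only [List.mem_map]
    rintro q ⟨x, hx, rfl⟩
    exact ⟨hx, rfl⟩
  constructor
  · rw [List.map_map]
    change (List.map (fun x => x) _).Nodup
    rw [List.map_id']
    exact hU.filter _
  · exact fun q hq => (mem_unmatched.1 (hm q hq).1).1
  · intro q hq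
    rw [(hm q hq).2]
    exact hM
  · intro q hq
    rw [(hm q hq).2]
    exact (mem_unmatched.1 (hm q hq).1).2
  · intro q hq
    rw [(hm q hq).2]
  · intro q hq p hp
    rw [(hm q hq).2] at hp
    exact ⟨p.2, hp, .inl rfl⟩

theorem searchInv_iterate {ts : List Triple} {U : List ℕ} {M : Matching}
    {Q : List (ℕ × Matching)} (h : SearchInv ts U M Q) (i : ℕ) :
    SearchInv ts U M ((grow ts)^[i] Q) ∧ (∀ q ∈ Q, q ∈ (grow ts)^[i] Q) ∧
      (reachable ts ((grow ts)^[i] Q) = [] ∨ ((grow ts)^[i] Q).length = Q.length + i) := by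
  induction i with
  | zero => exact ⟨h, fun q hq => hq, .inr rfl⟩
  | succ i ih =>
    rw [Function.iterate_succ_apply']
    generalize (grow ts)^[i] Q = Q' at *
    obtain ⟨h1, h2, h3⟩ := ih
    cases hr : reachable ts Q' with
    | nil => rw [grow, hr]; exact ⟨h1, h2, .inl hr⟩
    | cons r l =>
      rw [grow, hr]
      refine ⟨h1.cons (by simp [hr]), fun q hq => List.mem_cons_of_mem _ (h2 q hq), .inr ?_⟩
      simp only [hr, reduceCtorEq, false_or] at h3
      simp [h3]
      omega

/-! ### Completeness of the search and matchings without augmentation -/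

section Alternating

variable {n : ℕ} {ts : List Triple} {U : List ℕ} {M : Matching}

theorem searchInv_alternating (hU : U.Nodup) (hM : IsMatching ts U M) :
    SearchInv ts U M (alternating n ts U M) :=
  (searchInv_iterate (searchInv_start hU hM) n).1

theorem mem_alternating_of_unmatched (hU : U.Nodup) (hM : IsMatching ts U M) {x : ℕ}
    (hx : x ∈ unmatched U M) : x ∈ (alternating n ts U M).map Prod.fst :=
  List.mem_map.2 ⟨(x, M), (searchInv_iterate (searchInv_start hU hM) n).2.1 _
    (List.mem_map.2 ⟨x, hx, rfl⟩), rfl⟩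

/-- The reached leaves are distinct and below `n`, and the search starts with at least one of them.
So the `n` rounds cannot all add a leaf, and the search has stopped. -/
theorem reachable_alternating (hU : U.Nodup) (hUn : ∀ x ∈ U, x < n) (hM : IsMatching ts U M)
    (hne : unmatched U M ≠ []) : reachable ts (alternating n ts U M) = [] := by
  rcases (searchInv_iterate (searchInv_start hU hM) n).2.2 with h | h
  · exact h
  · have h1 := searchInv_alternating (n := n) hU hM
    have h2 : (alternating n ts U M).map Prod.fst ⊆ List.range n := by
      intro x hx
      obtain ⟨q, hq, rfl⟩ := List.mem_map.1 hx
      exact List.mem_range.2 (hUn _ (h1.mem q hq))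
    have h3 := (h1.nodup.subperm h2).length_le
    have h4 := List.length_pos_iff.2 hne
    rw [List.length_map, List.length_range] at h3
    rw [List.length_map] at h
    change (alternating n ts U M).length = _ at h
    omega

theorem mem_larger {Q : List (ℕ × Matching)} {N : Matching} :
    N ∈ larger ts Q ↔ ∃ q ∈ Q, ∃ t ∈ ts, conf ts q.1 t = true ∧ t ∉ q.2.map Prod.fst ∧
      N = (t, q.1) :: q.2 := by
  have hc : ∀ (M : Matching) t, M.covers t = true ↔ t ∈ M.map Prod.fst := by
    intro M t
    simp [Matching.covers, List.any_eq_true, List.mem_map]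
  simp only [larger, List.mem_flatMap, List.mem_filter, List.mem_map (f := fun t : Triple =>
    ((t, _) :: _ : Matching)), Bool.and_eq_true, Bool.not_eq_true', ← Bool.not_eq_true, hc]
  constructor
  · rintro ⟨q, hq, t, ⟨ht, h1, h2⟩, rfl⟩
    exact ⟨q, hq, t, ht, h1, h2, rfl⟩
  · rintro ⟨q, hq, t, ht, h1, h2, rfl⟩
    exact ⟨q, hq, t, ⟨ht, h1, h2⟩, rfl⟩

theorem isMatching_augment (hU : U.Nodup) (hM : IsMatching ts U M) :
    IsMatching ts U (augment n ts U M) ∧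
      (larger ts (alternating n ts U M) = [] ∧ augment n ts U M = M ∨
        (augment n ts U M).length = M.length + 1) := by
  unfold augment
  cases h : larger ts (alternating n ts U M) with
  | nil => exact ⟨hM, .inl ⟨rfl, rfl⟩⟩
  | cons N l =>
    have hi := searchInv_alternating (n := n) hU hM
    obtain ⟨q, hq, t, ht, h1, h2, rfl⟩ := mem_larger.1 (show N ∈ _ by rw [h]; simp)
    exact ⟨(hi.isMatching q hq).cons ht (hi.mem q hq) h1 h2 (hi.notMem q hq),
      .inr (by simp [hi.length_eq q hq])⟩

/-- A round adds an edge or finds nothing, and in the latter case the matching stays fixed from then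
on. Hence the `k + 1` rounds. -/
theorem isMatching_matching (hU : U.Nodup) (k : ℕ) :
    IsMatching ts U (matching n ts U k) ∧
      (larger ts (alternating n ts U (matching n ts U k)) = [] ∨
        k < (matching n ts U k).length) := by
  have key : ∀ i, IsMatching ts U ((augment n ts U)^[i] []) ∧
      (larger ts (alternating n ts U ((augment n ts U)^[i] [])) = [] ∨
        i ≤ ((augment n ts U)^[i] []).length) := by
    intro i
    induction i with
    | zero => exact ⟨.nil _ _, .inr (by simp)⟩
    | succ i ih =>
      rw [Function.iterate_succ_apply']
      generalize (augment n ts U)^[i] [] = M at *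
      obtain ⟨h1, h2⟩ := ih
      obtain ⟨h3, h4⟩ := isMatching_augment (n := n) hU h1
      refine ⟨h3, ?_⟩
      rcases h4 with ⟨h4, h5⟩ | h4
      · rw [h5]; exact .inl h4
      · rcases h2 with h2 | h2
        · have : augment n ts U M = M := by rw [augment, h2]; rfl
          rw [this] at h4
          omega
        · right; omega
  exact key (k + 1)

/-- If there is no larger matching, then the conflicts of the leaves reached are matched to the
leaves reached. -/
theorem exists_mem_matching (hU : U.Nodup) (hUn : ∀ x ∈ U, x < n) (hM : IsMatching ts U M)
    (hne : unmatched U M ≠ []) (hl : larger ts (alternating n ts U M) = []) {t : Triple}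
    (ht : t ∈ ts) {x : ℕ} (hx : x ∈ (alternating n ts U M).map Prod.fst)
    (hc : conf ts x t = true) : ∃ y, (t, y) ∈ M ∧ y ∈ (alternating n ts U M).map Prod.fst := by
  have hi := searchInv_alternating (n := n) hU hM
  have hr := reachable_alternating hU hUn hM hne
  obtain ⟨q, hq, rfl⟩ := List.mem_map.1 hx
  by_cases hcov : t ∈ q.2.map Prod.fst
  · obtain ⟨p, hp, rfl⟩ := List.mem_map.1 hcov
    obtain ⟨z, hz, rfl | hz'⟩ := hi.exists_mem q hq p hp
    · refine ⟨p.2, hz, ?_⟩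
      -- The triple `p.1` still has its original partner `p.2`. If that partner were unreached, the
      -- search could continue through it.
      by_contra hn
      have := mem_reachable.2 ⟨q, hq, p.1, ht, hc, p, hp, rfl, hn, rfl⟩
      rw [hr] at this
      simp at this
    · exact ⟨z, hz, hz'⟩
  · have := mem_larger.2 ⟨q, hq, t, ht, hc, hcov, rfl⟩
    rw [hl] at this
    simp at this

end Alternating

open Classical in
/-- Conflicts that are matched force different inconsistent triplets. -/
theorem length_le_countP {n : ℕ} {ts : List Triple} (hg : Good n ts) {W U : List ℕ}
    (hW : Packed n (Rel ts) fun x => x ∈ W) (hU : ∀ x ∈ U, x < n ∧ x ∉ W) {M : Matching}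
    (hM : IsMatching ts U M) {C : ℕ → ℕ → ℕ → Prop} (hC : TreeRel C) :
    M.length ≤ ts.countP fun t =>
      ¬ t.In C ∧ (t ∈ M.map Prod.fst ∨ ∃ x ∈ M.map Prod.snd, x ∈ t.support) := by
  induction M with
  | nil => simp
  | cons p M ih =>
    have hM' := hM.sublist (List.sublist_cons_self p M)
    obtain ⟨t, x⟩ := p
    -- By `Forces.of_packed`, a triple with an uncovered leaf agrees with what `x` forces, so
    -- conflicts lie entirely in `W`.
    have inW : ∀ p ∈ (t, x) :: M, ∀ y ∈ p.1.support, y ∈ W := by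
      intro p hp y hy
      obtain ⟨h1, h2, h3⟩ := hM.mem p hp
      have hne := hg.ne _ h1
      have hr := Rel.of_mem h1
      by_contra hyW
      have hw : p.1.1 ∉ W ∨ p.1.2.1 ∉ W ∨ p.1.2.2 ∉ W := by
        rcases Triple.mem_support.1 hy with rfl | rfl | rfl <;> tauto
      rcases conf_iff.1 h3 with h | h
      · exact hg.denseRel.asymm hr
          (h.of_packed hg.denseRel hW (hU _ h2).2 hne.2.1 hne.1 (by tauto))
      · exact hg.denseRel.asymm (hg.denseRel.symm hr)
          (h.of_packed hg.denseRel hW (hU _ h2).2 hne.2.2 hne.1.symm (by tauto))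
    obtain ⟨ht, hx, hc⟩ := hM.mem (t, x) (by simp)
    dsimp only at ht hx hc
    have hlt := hg.lt _ ht
    have hne := hg.ne _ ht
    have hxt : x ∉ t.support := fun h => (hU x hx).2 (inW (t, x) (by simp) x h)
    -- If the tree contained all triplets at `x` inside `t` plus `x`, it would contain the triplet
    -- that `x` forces on the leaves of `t`, and therefore not `t`.
    obtain ⟨s, hs, hsC, hst⟩ : ∃ s ∈ ts, ¬ s.In C ∧
        (s = t ∨ x ∈ s.support ∧ s.support ⊆ insert x t.support) := by
      by_contra hn
      push Not at hn
      have e1 : t.In C := by_contra fun h => (hn t ht h).1 rfl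
      have e2 : ∀ a b c, (x = a ∨ x = b ∨ x = c) → a ∈ insert x t.support →
          b ∈ insert x t.support → c ∈ insert x t.support → Rel ts a b c → C a b c := by
        intro a b c hx ha hb hc hr
        refine hC.of_rel (fun s hs hss => by_contra fun h => (hn s hs h).2 ?_ ?_) hr
        · rw [hss]; simpa using hx
        · rw [hss]
          intro y hy
          simp only [Finset.mem_insert, Finset.mem_singleton] at hy
          rcases hy with rfl | rfl | rfl <;> assumption
      have m1 : t.1 ∈ insert x t.support := by simp [Triple.support]
      have m2 : t.2.1 ∈ insert x t.support := by simp [Triple.support]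
      have m3 : t.2.2 ∈ insert x t.support := by simp [Triple.support]
      have m0 : x ∈ insert x t.support := by simp
      have e3 : ∀ a b c, a ∈ insert x t.support → b ∈ insert x t.support →
          c ∈ insert x t.support → Forces (Rel ts) x a b c → Forces C x a b c :=
        fun a b c ha hb hc h => h.imp
          (.imp (e2 _ _ _ (by simp) m0 ha hc) (e2 _ _ _ (by simp) m0 hb hc))
          (.imp (e2 _ _ _ (by simp) ha hb m0) (e2 _ _ _ (by simp) hc m0 ha))
      rcases conf_iff.1 hc with h | h
      · exact hC.asymm e1 (hC.of_forces (e3 _ _ _ m1 m3 m2 h) hne.2.1 hne.1)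
      · exact hC.asymm (hC.symm e1) (hC.of_forces (e3 _ _ _ m2 m3 m1 h) hne.2.2 hne.1.symm)
    have hfst := (List.nodup_cons.1 hM.nodup_fst).1
    have hsnd := (List.nodup_cons.1 hM.nodup_snd).1
    rw [List.length_cons]
    refine (Nat.add_le_add_right (ih hM') 1).trans (countP_lt_countP ?_ ⟨s, hs, ?_⟩)
    · simp only [decide_eq_true_eq]
      rintro s - ⟨h1, h2⟩
      refine ⟨h1, h2.imp (List.mem_cons_of_mem _) ?_⟩
      rintro ⟨y, hy, hys⟩
      exact ⟨y, List.mem_cons_of_mem _ hy, hys⟩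
    · simp only [decide_eq_true_eq]
      refine ⟨⟨hsC, ?_⟩, ?_⟩
      · rcases hst with rfl | ⟨hst, -⟩
        · left; simp
        · right; exact ⟨x, by simp, hst⟩
      -- The triplet `s` was not counted for the other edges: it is `t` itself, which lies in `W`
      -- and is matched once, or its only leaf outside `W` is `x`, which is matched once.
      · rintro ⟨-, h⟩
        have hyW : ∀ y ∈ M.map Prod.snd, y ∉ W := by
          intro y hy
          obtain ⟨p, hp, rfl⟩ := List.mem_map.1 hy
          exact (hU _ (hM'.mem p hp).2.1).2
        rcases hst with rfl | ⟨hst, hsub⟩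
        · rcases h with h | ⟨y, hy, hys⟩
          · exact hfst h
          · exact hyW y hy (inW (s, x) (by simp) y hys)
        · rcases h with h | ⟨y, hy, hys⟩
          · obtain ⟨p, hp, rfl⟩ := List.mem_map.1 h
            exact (hU x hx).2 (inW p (by simp [hp]) x hst)
          · rcases Finset.mem_insert.1 (hsub hys) with rfl | hyt
            · exact hsnd hy
            · exact hyW y hy (inW (t, x) (by simp) y hyt)

end RTI

namespace RTI

open While

/-! ### The reduction -/

theorem edit_cases (ts : List Triple) (X : List ℕ) (t : Triple) :
    (∃ x ∈ X, Forces (Rel ts) x t.1 t.2.2 t.2.1) ∧ edit ts X t = (t.1, t.2.2, t.2.1) ∨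
    (∃ x ∈ X, Forces (Rel ts) x t.2.1 t.2.2 t.1) ∧ edit ts X t = (t.2.1, t.2.2, t.1) ∨
    (∀ x ∈ X, ¬ conf ts x t = true) ∧ edit ts X t = t := by
  simp only [edit, Bool.cond_eq_ite]
  split_ifs with h1 h2 <;> simp only [List.any_eq_true, dict_iff] at h1
  · exact .inl ⟨h1, rfl⟩
  · simp only [List.any_eq_true, dict_iff] at h2
    exact .inr (.inl ⟨h2, rfl⟩)
  · simp only [List.any_eq_true, dict_iff] at h2
    refine .inr (.inr ⟨fun x hx h => ?_, rfl⟩)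
    rw [conf_iff] at h
    rcases h with h | h
    · exact h1 ⟨x, hx, h⟩
    · exact h2 ⟨x, hx, h⟩

theorem support_edit (ts : List Triple) (X : List ℕ) (t : Triple) :
    (edit ts X t).support = t.support := by
  ext y
  rcases edit_cases ts X t with ⟨-, h⟩ | ⟨-, h⟩ | ⟨-, h⟩ <;> rw [h] <;>
    simp only [Triple.mem_support] <;> tauto

/-- Some leaf of `X` lies in the triple or distinguishes between its leaves. -/
def Touched (ts : List Triple) (X : List ℕ) (t : Triple) : Prop :=
  ∃ x ∈ X, Touches (Rel ts) x t.1 t.2.1 t.2.2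

theorem touched_of_conf {ts : List Triple} {X : List ℕ} {t : Triple} {x : ℕ} (hx : x ∈ X)
    (h : conf ts x t = true) : Touched ts X t := by
  refine ⟨x, hx, ?_⟩
  rw [conf_iff] at h
  unfold Forces at h
  unfold Touches
  have hs : ∀ a b c, Rel ts a b c → Rel ts b a c := by
    intro a b c h
    rw [Rel, rel_iff] at h ⊢
    exact h.symm
  have h1 := hs t.2.1 x t.1
  have h2 := hs t.1 x t.2.1
  tauto

theorem touched_of_mem_support {ts : List Triple} {X : List ℕ} {t : Triple} {x : ℕ} (hx : x ∈ X)
    (h : x ∈ t.support) : Touched ts X t := by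
  refine ⟨x, hx, ?_⟩
  rw [Triple.mem_support] at h
  unfold Touches
  tauto

section Reduction

variable {n : ℕ} {ts : List Triple} {W : List ℕ} {X : List ℕ}

/-- An edited triple is one forced by a leaf of `X`, at which the tree agrees. An unedited touched
triple either contains a leaf of `X`, or is the only one of the three possibilities on its leaves
that the touching leaf can force without a conflict. -/
theorem edit_in_of_touched (hg : Good n ts) (hW : Packed n (Rel ts) fun x => x ∈ W)
    (hX : ∀ x ∈ X, x < n ∧ x ∉ W) {C : ℕ → ℕ → ℕ → Prop} (hC : TreeRel C)
    (hCX : ∀ x ∈ X, AgreesAt (Rel ts) C x) {t : Triple} (ht : t ∈ ts) (h : Touched ts X t) :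
    (edit ts X t).In C := by
  have hne := hg.ne t ht
  have hlt := hg.lt t ht
  rcases edit_cases ts X t with ⟨⟨x, hx, hf⟩, he⟩ | ⟨⟨x, hx, hf⟩, he⟩ | ⟨hn, he⟩
  · rw [he]
    exact hf.of_agreesAt hC (hCX x hx) hne.2.1 hne.1
  · rw [he]
    exact hf.of_agreesAt hC (hCX x hx) hne.2.2 hne.1.symm
  · rw [he]
    obtain ⟨x, hx, h⟩ := h
    have hr := Rel.of_mem ht
    by_cases h1 : x = t.1
    · exact hCX x hx _ _ _ (.inl h1) hr
    by_cases h2 : x = t.2.1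
    · exact hCX x hx _ _ _ (.inr (.inl h2)) hr
    by_cases h3 : x = t.2.2
    · exact hCX x hx _ _ _ (.inr (.inr h3)) hr
    have hnx := hn x hx
    rw [conf_iff, not_or] at hnx
    rcases h.forces hg.denseRel (hW.starConsistent (hX x hx).2) hlt.1 hlt.2.1 hlt.2.2 hne.1 hne.2.1
      hne.2.2 (hX x hx).1 h1 h2 h3 with hf | hf | hf
    · exact hf.of_agreesAt hC (hCX x hx) hne.1 hne.2.1
    · exact absurd hf hnx.1
    · exact absurd hf hnx.2

theorem good_edit (hg : Good n ts) (X : List ℕ) : Good n (ts.map fun t => edit ts X t) where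
  lt := by
    simp only [List.mem_map]
    rintro t' ⟨t, ht, rfl⟩
    have := hg.lt t ht
    rcases edit_cases ts X t with ⟨-, h⟩ | ⟨-, h⟩ | ⟨-, h⟩ <;> rw [h] <;> (try dsimp only) <;> omega
  ne := by
    simp only [List.mem_map]
    rintro t' ⟨t, ht, rfl⟩
    have := hg.ne t ht
    rcases edit_cases ts X t with ⟨-, h⟩ | ⟨-, h⟩ | ⟨-, h⟩ <;> rw [h] <;> (try dsimp only) <;> omega
  nodup := by
    rw [List.map_map]
    have : (Triple.support ∘ fun t => edit ts X t) = Triple.support :=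
      funext fun t => support_edit ts X t
    rw [this]
    exact hg.nodup
  exists_mem := by
    intro a b c ha hb hc hab hac hbc
    obtain ⟨t, ht, h⟩ := hg.exists_mem a b c ha hb hc hab hac hbc
    exact ⟨_, List.mem_map.2 ⟨t, ht, rfl⟩, (support_edit ts X t).trans h⟩

/-- Away from the deleted leaf the relabelling is a transposition, hence injective, and tree
relations can be transported along it. -/
theorem relabel_eq_swap {n x i : ℕ} (hi : i ≠ x) : relabel n x i = Equiv.swap x (n - 1) i := by
  rw [relabel, Bool.cond_eq_ite, Equiv.swap_apply_def]
  simp only [Nat.beq_eq, hi, if_false]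

theorem mem_deleteLeaf {n x : ℕ} {ts : List Triple} {t' : Triple} :
    t' ∈ deleteLeaf n x ts ↔ ∃ t ∈ ts, x ∉ t.support ∧ t' = (Equiv.swap x (n - 1) t.1,
      Equiv.swap x (n - 1) t.2.1, Equiv.swap x (n - 1) t.2.2) := by
  simp only [deleteLeaf, List.mem_map, List.mem_filter, Bool.not_eq_true', ← Bool.not_eq_true,
    Triple.has_iff, and_assoc]
  refine exists_congr fun t => and_congr_right fun _ => and_congr_right fun h => ?_
  simp only [Triple.mem_support, not_or] at h
  rw [relabel_eq_swap (Ne.symm h.1), relabel_eq_swap (Ne.symm h.2.1),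
    relabel_eq_swap (Ne.symm h.2.2), eq_comm]

theorem good_deleteLeaf (hg : Good n ts) {x : ℕ} (hx : x < n) :
    Good (n - 1) (deleteLeaf n x ts) := by
  set e := Equiv.swap x (n - 1) with he
  have hlt : ∀ i, i < n → i ≠ x → e i < n - 1 := by
    intro i hi hix
    rw [he, Equiv.swap_apply_def, if_neg hix]
    split_ifs <;> omega
  have hlt' : ∀ i, i < n - 1 → e i < n ∧ e i ≠ x := by
    intro i hi
    rw [he, Equiv.swap_apply_def]
    split_ifs <;> omega
  constructor
  · intro t' ht'
    obtain ⟨t, ht, hxt, rfl⟩ := mem_deleteLeaf.1 ht'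
    simp only [Triple.mem_support, not_or] at hxt
    have h := hg.lt t ht
    exact ⟨hlt _ h.1 (Ne.symm hxt.1), hlt _ h.2.1 (Ne.symm hxt.2.1),
      hlt _ h.2.2 (Ne.symm hxt.2.2)⟩
  · intro t' ht'
    obtain ⟨t, ht, hxt, rfl⟩ := mem_deleteLeaf.1 ht'
    have h := hg.ne t ht
    exact ⟨e.injective.ne h.1, e.injective.ne h.2.1, e.injective.ne h.2.2⟩
  · have h1 : (deleteLeaf n x ts).map Triple.support =
        ((ts.filter fun t => !(t.has x)).map Triple.support).map (Finset.map e.toEmbedding) := by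
      rw [deleteLeaf, List.map_map, List.map_map]
      refine List.map_congr_left fun t ht => ?_
      simp only [List.mem_filter, Bool.not_eq_true', ← Bool.not_eq_true, Triple.has_iff,
        Triple.mem_support, not_or] at ht
      simp only [Function.comp_apply, Triple.support, Finset.map_insert, Finset.map_singleton,
        relabel_eq_swap (Ne.symm ht.2.1), relabel_eq_swap (Ne.symm ht.2.2.1),
        relabel_eq_swap (Ne.symm ht.2.2.2)]
      rfl
    rw [h1]
    exact (hg.nodup.sublist (List.filter_sublist.map _)).map (Finset.map_injective _)
  · intro a b c ha hb hc hab hac hbc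
    obtain ⟨t, ht, h⟩ := hg.exists_mem _ _ _ (hlt' a ha).1 (hlt' b hb).1 (hlt' c hc).1
      (e.injective.ne hab) (e.injective.ne hac) (e.injective.ne hbc)
    refine ⟨_, mem_deleteLeaf.2 ⟨t, ht, ?_, rfl⟩, ?_⟩
    · rw [h]
      have h1 := (hlt' a ha).2
      have h2 := (hlt' b hb).2
      have h3 := (hlt' c hc).2
      simp only [Finset.mem_insert, Finset.mem_singleton]
      tauto
    · have h1 := congrArg (Finset.map e.toEmbedding) h
      simp only [Triple.support, Finset.map_insert, Finset.map_singleton,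
        Equiv.coe_toEmbedding] at h1
      rw [Triple.support, h1]
      simp [he]

theorem TreeRel.comap {C : ℕ → ℕ → ℕ → Prop} (hC : TreeRel C) (e : ℕ ≃ ℕ) :
    TreeRel fun a b c => C (e a) (e b) (e c) where
  ne h := by
    have := hC.ne h
    simpa using this
  symm h := hC.symm h
  asymm h := hC.asymm h
  total h1 h2 h3 := hC.total (e.injective.ne h1) (e.injective.ne h2) (e.injective.ne h3)
  trans d h hd := hC.trans _ h (e.injective.ne hd)

theorem cost_deleteLeaf (C : ℕ → ℕ → ℕ → Prop) (x : ℕ) : cost C (deleteLeaf n x ts) =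
    cost (fun a b c => C (Equiv.swap x (n - 1) a) (Equiv.swap x (n - 1) b)
      (Equiv.swap x (n - 1) c)) (ts.filter fun t => !(t.has x)) := by
  rw [cost, cost, deleteLeaf, List.countP_map]
  refine List.countP_congr fun t ht => ?_
  simp only [List.mem_filter, Bool.not_eq_true', ← Bool.not_eq_true, Triple.has_iff,
    Triple.mem_support, not_or] at ht
  simp only [Function.comp_apply, decide_eq_true_eq]
  simp only [Triple.In, relabel_eq_swap (Ne.symm ht.2.1),
    relabel_eq_swap (Ne.symm ht.2.2.1), relabel_eq_swap (Ne.symm ht.2.2.2)]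

theorem pos_deleteLeaf (n x : ℕ) (ts : List Triple) (k : ℕ) :
    Pos (deleteLeaf n x ts) k ↔ Pos (ts.filter fun t => !(t.has x)) k := by
  constructor
  · rintro ⟨C, hC, h⟩
    exact ⟨_, hC.comap (Equiv.swap x (n - 1)), by rwa [cost_deleteLeaf] at h⟩
  · rintro ⟨C, hC, h⟩
    refine ⟨_, hC.comap (Equiv.swap x (n - 1)), ?_⟩
    rw [cost_deleteLeaf]
    simpa using h

-- In both directions the tree is rebuilt to agree at every leaf of `X`, which changes nothing on
-- untouched triples. From the reduced to the original instance, a triple newly missed must be one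
-- of the edited triples `F`, so at most `|F|` is added. Conversely, the rebuilt tree satisfies
-- every touched triple after editing, while the original tree missed at least `|F|` touched triples
-- because of the matching; so at least `|F|` is saved.
open Classical in
theorem pos_edit (hg : Good n ts) (hW : Packed n (Rel ts) fun x => x ∈ W)
    (hX : ∀ x ∈ X, x < n ∧ x ∉ W) {U : List ℕ} (hU : ∀ x ∈ U, x < n ∧ x ∉ W) {M : Matching}
    (hM : IsMatching ts U M)
    (hF : ∀ t ∈ ts, ∀ x ∈ X, conf ts x t = true → ∃ y, (t, y) ∈ M ∧ y ∈ X) {x : ℕ} (hx : x ∈ X)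
    {k : ℕ} (hk : M.length ≤ k) :
    Pos ((ts.map fun t => edit ts X t).filter fun t => !(t.has x))
      (k - (ts.filter fun t => X.any fun x => conf ts x t).length) ↔ Pos ts k := by
  set F := ts.filter fun t => X.any fun x => conf ts x t with hFdef
  have memF : ∀ t, t ∈ F ↔ t ∈ ts ∧ ∃ x ∈ X, conf ts x t = true := by
    intro t
    simp [hFdef, List.mem_filter, List.any_eq_true]
  set N := M.filter fun p => decide (p.1 ∈ F ∧ p.2 ∈ X) with hN
  have hNM : IsMatching ts U N := hM.sublist List.filter_sublist
  have hFN : F.length ≤ N.length := by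
    have h1 : F.Nodup := hg.nodup.of_map.filter _
    have h2 : F ⊆ N.map Prod.fst := by
      intro t ht
      obtain ⟨h3, x, hx, h4⟩ := (memF t).1 ht
      obtain ⟨y, hy, hyX⟩ := hF t h3 x hx h4
      exact List.mem_map.2 ⟨(t, y), List.mem_filter.2 ⟨hy, by simpa using ⟨ht, hyX⟩⟩, rfl⟩
    simpa using (h1.subperm h2).length_le
  -- This keeps the subtraction of `|F|` from the budget from being truncated.
  have hFk : F.length ≤ k := hFN.trans ((List.length_filter_le _ _).trans hk)
  have keep : ∀ C C' : ℕ → ℕ → ℕ → Prop, (∀ a b c, a < n → b < n → c < n → a ≠ b → a ≠ c → b ≠ c →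
      (∀ x ∈ X, ¬ Touches (Rel ts) x a b c) → (C' a b c ↔ C a b c)) →
      ∀ t ∈ ts, ¬ Touched ts X t → (t.In C' ↔ t.In C) := by
    intro C C' h t ht hn
    have hlt := hg.lt t ht
    have hne := hg.ne t ht
    exact h _ _ _ hlt.1 hlt.2.1 hlt.2.2 hne.1 hne.2.1 hne.2.2 fun x hx hx' => hn ⟨x, hx, hx'⟩
  have edit_eq : ∀ t, (∀ x ∈ X, ¬ conf ts x t = true) → edit ts X t = t := by
    intro t h
    rcases edit_cases ts X t with ⟨⟨x, hx, hf⟩, -⟩ | ⟨⟨x, hx, hf⟩, -⟩ | ⟨-, he⟩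
    · exact absurd (conf_iff.2 (.inl hf)) (h x hx)
    · exact absurd (conf_iff.2 (.inr hf)) (h x hx)
    · exact he
  have edit_eq' : ∀ t, ¬ Touched ts X t → edit ts X t = t :=
    fun t h => edit_eq t fun x hx hc => h (touched_of_conf hx hc)
  constructor
  · rintro ⟨C, hC, hcost⟩
    obtain ⟨C', hC', h1, h2⟩ := exists_agreesAt_list hg.denseRel hW X
      (fun x hx => ⟨(hX x hx).2, (hX x hx).1⟩) hC
    refine ⟨C', hC', ?_⟩
    have e1 : cost C' ts ≤ F.length + cost C ((ts.map fun t => edit ts X t).filter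
        fun t => !(t.has x)) := by
      rw [hFdef, ← List.countP_eq_length_filter, cost, cost, List.countP_filter, List.countP_map]
      refine countP_or_le _ _ _ _ fun t ht htC => ?_
      simp only [decide_eq_true_eq, Function.comp_apply, Bool.and_eq_true, Bool.not_eq_true',
        ← Bool.not_eq_true, Triple.has_iff, List.any_eq_true] at htC ⊢
      by_cases htt : Touched ts X t
      · left
        by_contra hn
        push Not at hn
        have := edit_in_of_touched hg hW hX hC' h1 ht htt
        rw [edit_eq t hn] at this
        exact htC this
      · right
        rw [edit_eq' t htt]
        exact ⟨fun h => htC ((keep C C' h2 t ht htt).2 h),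
          fun h => htt (touched_of_mem_support hx h)⟩
    omega
  · rintro ⟨C, hC, hcost⟩
    obtain ⟨C', hC', h1, h2⟩ := exists_agreesAt_list hg.denseRel hW X
      (fun x hx => ⟨(hX x hx).2, (hX x hx).1⟩) hC
    refine ⟨C', hC', ?_⟩
    have e1 := length_le_countP hg hW hU hNM hC
    have e2 : cost C' ((ts.map fun t => edit ts X t).filter fun t => !(t.has x)) +
        ts.countP (fun t => ¬ t.In C ∧ (t ∈ N.map Prod.fst ∨ ∃ x ∈ N.map Prod.snd,
          x ∈ t.support)) ≤ cost C ts := by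
      have e3 : cost C' ((ts.map fun t => edit ts X t).filter fun t => !(t.has x)) ≤
          ts.countP fun t => ¬ (edit ts X t).In C' := by
        rw [cost, List.countP_filter, List.countP_map]
        refine List.countP_mono_left fun t _ => ?_
        simp only [Function.comp_apply, Bool.and_eq_true]
        exact fun h => h.1
      refine (Nat.add_le_add_right e3 _).trans ?_
      have e4 : ∀ t ∈ ts, ¬ (edit ts X t).In C' → ¬ Touched ts X t ∧ ¬ t.In C := by
        intro t ht h
        have h3 : ¬ Touched ts X t := fun h' =>
          h (edit_in_of_touched hg hW hX hC' h1 ht h')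
        rw [edit_eq' t h3] at h
        exact ⟨h3, fun h' => h ((keep C C' h2 t ht h3).2 h')⟩
      refine add_countP_le _ _ _ _ ?_ ?_ ?_
      · simp only [decide_eq_true_eq]
        exact fun t ht h => (e4 t ht h).2
      · simp only [decide_eq_true_eq]
        exact fun t ht h => h.1
      · simp only [decide_eq_true_eq]
        rintro t ht h ⟨-, h'⟩
        refine (e4 t ht h).1 ?_
        rcases h' with h' | ⟨y, hy, hyt⟩
        · obtain ⟨p, hp, rfl⟩ := List.mem_map.1 h'
          have hp' := (List.mem_filter.1 hp).2
          simp only [decide_eq_true_eq] at hp'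
          obtain ⟨-, x, hx, hc⟩ := (memF _).1 hp'.1
          exact touched_of_conf hx hc
        · obtain ⟨p, hp, rfl⟩ := List.mem_map.1 hy
          have hp' := (List.mem_filter.1 hp).2
          simp only [decide_eq_true_eq] at hp'
          exact touched_of_mem_support hp'.2 hyt
    omega

end Reduction

/-! ### The kernelization -/

/-- `s'` is a valid state equivalent to `s` with no larger parameter. -/
structure Reduces (s s' : State) : Prop where
  good : Good s'.1 s'.2.1
  pos : 0 < s'.1
  pos_iff : Pos s'.2.1 s'.2.2 ↔ Pos s.2.1 s.2.2
  le : s'.2.2 ≤ s.2.2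

theorem Reduces.trans {s s' s'' : State} (h : Reduces s s') (h' : Reduces s' s'') :
    Reduces s s'' :=
  ⟨h'.good, h'.pos, h'.pos_iff.trans h.pos_iff, h'.le.trans h.le⟩

theorem good_negative : Good negative.1 negative.2.1 where
  lt := by decide
  ne := by decide
  nodup := by decide
  exists_mem := by
    intro a b c ha hb hc
    change a < 4 at ha
    change b < 4 at hb
    change c < 4 at hc
    interval_cases a <;> interval_cases b <;> interval_cases c <;> decide

/-- The triplet `01|2` and the leaf `3` form a violation, so every tree misses a triplet, but the
budget is `0`. -/
theorem not_pos_negative : ¬ Pos negative.2.1 negative.2.2 := by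
  rintro ⟨C, hC, h⟩
  obtain ⟨t, ht, h1, -⟩ := exists_not_in_of_viol good_negative hC (a := 0) (b := 1) (c := 2)
    (d := 3) (by decide) (by decide)
  have h2 : cost C negative.2.1 = 0 := Nat.le_zero.1 h
  rw [cost, List.countP_eq_zero] at h2
  exact h2 t ht (by simpa using h1)

theorem reduces_negative {s : State} (h : ¬ Pos s.2.1 s.2.2) : Reduces s negative :=
  ⟨good_negative, by decide, iff_of_false not_pos_negative h, Nat.zero_le _⟩

theorem small_iff {n k : ℕ} : small n k = true ↔ n ≤ 4 ∨ n ≤ 5 * k := by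
  simp only [small, Bool.or_eq_true, Nat.ble_eq]
  omega

theorem step_spec {s : State} (hg : Good s.1 s.2.1) (h0 : 0 < s.1) :
    Reduces s (step s) ∧ (small (step s).1 (step s).2.2 = true ∨ (step s).1 + 1 ≤ s.1) := by
  obtain ⟨n, ts, k⟩ := s
  dsimp only at hg h0
  simp only [step, stepPack, stepMatching, Bool.cond_eq_ite]
  split_ifs with h1 h2 h3
  · exact ⟨⟨hg, h0, Iff.rfl, le_rfl⟩, .inl h1⟩
  · rw [small_iff, not_or] at h1
    rw [Nat.ble_eq] at h2 h3
    set W := (pack n ts).1 with hWdef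
    set U := uncovered n W with hUdef
    set M := matching n ts U k with hMdef
    have hW := packed_pack hg
    have hU : ∀ x ∈ U, x < n ∧ x ∉ W := fun x => mem_uncovered.1
    have hUn : ∀ x ∈ U, x < n := fun x hx => (hU x hx).1
    have hUd : U.Nodup := nodup_uncovered n W
    obtain ⟨hM, hl⟩ := isMatching_matching (n := n) (ts := ts) hUd k
    rw [← hMdef] at hM hl
    have hl := hl.resolve_right (not_lt.2 h3)
    -- The source of the constant five: if every uncovered leaf were matched, there would be at most
    -- `k` of them besides at most `4k` covered leaves, hence `n ≤ 5k`.
    have hne : unmatched U M ≠ [] := by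
      intro he
      have h4 : U ⊆ M.map Prod.snd := by
        intro x hx
        by_contra hn
        have : x ∈ unmatched U M := mem_unmatched.2 ⟨hx, hn⟩
        simp [he] at this
      have h5 := (hUd.subperm h4).length_le
      have h6 := le_length_uncovered hg
      rw [List.length_map] at h5
      change n ≤ U.length + _ at h6
      omega
    set x := (unmatched U M).headD 0 with hx
    have hxm : x ∈ unmatched U M := by
      cases h : unmatched U M with
      | nil => exact absurd h hne
      | cons y l => simp [hx, h]
    have hxX := mem_alternating_of_unmatched (n := n) hUd hM hxm
    set X := (alternating n ts U M).map Prod.fst with hX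
    have hXU : ∀ y ∈ X, y ∈ U := by
      intro y hy
      obtain ⟨q, hq, rfl⟩ := List.mem_map.1 hy
      exact (searchInv_alternating hUd hM).mem q hq
    have hxn : x < n := hUn x (hXU x hxX)
    refine ⟨⟨good_deleteLeaf (good_edit hg X) hxn, ?_, ?_, Nat.sub_le _ _⟩, .inr ?_⟩
    · change 0 < n - 1
      omega
    · refine (pos_deleteLeaf n x _ _).trans (pos_edit hg hW (fun y hy => hU y (hXU y hy)) hU hM
        (fun t ht y hy hc => exists_mem_matching hUd hUn hM hne hl ht hy hc) hxX h3)
    · change n - 1 + 1 ≤ n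
      omega
  · refine ⟨reduces_negative ?_, .inl (by decide)⟩
    rintro ⟨C, hC, h⟩
    rw [Nat.ble_eq] at h3
    refine h3 (le_trans ?_ h)
    refine (length_le_countP hg (packed_pack hg) (fun x => mem_uncovered.1)
      (isMatching_matching (n := n) (nodup_uncovered n _) k).1 hC).trans
      (List.countP_mono_left fun t _ => ?_)
    simp only [decide_eq_true_eq]
    exact fun h => h.1
  · refine ⟨reduces_negative ?_, .inl (by decide)⟩
    rintro ⟨C, hC, h⟩
    rw [Nat.ble_eq] at h2
    exact h2 ((pack_le_cost hg hC).trans h)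

/-- As long as the state is not small, each round loses a leaf. Since the leaf set stays nonempty,
`n` rounds cannot all do so. -/
theorem kernel_spec {s : State} (hg : Good s.1 s.2.1) (h0 : 0 < s.1) :
    Reduces s (kernel s) ∧ small (kernel s).1 (kernel s).2.2 = true := by
  have key : ∀ i, Reduces s (step^[i] s) ∧
      (small (step^[i] s).1 (step^[i] s).2.2 = true ∨ (step^[i] s).1 + i ≤ s.1) := by
    intro i
    induction i with
    | zero => exact ⟨⟨hg, h0, Iff.rfl, le_rfl⟩, .inr le_rfl⟩
    | succ i ih =>
      rw [Function.iterate_succ_apply']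
      obtain ⟨h1, h2⟩ := ih
      obtain ⟨h3, h4⟩ := step_spec h1.good h1.pos
      refine ⟨h1.trans h3, ?_⟩
      rcases h4 with h4 | h4
      · exact .inl h4
      · rcases h2 with h2 | h2
        · left
          have : step (step^[i] s) = step^[i] s := by rw [step, h2, cond_true]
          rw [this]
          exact h2
        · right; omega
  obtain ⟨h1, h2⟩ := key s.1
  refine ⟨h1, h2.resolve_right ?_⟩
  have := h1.pos
  omega

end RTI

namespace RTI

/-! ### Trees and tree relations -/

namespace BinTree

variable {V : Type*}

/-- The tree displays the rooted triplet `ab|c`. -/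
def Displays : BinTree V → V → V → V → Prop
  | leaf _, _, _, _ => False
  | node l r, a, b, c => Displays l a b c ∨ Displays r a b c ∨ a ≠ b ∧
      (a ∈ l.leaves ∧ b ∈ l.leaves ∧ c ∈ r.leaves ∨ a ∈ r.leaves ∧ b ∈ r.leaves ∧ c ∈ l.leaves)

theorem Displays.mem {T : BinTree V} {a b c : V} (h : T.Displays a b c) :
    a ∈ T.leaves ∧ b ∈ T.leaves ∧ c ∈ T.leaves := by
  induction T with
  | leaf v => exact h.elim
  | node l r hl hr =>
    simp only [leaves, List.mem_append]
    rcases h with h | h | ⟨-, h⟩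
    · have := hl h; tauto
    · have := hr h; tauto
    · tauto

theorem Displays.symm {T : BinTree V} {a b c : V} (h : T.Displays a b c) : T.Displays b a c := by
  induction T with
  | leaf v => exact h
  | node l r hl hr =>
    rcases h with h | h | ⟨h', h⟩
    · exact .inl (hl h)
    · exact .inr (.inl (hr h))
    · exact .inr (.inr ⟨h'.symm, by tauto⟩)

theorem nodup_node {l r : BinTree V} (h : (node l r).leaves.Nodup) :
    l.leaves.Nodup ∧ r.leaves.Nodup ∧ ∀ v, v ∈ l.leaves → v ∈ r.leaves → False := by
  obtain ⟨h1, h2, h3⟩ := List.nodup_append'.1 h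
  exact ⟨h1, h2, fun v hv hv' => h3 hv hv'⟩

theorem Displays.ne {T : BinTree V} (hT : T.leaves.Nodup) {a b c : V} (h : T.Displays a b c) :
    a ≠ b ∧ a ≠ c ∧ b ≠ c := by
  induction T with
  | leaf v => exact h.elim
  | node l r hl hr =>
    obtain ⟨h1, h2, h3⟩ := nodup_node hT
    rcases h with h | h | ⟨h', h⟩
    · exact hl h1 h
    · exact hr h2 h
    · refine ⟨h', ?_, ?_⟩ <;> rintro rfl
      · have := h3 a; tauto
      · have := h3 b; tauto

theorem Displays.asymm {T : BinTree V} (hT : T.leaves.Nodup) {a b c : V}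
    (h : T.Displays a b c) : ¬ T.Displays a c b := by
  induction T with
  | leaf v => exact h.elim
  | node l r hl hr =>
    obtain ⟨h1, h2, h3⟩ := nodup_node hT
    have ha := h3 a
    have hb := h3 b
    have hc := h3 c
    rintro (h' | h' | ⟨-, h'⟩) <;> rcases h with h | h | ⟨-, h⟩
    · exact hl h1 h h'
    · have := h.mem; have := h'.mem; tauto
    · have := h'.mem; tauto
    · have := h.mem; have := h'.mem; tauto
    · exact hr h2 h h'
    · have := h'.mem; tauto
    · have := h.mem; tauto
    · have := h.mem; tauto
    · tauto

theorem displays_total {T : BinTree V} {a b c : V} (ha : a ∈ T.leaves)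
    (hb : b ∈ T.leaves) (hc : c ∈ T.leaves) (hab : a ≠ b) (hac : a ≠ c) (hbc : b ≠ c) :
    T.Displays a b c ∨ T.Displays a c b ∨ T.Displays b c a := by
  induction T with
  | leaf v =>
    simp only [leaves, List.mem_singleton] at ha hb
    exact absurd (ha.trans hb.symm) hab
  | node l r hl hr =>
    simp only [leaves, List.mem_append] at ha hb hc
    rcases ha with ha | ha <;> rcases hb with hb | hb <;> rcases hc with hc | hc
    · exact (hl ha hb hc).imp .inl (.imp .inl .inl)
    · exact .inl (.inr (.inr ⟨hab, .inl ⟨ha, hb, hc⟩⟩))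
    · exact .inr (.inl (.inr (.inr ⟨hac, .inl ⟨ha, hc, hb⟩⟩)))
    · exact .inr (.inr (.inr (.inr ⟨hbc, .inr ⟨hb, hc, ha⟩⟩)))
    · exact .inr (.inr (.inr (.inr ⟨hbc, .inl ⟨hb, hc, ha⟩⟩)))
    · exact .inr (.inl (.inr (.inr ⟨hac, .inr ⟨ha, hc, hb⟩⟩)))
    · exact .inl (.inr (.inr ⟨hab, .inr ⟨ha, hb, hc⟩⟩))
    · exact (hr ha hb hc).imp (.inr ∘ .inl) (.imp (.inr ∘ .inl) (.inr ∘ .inl))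

theorem Displays.trans {T : BinTree V} (hT : T.leaves.Nodup) {a b c : V}
    (h : T.Displays a b c) {d : V} (hd : d ∈ T.leaves) (hbd : b ≠ d) :
    T.Displays d b c ∨ T.Displays a b d := by
  induction T with
  | leaf v => exact h.elim
  | node l r hl hr =>
    obtain ⟨h1, h2, h3⟩ := nodup_node hT
    have hne := h.ne hT
    simp only [leaves, List.mem_append] at hd
    rcases h with h | h | ⟨h', h⟩
    · have hm := h.mem
      rcases hd with hd | hd
      · exact (hl h1 h hd).imp .inl .inl
      · exact .inr (.inr (.inr ⟨hne.1, .inl ⟨hm.1, hm.2.1, hd⟩⟩))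
    · have hm := h.mem
      rcases hd with hd | hd
      · exact .inr (.inr (.inr ⟨hne.1, .inr ⟨hm.1, hm.2.1, hd⟩⟩))
      · exact (hr h2 h hd).imp (.inr ∘ .inl) (.inr ∘ .inl)
    · rcases hd with hd | hd <;> rcases h with ⟨ha, hb, hc⟩ | ⟨ha, hb, hc⟩
      · exact .inl (.inr (.inr ⟨hbd.symm, .inl ⟨hd, hb, hc⟩⟩))
      · exact .inr (.inr (.inr ⟨h', .inr ⟨ha, hb, hd⟩⟩))
      · exact .inr (.inr (.inr ⟨h', .inl ⟨ha, hb, hd⟩⟩))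
      · exact .inl (.inr (.inr ⟨hbd.symm, .inr ⟨hd, hb, hc⟩⟩))

theorem Iso.mem_leaves {T T' : BinTree V} (h : T.Iso T') (v : V) :
    v ∈ T.leaves ↔ v ∈ T'.leaves := by
  induction h with
  | leaf => rfl
  | node _ _ hl hr => simp [leaves, hl, hr]
  | swap _ _ hl hr => simp [leaves, hl, hr, or_comm]

theorem Iso.displays_iff {T T' : BinTree V} (h : T.Iso T') (a b c : V) :
    T.Displays a b c ↔ T'.Displays a b c := by
  induction h with
  | leaf => rfl
  | node h1 h2 hl hr => simp only [Displays, hl, hr, h1.mem_leaves, h2.mem_leaves]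
  | swap h1 h2 hl hr =>
    simp only [Displays, hl, hr, h1.mem_leaves, h2.mem_leaves]
    tauto

open Classical in
theorem leaves_restrict (S : Set V) (T : BinTree V) :
    ((T.restrict S).elim [] leaves) = T.leaves.filter fun v => v ∈ S := by
  induction T with
  | leaf v =>
    by_cases hv : v ∈ S <;> simp [restrict, leaves, hv]
  | node l r hl hr =>
    rw [leaves, List.filter_append, ← hl, ← hr, restrict]
    cases restrict S l <;> cases restrict S r <;> simp [leaves]

theorem displays_restrict {S : Set V} (T : BinTree V) {a b c : V} (ha : a ∈ S) (hb : b ∈ S)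
    (hc : c ∈ S) :
    (T.restrict S).elim False (fun T' => T'.Displays a b c) ↔ T.Displays a b c := by
  classical
  induction T with
  | leaf v =>
    by_cases hv : v ∈ S <;> simp [restrict, hv, Displays]
  | node l r hl hr =>
    have el := leaves_restrict S l
    have er := leaves_restrict S r
    have ml : ∀ v ∈ S, v ∈ l.leaves ↔ v ∈ (l.restrict S).elim [] leaves := by
      intro v hv; rw [el]; simp [hv]
    have mr : ∀ v ∈ S, v ∈ r.leaves ↔ v ∈ (r.restrict S).elim [] leaves := by
      intro v hv; rw [er]; simp [hv]
    rw [Displays, ← hl, ← hr, ml a ha, ml b hb, ml c hc, mr a ha, mr b hb, mr c hc, restrict]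
    cases restrict S l <;> cases restrict S r <;> simp [Displays]

theorem leaves_ne_nil (T : BinTree V) : T.leaves ≠ [] := by
  induction T <;> simp_all [leaves]

theorem length_leaves_pos (T : BinTree V) : 0 < T.leaves.length :=
  List.length_pos_iff.2 T.leaves_ne_nil

theorem eq_leaf_of_length {T : BinTree V} (h : T.leaves.length = 1) : ∃ x, T = leaf x := by
  cases T with
  | leaf v => exact ⟨v, rfl⟩
  | node l r =>
    have := l.length_leaves_pos
    have := r.length_leaves_pos
    rw [leaves, List.length_append] at h
    omega

theorem eq_node_of_length {T : BinTree V} (h : T.leaves.length = 2) :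
    ∃ x y, T = node (leaf x) (leaf y) := by
  cases T with
  | leaf v => simp [leaves] at h
  | node l r =>
    have := l.length_leaves_pos
    have := r.length_leaves_pos
    rw [leaves, List.length_append] at h
    obtain ⟨x, rfl⟩ := eq_leaf_of_length (T := l) (by omega)
    obtain ⟨y, rfl⟩ := eq_leaf_of_length (T := r) (by omega)
    exact ⟨x, y, rfl⟩

theorem eq_node_node_of_length {T : BinTree V} (h : T.leaves.length = 3) :
    (∃ x y z, T = node (leaf x) (node (leaf y) (leaf z))) ∨
      ∃ x y z, T = node (node (leaf x) (leaf y)) (leaf z) := by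
  cases T with
  | leaf v => simp [leaves] at h
  | node l r =>
    have := l.length_leaves_pos
    have := r.length_leaves_pos
    rw [leaves, List.length_append] at h
    rcases (by omega : l.leaves.length = 1 ∧ r.leaves.length = 2 ∨
      l.leaves.length = 2 ∧ r.leaves.length = 1) with ⟨h1, h2⟩ | ⟨h1, h2⟩
    · obtain ⟨x, rfl⟩ := eq_leaf_of_length h1
      obtain ⟨y, z, rfl⟩ := eq_node_of_length h2
      exact .inl ⟨x, y, z, rfl⟩
    · obtain ⟨x, y, rfl⟩ := eq_node_of_length h1
      obtain ⟨z, rfl⟩ := eq_leaf_of_length h2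
      exact .inr ⟨x, y, z, rfl⟩

theorem iso_of_displays {T : BinTree V} (h : T.leaves.length = 3) {a b c : V}
    (hd : T.Displays a b c) : T.Iso (node (node (leaf a) (leaf b)) (leaf c)) := by
  rcases eq_node_node_of_length h with ⟨x, y, z, rfl⟩ | ⟨x, y, z, rfl⟩
  · simp only [Displays, leaves, List.cons_append, List.nil_append,
      List.mem_cons, List.not_mem_nil, or_false, false_or] at hd
    have : c = x ∧ (a = y ∧ b = z ∨ a = z ∧ b = y) := by grind
    obtain ⟨rfl, ⟨rfl, rfl⟩ | ⟨rfl, rfl⟩⟩ := this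
    · exact .swap (.leaf _) (.node (.leaf _) (.leaf _))
    · exact .swap (.leaf _) (.swap (.leaf _) (.leaf _))
  · simp only [Displays, leaves, List.cons_append, List.nil_append,
      List.mem_cons, List.not_mem_nil, or_false, false_or] at hd
    have : c = z ∧ (a = x ∧ b = y ∨ a = y ∧ b = x) := by grind
    obtain ⟨rfl, ⟨rfl, rfl⟩ | ⟨rfl, rfl⟩⟩ := this
    · exact .node (.node (.leaf _) (.leaf _)) (.leaf _)
    · exact .node (.swap (.leaf _) (.leaf _)) (.leaf _)

end BinTree

/-- Restriction preserves displayed triplets on the retained leaves, and a tree with three leaves is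
determined, up to exchanging children, by the triplet that it displays. -/
theorem Triplet.consistentWith_iff {V : Type*} {t : Triplet V} {T : BinTree V} (hT : T.IsOver)
    {a b : V} (hp : t.pair = s(a, b)) : t.ConsistentWith T ↔ T.Displays a b t.apex := by
  classical
  have hab : a ≠ b := by
    have := t.not_isDiag
    rwa [hp, Sym2.mk_isDiag_iff] at this
  have hc := t.apex_notMem
  rw [hp, Sym2.mem_iff, not_or] at hc
  have hS : ∀ v, v ∈ t.leaves ↔ v = a ∨ v = b ∨ v = t.apex := by
    intro v
    rw [Triplet.leaves, Set.mem_ofPred_eq, hp, Sym2.mem_iff, or_assoc]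
  have key := BinTree.displays_restrict T ((hS a).2 (by simp)) ((hS b).2 (by simp))
    ((hS t.apex).2 (by simp))
  constructor
  · rintro ⟨a', b', hp', T', hr, hi⟩
    have h1 : T'.Displays a' b' t.apex := by
      rw [hi.displays_iff]
      have : a' ≠ b' := by
        have := t.not_isDiag
        rwa [hp', Sym2.mk_isDiag_iff] at this
      simp [BinTree.Displays, BinTree.leaves, this]
    have h2 : T'.Displays a b t.apex := by
      rw [hp', Sym2.eq_iff] at hp
      rcases hp with ⟨rfl, rfl⟩ | ⟨rfl, rfl⟩
      · exact h1
      · exact h1.symm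
    rw [hr] at key
    exact key.1 h2
  · intro h
    have h1 := key.2 h
    have h2 := BinTree.leaves_restrict t.leaves T
    cases hr : T.restrict t.leaves with
    | none => rw [hr] at h1; exact h1.elim
    | some T' =>
      rw [hr] at h1 h2
      refine ⟨a, b, hp, T', hr, BinTree.iso_of_displays ?_ h1⟩
      change T'.leaves = _ at h2
      rw [h2, ← List.toFinset_card_of_nodup (hT.1.filter _)]
      rw [show (T.leaves.filter fun v => v ∈ t.leaves).toFinset = {a, b, t.apex} by
        ext v; simp [hT.2 v, hS]]
      exact Finset.card_eq_three.2 ⟨a, b, t.apex, hab, Ne.symm hc.1, Ne.symm hc.2, rfl⟩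

/-- The tree relation on `ℕ` of a tree on the numbers below `n`. -/
def BinTree.extend {n : ℕ} (T : BinTree (Fin n)) (a b c : ℕ) : Prop :=
  a ≠ b ∧ a ≠ c ∧ b ≠ c ∧
    ((∃ (ha : a < n) (hb : b < n) (hc : c < n), T.Displays ⟨a, ha⟩ ⟨b, hb⟩ ⟨c, hc⟩) ∨
      n ≤ c ∧ a < c ∧ b < c)

/-- The additional leaves `n`, `n + 1`, … are attached one after another above the root, so the
largest leaf of a triple is its apex as soon as it is at least `n`. -/
theorem BinTree.treeRel_extend {n : ℕ} {T : BinTree (Fin n)} (hT : T.IsOver) :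
    TreeRel T.extend where
  ne h := ⟨h.1, h.2.1, h.2.2.1⟩
  symm := by
    rintro a b c ⟨h1, h2, h3, ⟨ha, hb, hc, h⟩ | h⟩
    · exact ⟨h1.symm, h3, h2, .inl ⟨hb, ha, hc, h.symm⟩⟩
    · exact ⟨h1.symm, h3, h2, .inr (by omega)⟩
  asymm := by
    rintro a b c ⟨-, -, -, ⟨ha, hb, hc, h⟩ | h⟩ ⟨-, -, -, ⟨ha', hb', hc', h'⟩ | h'⟩
    · exact h.asymm hT.1 h'
    · omega
    · omega
    · omega
  total := by
    intro a b c h1 h2 h3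
    by_cases h : a < n ∧ b < n ∧ c < n
    · obtain ⟨ha, hb, hc⟩ := h
      rcases displays_total (hT.2 ⟨a, ha⟩) (hT.2 ⟨b, hb⟩) (hT.2 ⟨c, hc⟩) (by simpa using h1)
        (by simpa using h2) (by simpa using h3) with h | h | h
      · exact .inl ⟨h1, h2, h3, .inl ⟨ha, hb, hc, h⟩⟩
      · exact .inr (.inl ⟨h2, h1, h3.symm, .inl ⟨ha, hc, hb, h⟩⟩)
      · exact .inr (.inr ⟨h3, h1.symm, h2.symm, .inl ⟨hb, hc, ha, h⟩⟩)
    · rcases (by omega : n ≤ c ∧ a < c ∧ b < c ∨ n ≤ b ∧ a < b ∧ c < b ∨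
        n ≤ a ∧ b < a ∧ c < a) with h | h | h
      · exact .inl ⟨h1, h2, h3, .inr h⟩
      · exact .inr (.inl ⟨h2, h1, h3.symm, .inr h⟩)
      · exact .inr (.inr ⟨h3, h1.symm, h2.symm, .inr h⟩)
  trans := by
    rintro a b c d ⟨h1, h2, h3, h⟩ hbd
    by_cases had : a = d
    · subst had; exact .inl ⟨h1, h2, h3, h⟩
    by_cases hcd : c = d
    · subst hcd; exact .inr ⟨h1, h2, h3, h⟩
    have hdb := Ne.symm hbd
    have hdc := Ne.symm hcd
    rcases h with ⟨ha, hb, hc, h⟩ | h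
    · by_cases hd : d < n
      · rcases h.trans hT.1 (hT.2 ⟨d, hd⟩) (by simpa using hbd) with h | h
        · exact .inl ⟨hdb, hdc, h3, .inl ⟨hd, hb, hc, h⟩⟩
        · exact .inr ⟨h1, had, hbd, .inl ⟨ha, hb, hd, h⟩⟩
      · exact .inr ⟨h1, had, hbd, .inr (by omega)⟩
    · by_cases hd : d < c
      · exact .inl ⟨hdb, hdc, h3, .inr (by omega)⟩
      · exact .inr ⟨h1, had, hbd, .inr (by omega)⟩

/-- Rank the leaves by their distance from some `x` in `S`. The leaves of maximal rank form one side
of the root and the others, among them `x`, the other side; both are proper subsets of `S`. The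
facts `low` and `high` determine `C` on triples with different ranks and exclude every triplet that
this split would contradict. -/
theorem TreeRel.exists_tree {C : ℕ → ℕ → ℕ → Prop} (hC : TreeRel C) {n : ℕ}
    (S : Finset (Fin n)) (hS : S.Nonempty) :
    ∃ T : BinTree (Fin n), T.leaves.Nodup ∧ (∀ v, v ∈ T.leaves ↔ v ∈ S) ∧
      ∀ a b c, a ∈ S → b ∈ S → c ∈ S → C a b c → T.Displays a b c := by
  induction S using Finset.strongInduction with
  | H S ih =>
  obtain ⟨x, hx⟩ := hS
  by_cases hS1 : S = {x}
  · subst hS1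
    refine ⟨.leaf x, by simp [BinTree.leaves], by simp [BinTree.leaves], ?_⟩
    intro a b c ha hb hc h
    rw [Finset.mem_singleton] at ha hb
    exact absurd (by rw [ha, hb]) (hC.ne h).1
  have hR : DenseRel n fun a b c => C a b c ∧ a < n ∧ b < n ∧ c < n :=
    { lt := fun h => h.2
      ne := fun h => hC.ne h.1
      symm := fun h => ⟨hC.symm h.1, h.2.2.1, h.2.1, h.2.2.2⟩
      asymm := fun h h' => hC.asymm h.1 h'.1
      total := fun ha hb hc h1 h2 h3 => (hC.total h1 h2 h3).imp (⟨·, ha, hb, hc⟩)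
        (.imp (⟨·, ha, hc, hb⟩) (⟨·, hb, hc, ha⟩)) }
  obtain ⟨r, r0, rpos, hr⟩ := exists_rank hR (x := x) fun a c d h hxd hd =>
    (hC.trans d h.1 hxd).imp (⟨·, hd, h.2.2⟩) (⟨·, h.2.1, h.2.2.1, hd⟩)
  have hr' : ∀ a b : Fin n, a ≠ x → b ≠ x → (C x a b ↔ r a < r b) := by
    intro a b ha hb
    rw [← hr a b a.2 b.2 (by simpa [Fin.ext_iff] using ha) (by simpa [Fin.ext_iff] using hb)]
    simp
  have low : ∀ a b c : Fin n, a ≠ c → a ≠ b → c ≠ b → r a < r b → r c < r b → C a c b := by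
    intro a b c hac hab hcb h1 h2
    have hbx : b ≠ x := by rintro rfl; omega
    by_cases hax : a = x
    · subst hax; exact (hr' c b hac.symm hbx).2 h2
    by_cases hcx : c = x
    · subst hcx; exact hC.symm ((hr' a b hac hbx).2 h1)
    exact hC.of_forces (x := x) (.inl ⟨(hr' a b hax hbx).2 h1, (hr' c b hcx hbx).2 h2⟩)
      (by simpa [Fin.ext_iff] using hac) (by simpa [Fin.ext_iff] using hab)
  have high : ∀ a b c : Fin n, a ≠ c → a ≠ b → c ≠ b → r a = r c → r b < r a → C a c b := by
    intro a b c hac hab hcb h1 h2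
    have hax : a ≠ x := by rintro rfl; omega
    have hcx : c ≠ x := by rintro rfl; omega
    have h3 : C a c x := by
      have n1 := mt (hr' a c hax hcx).1 (by omega)
      have n2 := mt (hr' c a hcx hax).1 (by omega)
      have := hC.total (a := x) (b := a) (c := c) (by simpa [Fin.ext_iff] using hax.symm)
        (by simpa [Fin.ext_iff] using hcx.symm) (by simpa [Fin.ext_iff] using hac)
      tauto
    by_cases hbx : b = x
    · subst hbx; exact h3
    exact hC.of_forces (x := x) (.inr ⟨h3, hC.symm ((hr' b a hbx hax).2 h2)⟩)
      (by simpa [Fin.ext_iff] using hac) (by simpa [Fin.ext_iff] using hab)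
  obtain ⟨m, hm, hmax⟩ := S.exists_max_image (fun a => r a) ⟨x, hx⟩
  have hmpos : 0 < r m := by
    obtain ⟨y, hy, hyx⟩ : ∃ y ∈ S, y ≠ x := by
      by_contra hn
      push Not at hn
      exact hS1 (Finset.eq_singleton_iff_unique_mem.2 ⟨hx, hn⟩)
    have := rpos y (by simpa [Fin.ext_iff] using hyx)
    have := hmax y hy
    omega
  obtain ⟨TA, a1, a2, a3⟩ := ih (S.filter fun a => r a = r m)
    (Finset.filter_ssubset.2 ⟨x, hx, by omega⟩) ⟨m, by simp [hm]⟩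
  obtain ⟨TB, b1, b2, b3⟩ := ih (S.filter fun a => ¬ r a = r m)
    (Finset.filter_ssubset.2 ⟨m, hm, by simp⟩)
    ⟨x, by simp only [Finset.mem_filter]; exact ⟨hx, by omega⟩⟩
  simp only [Finset.mem_filter] at a2 a3 b2 b3
  refine ⟨.node TA TB, ?_, ?_, ?_⟩
  · refine List.nodup_append'.2 ⟨a1, b1, fun v hv hv' => ?_⟩
    exact ((b2 v).1 hv').2 ((a2 v).1 hv).2
  · intro v
    rw [BinTree.leaves, List.mem_append, a2, b2]
    tauto
  · intro a b c ha hb hc h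
    have hne := hC.ne h
    have nab : a ≠ b := by simpa [Fin.ext_iff] using hne.1
    have nac : a ≠ c := by simpa [Fin.ext_iff] using hne.2.1
    have nbc : b ≠ c := by simpa [Fin.ext_iff] using hne.2.2
    have ma := hmax a ha
    have mb := hmax b hb
    have mc := hmax c hc
    simp only [BinTree.Displays, a2, b2]
    by_cases qa : r a = r m <;> by_cases qb : r b = r m <;> by_cases qc : r c = r m
    · exact .inl (a3 a b c ⟨ha, qa⟩ ⟨hb, qb⟩ ⟨hc, qc⟩ h)
    · exact .inr (.inr ⟨nab, .inl ⟨⟨ha, qa⟩, ⟨hb, qb⟩, hc, qc⟩⟩)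
    · exact absurd (high a b c nac nab nbc.symm (by omega) (by omega)) (hC.asymm h)
    · exact absurd (low b a c nbc nab.symm nac.symm (by omega) (by omega))
        (hC.asymm (hC.symm h))
    · exact absurd (high b a c nbc nab.symm nac.symm (by omega) (by omega))
        (hC.asymm (hC.symm h))
    · exact absurd (low a b c nac nab nbc.symm (by omega) (by omega)) (hC.asymm h)
    · exact .inr (.inr ⟨nab, .inr ⟨⟨ha, qa⟩, ⟨hb, qb⟩, hc, qc⟩⟩)
    · exact .inr (.inl (b3 a b c ⟨ha, qa⟩ ⟨hb, qb⟩ ⟨hc, qc⟩ h))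

end RTI

namespace RTI

open While

/-! ### Instances and lists of triples -/

/-- The triple `(a, b, c)` stands for the rooted triplet `ab|c`. -/
def Represents {n : ℕ} (t : Triplet (Fin n)) (s : Triple) : Prop :=
  ∃ a b : Fin n, t.pair = s(a, b) ∧ s = (a.val, b.val, t.apex.val)

section Represents

variable {n : ℕ} {t t' : Triplet (Fin n)} {s : Triple}

theorem Represents.mem_leaves (h : Represents t s) (v : Fin n) :
    v ∈ t.leaves ↔ v.val ∈ s.support := by
  obtain ⟨a, b, hp, rfl⟩ := h
  simp [Triplet.leaves, hp, Triple.mem_support, Fin.ext_iff, or_assoc]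

theorem Represents.lt (h : Represents t s) : s.1 < n ∧ s.2.1 < n ∧ s.2.2 < n := by
  obtain ⟨a, b, hp, rfl⟩ := h
  exact ⟨a.2, b.2, t.apex.2⟩

theorem Represents.ne (h : Represents t s) : s.1 ≠ s.2.1 ∧ s.1 ≠ s.2.2 ∧ s.2.1 ≠ s.2.2 := by
  obtain ⟨a, b, hp, rfl⟩ := h
  have h1 := t.not_isDiag
  have h2 := t.apex_notMem
  rw [hp, Sym2.mk_isDiag_iff] at h1
  rw [hp, Sym2.mem_iff, not_or] at h2
  simp only [ne_eq, Fin.val_inj]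
  exact ⟨h1, Ne.symm h2.1, Ne.symm h2.2⟩

theorem Represents.unique (h : Represents t s) (h' : Represents t' s) : t = t' := by
  obtain ⟨a, b, hp, rfl⟩ := h
  obtain ⟨a', b', hp', he⟩ := h'
  simp only [Prod.mk.injEq, Fin.val_inj] at he
  obtain ⟨rfl, rfl, hc⟩ := he
  exact Triplet.ext (hp.trans hp'.symm) hc

theorem Represents.card_support (h : Represents t s) : s.support.card = 3 := by
  obtain ⟨h1, h2, h3⟩ := h.ne
  exact Finset.card_eq_three.2 ⟨_, _, _, h1, h2, h3, rfl⟩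

theorem exists_represents (hlt : s.1 < n ∧ s.2.1 < n ∧ s.2.2 < n)
    (hne : s.1 ≠ s.2.1 ∧ s.1 ≠ s.2.2 ∧ s.2.1 ≠ s.2.2) : ∃ t : Triplet (Fin n), Represents t s := by
  refine ⟨⟨s(⟨s.1, hlt.1⟩, ⟨s.2.1, hlt.2.1⟩), ⟨s.2.2, hlt.2.2⟩, ?_, ?_⟩, ⟨s.1, hlt.1⟩,
    ⟨s.2.1, hlt.2.1⟩, rfl, rfl⟩
  · rw [Sym2.mk_isDiag_iff, Fin.mk.injEq]
    exact hne.1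
  · rw [Sym2.mem_iff, Fin.mk.injEq, Fin.mk.injEq, not_or]
    exact ⟨Ne.symm hne.2.1, Ne.symm hne.2.2⟩

theorem tripletCode_iff {d : Data} :
    Instance.TripletCode t d ↔ ∃ s, Represents t s ∧ d = Enc.enc s := by
  constructor
  · rintro ⟨a, b, hp, rfl⟩
    exact ⟨_, ⟨a, b, hp, rfl⟩, rfl⟩
  · rintro ⟨_, ⟨a, b, hp, rfl⟩, rfl⟩
    exact ⟨a, b, hp, rfl⟩

theorem Represents.consistentWith_iff (h : Represents t s) {T : BinTree (Fin n)} (hT : T.IsOver) :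
    t.ConsistentWith T ↔ ∃ a b c, T.Displays a b c ∧ s = (a.val, b.val, c.val) := by
  obtain ⟨a, b, hp, rfl⟩ := h
  rw [Triplet.consistentWith_iff hT hp]
  constructor
  · exact fun h => ⟨a, b, _, h, rfl⟩
  · rintro ⟨a', b', c', h, he⟩
    simp only [Prod.mk.injEq, Fin.val_inj] at he
    obtain ⟨rfl, rfl, rfl⟩ := he
    exact h

end Represents

theorem exists_left_of_forall₂ {α β : Type*} {r : α → β → Prop} {l : List α} {m : List β}
    (h : List.Forall₂ r l m) {b : β} (hb : b ∈ m) : ∃ a ∈ l, r a b := by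
  induction h with
  | nil => simp at hb
  | cons h1 h2 ih =>
    rcases List.mem_cons.1 hb with rfl | hb
    · exact ⟨_, by simp, h1⟩
    · obtain ⟨a, ha, hab⟩ := ih hb
      exact ⟨a, by simp [ha], hab⟩

theorem exists_right_of_forall₂ {α β : Type*} {r : α → β → Prop} {l : List α} {m : List β}
    (h : List.Forall₂ r l m) {a : α} (ha : a ∈ l) : ∃ b ∈ m, r a b :=
  exists_left_of_forall₂ h.flip ha

theorem countP_eq_of_forall₂ {α β : Type*} {r : α → β → Prop} {l : List α} {m : List β}
    (h : List.Forall₂ r l m) {p : α → Bool} {q : β → Bool} (hpq : ∀ a b, r a b → p a = q b) :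
    l.countP p = m.countP q := by
  induction h with
  | nil => rfl
  | cons h1 h2 ih => rw [List.countP_cons, List.countP_cons, ih, hpq _ _ h1]

section Lists

variable {n : ℕ} {R : Finset (Triplet (Fin n))} {ts : List (Triplet (Fin n))} {l : List Triple}

theorem good_of_dense (hd : Dense R) (hts : ts.Nodup) (hR : ∀ t, t ∈ ts ↔ t ∈ R)
    (h : List.Forall₂ Represents ts l) : Good n l where
  lt s hs := by
    obtain ⟨t, -, ht⟩ := exists_left_of_forall₂ h hs
    exact ht.lt
  ne s hs := by
    obtain ⟨t, -, ht⟩ := exists_left_of_forall₂ h hs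
    exact ht.ne
  nodup := by
    have inj : ∀ t ∈ ts, ∀ t' ∈ ts, ∀ s s', Represents t s → Represents t' s' →
        s.support = s'.support → t = t' := by
      intro t ht t' ht' s s' hs hs' hss
      classical
      set S : Finset (Fin n) := Finset.univ.filter fun v => v.val ∈ s.support with hS
      have hSc : S.card = 3 := by
        rw [← hs.card_support, ← Finset.card_map Fin.valEmbedding]
        congr 1
        ext v
        simp only [hS, Finset.mem_map, Finset.mem_filter, Finset.mem_univ, true_and,
          Fin.valEmbedding_apply]
        constructor
        · rintro ⟨w, hw, rfl⟩
          exact hw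
        · intro hv
          have hlt := hs.lt
          have : v < n := by
            rcases Triple.mem_support.1 hv with rfl | rfl | rfl
            · exact hlt.1
            · exact hlt.2.1
            · exact hlt.2.2
          exact ⟨⟨v, this⟩, hv, rfl⟩
      refine (hd S hSc).unique ⟨(hR t).1 ht, ?_⟩ ⟨(hR t').1 ht', ?_⟩
      · ext v; simp [hS, hs.mem_leaves]
      · ext v; simp [hS, hs'.mem_leaves, hss]
    clear hR
    induction h with
    | nil => simp
    | @cons t s ts l h1 h2 ih =>
      rw [List.nodup_cons] at hts
      rw [List.map_cons, List.nodup_cons]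
      refine ⟨fun hm => ?_, ih hts.2 fun t ht t' ht' => inj t (by simp [ht]) t' (by simp [ht'])⟩
      obtain ⟨s', hs', he⟩ := List.mem_map.1 hm
      obtain ⟨t', ht', hr⟩ := exists_left_of_forall₂ h2 hs'
      have := inj t (by simp) t' (by simp [ht']) s s' h1 hr he.symm
      exact hts.1 (this ▸ ht')
  exists_mem := by
    intro a b c ha hb hc hab hac hbc
    obtain ⟨t, ⟨htR, ht⟩, -⟩ := hd {⟨a, ha⟩, ⟨b, hb⟩, ⟨c, hc⟩}
      (Finset.card_eq_three.2 ⟨_, _, _, by simpa using hab, by simpa using hac,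
        by simpa using hbc, rfl⟩)
    obtain ⟨s, hs, hr⟩ := exists_right_of_forall₂ h ((hR t).2 htR)
    refine ⟨s, hs, ?_⟩
    ext v
    have hlt := hr.lt
    have key : ∀ hv : v < n, v ∈ s.support ↔ v = a ∨ v = b ∨ v = c := by
      intro hv
      rw [← hr.mem_leaves ⟨v, hv⟩, ht]
      simp
    simp only [Finset.mem_insert, Finset.mem_singleton]
    by_cases hv : v < n
    · exact key hv
    · rw [Triple.mem_support]
      omega

theorem exists_dense_of_good (hg : Good n l) :
    ∃ (R : Finset (Triplet (Fin n))) (ts : List (Triplet (Fin n))), Dense R ∧ ts.Nodup ∧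
      (∀ t, t ∈ ts ↔ t ∈ R) ∧ List.Forall₂ Represents ts l := by
  classical
  obtain ⟨ts, hts⟩ : ∃ ts : List (Triplet (Fin n)), List.Forall₂ Represents ts l := by
    have h : ∀ s ∈ l, ∃ t : Triplet (Fin n), Represents t s :=
      fun s hs => exists_represents (hg.lt s hs) (hg.ne s hs)
    clear hg
    induction l with
    | nil => exact ⟨[], .nil⟩
    | cons s l ih =>
      obtain ⟨t, ht⟩ := h s (by simp)
      obtain ⟨ts, hts⟩ := ih fun s hs => h s (by simp [hs])
      exact ⟨t :: ts, .cons ht hts⟩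
  have hnd : ts.Nodup := by
    have hn := hg.nodup
    clear hg
    induction hts with
    | nil => simp
    | @cons t s ts l h1 h2 ih =>
      rw [List.map_cons, List.nodup_cons] at hn
      refine List.nodup_cons.2 ⟨fun ht => hn.1 ?_, ih hn.2⟩
      obtain ⟨s', hs', hr⟩ := exists_right_of_forall₂ h2 ht
      refine List.mem_map.2 ⟨s', hs', ?_⟩
      obtain ⟨a, b, hp, rfl⟩ := h1
      obtain ⟨a', b', hp', rfl⟩ := hr
      rw [hp, Sym2.eq_iff] at hp'
      rcases hp' with ⟨rfl, rfl⟩ | ⟨rfl, rfl⟩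
      · rfl
      · exact Finset.insert_comm _ _ _
  refine ⟨ts.toFinset, ts, fun S hS => ?_, hnd, by simp, hts⟩
  obtain ⟨a, b, c, hab, hac, hbc, rfl⟩ := Finset.card_eq_three.1 hS
  obtain ⟨s, hs, hsup⟩ := hg.exists_mem a b c a.2 b.2 c.2 (by simpa [Fin.ext_iff] using hab)
    (by simpa [Fin.ext_iff] using hac) (by simpa [Fin.ext_iff] using hbc)
  obtain ⟨t, ht, hr⟩ := exists_left_of_forall₂ hts hs
  refine ⟨t, ⟨by simpa using ht, ?_⟩, ?_⟩
  · ext v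
    rw [hr.mem_leaves, hsup]
    simp [Fin.ext_iff]
  · rintro t' ⟨ht', hl⟩
    obtain ⟨s', hs', hr'⟩ := exists_right_of_forall₂ hts (List.mem_toFinset.1 ht')
    have : s' = s := by
      refine hg.eq_of_support_eq hs' hs ?_
      rw [hsup]
      ext v
      by_cases hv : v < n
      · have h1 := hr'.mem_leaves ⟨v, hv⟩
        rw [hl] at h1
        rw [← h1]
        simp [Fin.ext_iff]
      · have := hr'.lt
        rw [Triple.mem_support]
        simp only [Finset.mem_insert, Finset.mem_singleton]
        omega
    subst this
    exact hr'.unique hr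

open Classical in
theorem card_inconsistent (hts : ts.Nodup) (hR : ∀ t, t ∈ ts ↔ t ∈ R)
    (h : List.Forall₂ Represents ts l) {T : BinTree (Fin n)} (hT : T.IsOver) :
    (inconsistent R T).card = cost T.extend l := by
  have h1 : inconsistent R T = (ts.filter fun t => ¬ t.ConsistentWith T).toFinset := by
    ext t
    simp [inconsistent, hR]
  rw [h1, List.toFinset_card_of_nodup (hts.filter _), ← List.countP_eq_length_filter, cost]
  refine countP_eq_of_forall₂ h fun t s hr => ?_
  rw [decide_eq_decide, hr.consistentWith_iff hT, not_iff_not]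
  have hlt := hr.lt
  have hne := hr.ne
  constructor
  · rintro ⟨a, b, c, hd, rfl⟩
    exact ⟨hne.1, hne.2.1, hne.2.2, .inl ⟨a.2, b.2, c.2, hd⟩⟩
  · rintro ⟨-, -, -, ⟨ha, hb, hc, hd⟩ | h⟩
    · exact ⟨_, _, _, hd, rfl⟩
    · omega

/-- A tree is extended to `ℕ` in one direction. In the other, a tree that displays all triplets of
`C` on the leaf set misses no more than `C` does. -/
theorem exists_tree_iff_pos (hn : 0 < n) (hts : ts.Nodup) (hR : ∀ t, t ∈ ts ↔ t ∈ R)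
    (h : List.Forall₂ Represents ts l) (k : ℕ) :
    (∃ T : BinTree (Fin n), T.IsOver ∧ (inconsistent R T).card ≤ k) ↔ Pos l k := by
  classical
  constructor
  · rintro ⟨T, hT, hk⟩
    exact ⟨T.extend, BinTree.treeRel_extend hT, by rwa [← card_inconsistent hts hR h hT]⟩
  · rintro ⟨C, hC, hk⟩
    obtain ⟨T, h1, h2, h3⟩ := hC.exists_tree (Finset.univ : Finset (Fin n)) ⟨⟨0, hn⟩, by simp⟩
    have hT : T.IsOver := ⟨h1, fun v => (h2 v).2 (by simp)⟩
    refine ⟨T, hT, ?_⟩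
    rw [card_inconsistent hts hR h hT]
    refine le_trans (List.countP_mono_left fun s hs => ?_) hk
    simp only [decide_eq_true_eq]
    refine mt fun hin => ?_
    obtain ⟨t, -, hr⟩ := exists_left_of_forall₂ h hs
    have hlt := hr.lt
    have hne := hr.ne
    exact ⟨hne.1, hne.2.1, hne.2.2, .inl ⟨hlt.1, hlt.2.1, hlt.2.2,
      h3 _ _ _ (by simp) (by simp) (by simp) hin⟩⟩

end Lists

/-- The code of an instance is the code of a list of triples. -/
theorem Instance.Code.exists_input {I : Instance} {x : Data} (h : I.Code x) :
    ∃ l : List Triple, x = Enc.enc (I.n, l, Nat.bits I.k) ∧ Good I.n l ∧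
      (I.Positive ↔ Pos l I.k) := by
  obtain ⟨ts, ds, hts, hR, h, rfl⟩ := h
  obtain ⟨l, hl, hds⟩ : ∃ l, List.Forall₂ Represents ts l ∧ ds = l.map Enc.enc := by
    clear hts hR
    induction h with
    | nil => exact ⟨[], .nil, rfl⟩
    | cons h1 h2 ih =>
      obtain ⟨s, hs, rfl⟩ := tripletCode_iff.1 h1
      obtain ⟨l, hl, rfl⟩ := ih
      exact ⟨s :: l, .cons hs hl, rfl⟩
  subst hds
  exact ⟨l, rfl, good_of_dense I.dense hts hR hl, exists_tree_iff_pos I.n_pos hts hR hl I.k⟩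

theorem exists_instance {n k : ℕ} {l : List Triple} (hn : 0 < n) (hg : Good n l) :
    ∃ J : Instance, J.n = n ∧ J.k = k ∧ J.Code (Enc.enc (n, l, Nat.bits k)) ∧
      (J.Positive ↔ Pos l k) := by
  obtain ⟨R, ts, hd, hts, hR, hl⟩ := exists_dense_of_good hg
  refine ⟨⟨n, hn, R, hd, k⟩, rfl, rfl, ⟨ts, l.map Enc.enc, hts, hR, ?_, rfl⟩,
    exists_tree_iff_pos hn hts hR hl k⟩
  rw [List.forall₂_map_right_iff]
  exact hl.imp fun t s h => tripletCode_iff.2 ⟨s, h, rfl⟩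

/-! ### Binary numbers -/

theorem succBits_bits (n : ℕ) : succBits (Nat.bits n) = Nat.bits (n + 1) := by
  induction n using Nat.strong_induction_on with
  | _ n ih =>
    rcases Nat.even_or_odd' n with ⟨m, rfl | rfl⟩
    · rcases Nat.eq_zero_or_pos m with rfl | hm
      · simp [succBits]
      · rw [Nat.bit0_bits m (by omega), Nat.bit1_bits]
        rfl
    · rw [Nat.bit1_bits, show 2 * m + 1 + 1 = 2 * (m + 1) by ring, Nat.bit0_bits _ (by omega),
        ← ih m (by omega)]
      rfl

theorem toBits_eq (n : ℕ) : toBits n = Nat.bits n := by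
  induction n with
  | zero => simp [toBits]
  | succ n ih =>
    rw [← succBits_bits, ← ih, toBits, Function.iterate_succ_apply', incBits_eq]
    rfl

theorem minNat_eq (a b : ℕ) : minNat a b = min a b := by
  rw [minNat, Bool.cond_eq_ite, min_def]
  simp only [Nat.ble_eq]

theorem capBits_bits (n k : ℕ) : capBits n (Nat.bits k) = min n k := by
  induction k using Nat.strong_induction_on with
  | _ k ih =>
    rcases Nat.even_or_odd' k with ⟨m, rfl | rfl⟩
    · rcases Nat.eq_zero_or_pos m with rfl | hm
      · simp [capBits]
      · have := ih m (by omega)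
        rw [Nat.bit0_bits m (by omega), capBits, List.foldr_cons, minNat_eq, cond_false]
        rw [capBits] at this
        rw [this]
        omega
    · have := ih m (by omega)
      rw [Nat.bit1_bits, capBits, List.foldr_cons, minNat_eq, cond_true]
      rw [capBits] at this
      rw [this]
      omega

end RTI

theorem mainTheorem1 :
    ∃ (P : While.Cmd) (p : Polynomial ℕ),
      ∀ (I : RTI.Instance) (x : While.Data), I.Code x →
        ∃ (J : RTI.Instance) (y : While.Data) (t : ℕ),
          J.Code y ∧ While.Outputs P x y t ∧ t ≤ p.eval x.size ∧
          (J.Positive ↔ I.Positive) ∧ J.k ≤ I.k ∧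
          (1 ≤ I.k → J.n ≤ 5 * I.k) ∧ (I.k = 0 → J.n ≤ 4) := by
  obtain ⟨-, P, T, hT, hP⟩ := RTI.pt_kernelize
  -- The initial stack `nil` has size `1`, which is added to the size of the input.
  obtain ⟨-, p, hp⟩ := hT.comp (.add .id (.const 1))
  refine ⟨P, p, fun I x hx => ?_⟩
  obtain ⟨l, rfl, hg, hpos⟩ := hx.exists_input
  obtain ⟨s, ⟨t, ht, hrun⟩, hs, -⟩ := hP (I.n, l, Nat.bits I.k) 
    (While.initStore (While.Enc.enc (I.n, l, Nat.bits I.k))) (by simp [While.initStore])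
  have hs1 : (While.initStore (While.Enc.enc (I.n, l, Nat.bits I.k)) 1).size = 1 := by
    simp [While.initStore, While.Data.size]
  rw [hs1] at ht
  suffices h : ∃ J : RTI.Instance,
      J.Code (While.Enc.enc (RTI.kernelize (I.n, l, Nat.bits I.k))) ∧
      (J.Positive ↔ I.Positive) ∧ J.k ≤ I.k ∧ (1 ≤ I.k → J.n ≤ 5 * I.k) ∧
      (I.k = 0 → J.n ≤ 4) by
    obtain ⟨J, hJ, h⟩ := h
    exact ⟨J, _, t, hJ, ⟨s, hrun, hs⟩, ht.trans (hp _), h⟩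
  rw [RTI.kernelize, Bool.cond_eq_ite]
  simp only [RTI.capBits_bits]
  split_ifs with hsmall
  · rw [RTI.small_iff] at hsmall
    exact ⟨I, hx, Iff.rfl, le_rfl, by omega, by omega⟩
  · rw [RTI.small_iff] at hsmall
    -- With `k ≥ n` the cap would be `n`, and `n ≤ 5n` would make the instance small. So for an
    -- instance that is not small, the cap does not alter the budget.
    have hk : min I.n I.k = I.k := by omega
    rw [hk] at hsmall ⊢
    obtain ⟨hr, hfin⟩ := RTI.kernel_spec (s := (I.n, l, I.k)) hg I.n_pos
    obtain ⟨J, hJn, hJk, hJ, hJpos⟩ :=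
      RTI.exists_instance (k := (RTI.kernel (I.n, l, I.k)).2.2) hr.pos hr.good
    rw [RTI.small_iff] at hfin
    have hle := hr.le
    dsimp only at hle
    refine ⟨J, ?_, hJpos.trans (hr.pos_iff.trans hpos.symm), by omega, by omega, by omega⟩
    rw [RTI.toInput, RTI.toBits_eq]
    exact hJ
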